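/- **Setting.** Fix an integer $k\ge 1$. For every $N\ge 1$ let $M_N=(M_N(i_1,\dots,i_{2k}))_{i_1,\dots,i_{2k}\in[N]}\in(\mathbb C^N)^{\otimes 2k}$ be a random tensor whose entries are i.i.d. copies of a centered complex random variable $m_N$ with finite moments of all orders, such that for some $c>0$ and $c'\in\mathbb C$, as $N\to\infty$, $$N^k\,\mathbb E|m_N|^2\to c,\qquad N^k\,\mathbb E[m_N^2]\to c',\qquad N^k\,\mathbb E[m_N^{\ell_1}\overline{m_N}^{\,\ell_2}]\to 0\quad\text{for all integers }\ell_1,\ell_2\ge 0\text{ with }\ell_1+\ell_2>2 .$$ *Flattenings.* For $\sigma\in\mathfrak S_{2k}$ let $M_{N,\sigma}\in \mathrm M_{N^k}(\mathbb C)$ be the matrix with entries $$M_{N,\sigma}\big((i_1,\dots,i_k),(i_{k+1},\dots,i_{2k})\big)=M_N\big(i_{\sigma(1)},\dots,i_{\sigma(2k)}\big).$$ *Permutation matrices.* For $\eta\in\mathfrak S_k$ let $U_{N,\eta}$ be the $N^k\times N^k$ matrix with $U_{N,\eta}(v_1\otimes\dots\otimes v_k)=v_{\eta^{-1}(1)}\otimes\dots\otimes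 v_{\eta^{-1}(k)}$, so that $U_{N,\eta}U_{N,\eta'}=U_{N,\eta\eta'}$. For a random matrix $A$ of size $N^k$ put $\Phi_N[A]=\mathbb E[N^{-k}\operatorname{Tr}A]$ and $\mathcal E_N(A)=\sum_{\eta\in\mathfrak S_k}\Phi_N[A\,U_{N,\eta}^*]\,U_{N,\eta}$. For $N\ge k$ the matrices $U_{N,\eta}$ are linearly independent; elements $B_N=\sum_\eta B_N(\eta)U_{N,\eta}$ are said to converge to $b=\sum_\eta b(\eta)u_\eta$ in the group algebra $\mathbb C\mathfrak S_k$ (with $u_\eta u_{\eta'}=u_{\eta\eta'}$, $u_\eta^*=u_{\eta^{-1}}$) if $B_N(\eta)\to b(\eta)$ for every $\eta$. *$\mathfrak S_k^*$-probability spaces.* Such a space is a triple $(\mathcal A,\mathbb C\mathfrak S_k,\mathcal E)$ where $\mathcal A$ is a unital complex $*$-algebra containing $\mathbb C\mathfrak S_k$ as a unital $*$-subalgebra and $\mathcal E:\mathcal A\to\mathbb C\mathfrak S_k$ is linear, unital, completely positive and satisfies $\mathcal E(bab')=b\,\mathcal E(a)\,b'$ for $b,b'\in\mathbb C\mathfrak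 S_k$. A family $(M_{N,j})_{j\in J}$ of random matrices of size $N^k$ converges in $\mathfrak S_k^*$-distribution to $(m_j)_{j\in J}\subset\mathcal A$ if $$\mathcal E_N\big[M_{N,j_1}^{\varepsilon_1}U_{N,\eta_1}\cdots M_{N,j_L}^{\varepsilon_L}U_{N,\eta_L}\big]\longrightarrow\mathcal E\big[m_{j_1}^{\varepsilon_1}u_{\eta_1}\cdots m_{j_L}^{\varepsilon_L}u_{\eta_L}\big]$$ for all $L\ge1$, $j_\ell\in J$, $\varepsilon_\ell\in\{1,*\}$, $\eta_\ell\in\mathfrak S_k$. *Circular families.* The $\mathfrak S_k$-free cumulants are the unique sequence of multilinear maps $\mathcal K_n:\mathcal A^n\to\mathbb C\mathfrak S_k$, $n\ge1$, such that $\mathcal E(a_1\cdots a_n)=\sum_{\xi\in\mathrm{NC}(n)}\mathcal K_\xi(a_1,\dots,a_n)$ for all $n\ge 1$ and $a_1,\dots,a_n\in\mathcal A$, the sum being over the non-crossing partitions of $[n]$. Here $\mathcal K_\xi$ is defined inductively by removing the interval block $B=\{i,\dots,i+n'-1\}$ of $\xi$ with smallest $i$: $\mathcal K_\xi(a_1,\dots,a_n)=\mathcal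 K_{\xi\setminus B}\big(a_1,\dots,a_{i-1}\mathcal K_{n'}(a_i,\dots,a_{i+n'-1}),a_{i+n'},\dots,a_n\big)$ if $i>1$, $\mathcal K_\xi(a_1,\dots,a_n)=\mathcal K_{n'}(a_1,\dots,a_{n'})\,\mathcal K_{\xi\setminus B}(a_{n'+1},\dots,a_n)$ if $i=1$, and $\mathcal K_\emptyset=1$. A family $(m_j)_{j\in J}$ is $\mathfrak S_k$-circular if $\mathcal K_L(m_{j_1}^{\varepsilon_1}b_1,\dots,m_{j_L}^{\varepsilon_L}b_L)=0$ for all $L\ge3$, $j_\ell\in J$, $\varepsilon_\ell\in\{1,*\}$, $b_\ell\in\mathbb C\mathfrak S_k$, and it is centered if $\mathcal K_1(m_j)=\mathcal E(m_j)=0$ for all $j\in J$. *Notation in $\mathfrak S_{2k}$.* For $\eta,\eta'\in\mathfrak S_k$ let $\eta\sqcup\eta'\in\mathfrak S_{2k}$ be given by $i\mapsto\eta(i)$ for $i\le k$ and $i\mapsto\eta'(i-k)+k$ for $i>k$. Let $\tau\in\mathfrak S_{2k}$ be given by $i\mapsto i+k$ for $i\le k$ and $i\mapsto i-k$ for $i>k$.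 **Theorem.** The family $(M_{N,\sigma})_{\sigma\in\mathfrak S_{2k}}$ of flattenings converges in $\mathfrak S_k^*$-distribution, as $N\to\infty$, to a centered $\mathfrak S_k$-circular family $(m_\sigma)_{\sigma\in\mathfrak S_{2k}}$ in some $\mathfrak S_k^*$-probability space $(\mathcal A,\mathbb C\mathfrak S_k,\mathcal E)$. For all $\sigma,\sigma'\in\mathfrak S_{2k}$ and $\eta\in\mathfrak S_k$, its $\mathfrak S_k$-covariances are $$\mathcal E(m_\sigma u_\eta m_{\sigma'}^*)=\begin{cases}c\,u_{\eta'}&\text{if }\sigma=(\eta'\sqcup\eta)\sigma'\text{ for some }\eta'\in\mathfrak S_k,\\0&\text{otherwise,}\end{cases}$$ $$\mathcal E(m_\sigma^* u_\eta m_{\sigma'})=\begin{cases}c\,u_{\eta'}&\text{if }\sigma=(\eta\sqcup\eta')\sigma'\text{ for some }\eta'\in\mathfrak S_k,\\0&\text{otherwise,}\end{cases}$$ $$\mathcal E(m_\sigma u_\eta m_{\sigma'})=\begin{cases}c'\,u_{\eta'}&\text{if }\sigma=\tau(\eta\sqcup\eta')\sigma'\text{ for some }\eta'\in\mathfrak S_k,\\0&\text{otherwise.}\end{cases}$$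 -/

import Mathlib

namespace TensorFlattening

open MeasureTheory ProbabilityTheory Filter Topology
open scoped Matrix ComplexConjugate

/-! ### Random tensors -/

/-- A tensor of order `k + k = 2k` on `ℂ^N`, given by its coordinates. -/
abbrev Tensor (N k : ℕ) : Type := (Fin (k + k) → Fin N) → ℂ

/-- Square matrices of size `N ^ k`, with rows and columns indexed by `[N]^k`. -/
abbrev Mat (N k : ℕ) : Type := Matrix (Fin k → Fin N) (Fin k → Fin N) ℂ

/-- The assumption on the sequence of random tensors `M N` (`M N` lives on the probability space
`(Ω N, P N)`): its entries are i.i.d. with common law `μ N`, which is centered, has finite moments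
of all orders, and satisfies the three asymptotic conditions. -/
structure IsTensorModel (k : ℕ) {Ω : ℕ → Type*} [∀ N, MeasurableSpace (Ω N)]
    (P : ∀ N, Measure (Ω N)) (M : ∀ N, Ω N → Tensor N k) (μ : ℕ → Measure ℂ)
    (c : ℝ) (c' : ℂ) : Prop where
  hasLaw : ∀ N (i : Fin (k + k) → Fin N), HasLaw (fun ω => M N ω i) (μ N) (P N)
  indep : ∀ N, iIndepFun (fun (i : Fin (k + k) → Fin N) (ω : Ω N) => M N ω i) (P N)
  moments : ∀ N (l : ℕ), Integrable (fun z : ℂ => ‖z‖ ^ l) (μ N)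
  centered : ∀ N, ∫ z, z ∂(μ N) = 0
  c_pos : 0 < c
  lim_abs_sq : Tendsto (fun N : ℕ => (N : ℝ) ^ k * ∫ z, ‖z‖ ^ 2 ∂(μ N)) atTop (𝓝 c)
  lim_sq : Tendsto (fun N : ℕ => (N : ℂ) ^ k * ∫ z, z ^ 2 ∂(μ N)) atTop (𝓝 c')
  lim_higher : ∀ l₁ l₂ : ℕ, 2 < l₁ + l₂ →
    Tendsto (fun N : ℕ => (N : ℂ) ^ k * ∫ z, z ^ l₁ * (conj z) ^ l₂ ∂(μ N)) atTop (𝓝 0)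

/-- The flattening `M_σ` of a tensor: `M_σ((i_1, …, i_k), (i_{k+1}, …, i_{2k}))` is the entry of
`M` at the multi-index `(i_{σ(1)}, …, i_{σ(2k)})`, the image of `(i_1, …, i_{2k})` under `σ⁻¹` for
the left action `σ · i = i ∘ σ⁻¹` of permutations on multi-indices. -/
def flattening {N k : ℕ} (M : Tensor N k) (σ : Equiv.Perm (Fin (k + k))) : Mat N k :=
  Matrix.of fun i j => M (Fin.append i j ∘ σ)

/-- The permutation matrix `U_η`, mapping the basis vector indexed by `j` to the one indexed by
`η · j = j ∘ η⁻¹`. -/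
def permMatrix (N : ℕ) {k : ℕ} (η : Equiv.Perm (Fin k)) : Mat N k :=
  Matrix.of fun i j => if i = j ∘ η.symm then 1 else 0

/-- The action of `U_η` on simple tensors. -/
theorem permMatrix_mulVec_simple {N k : ℕ} (η : Equiv.Perm (Fin k)) (v : Fin k → Fin N → ℂ) :
    permMatrix N η *ᵥ (fun j => ∏ p, v p (j p)) = fun i => ∏ p, v (η.symm p) (i p) := by
  funext i
  have h : ∀ j : Fin k → Fin N, (i = j ∘ η.symm) ↔ (j = i ∘ η) := by
    intro j
    constructor
    · rintro rfl; funext x; simp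
    · rintro rfl; funext x; simp
  simp only [Matrix.mulVec, dotProduct, permMatrix, Matrix.of_apply, h, ite_mul, one_mul, zero_mul,
    Finset.sum_ite_eq', Finset.mem_univ, if_true, Function.comp_apply]
  exact Fintype.prod_equiv η _ _ (fun x => by simp)

/-- `η ⊔ η'`: `η` acting on the first `k` points and `η'` acting on the last `k` points. -/
def glue {k : ℕ} (η η' : Equiv.Perm (Fin k)) : Equiv.Perm (Fin (k + k)) :=
  finSumFinEquiv.permCongr (Equiv.sumCongr η η')

/-- `τ`: the permutation exchanging the first `k` points and the last `k` points. -/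
def swapHalves (k : ℕ) : Equiv.Perm (Fin (k + k)) :=
  finSumFinEquiv.permCongr (Equiv.sumComm (Fin k) (Fin k))

theorem glue_castAdd {k : ℕ} (η η' : Equiv.Perm (Fin k)) (i : Fin k) :
    glue η η' (Fin.castAdd k i) = Fin.castAdd k (η i) := by
  simp [glue, Equiv.permCongr_apply]

theorem glue_natAdd {k : ℕ} (η η' : Equiv.Perm (Fin k)) (i : Fin k) :
    glue η η' (Fin.natAdd k i) = Fin.natAdd k (η' i) := by
  rw [glue, Equiv.permCongr_apply, finSumFinEquiv_symm_apply_natAdd]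
  simp

theorem swapHalves_castAdd {k : ℕ} (i : Fin k) :
    swapHalves k (Fin.castAdd k i) = Fin.natAdd k i := by
  simp [swapHalves, Equiv.permCongr_apply]

theorem swapHalves_natAdd {k : ℕ} (i : Fin k) :
    swapHalves k (Fin.natAdd k i) = Fin.castAdd k i := by
  rw [swapHalves, Equiv.permCongr_apply, finSumFinEquiv_symm_apply_natAdd]
  simp

/-- `Φ_N`: the normalized expected trace of a random matrix of size `N ^ k`. -/
noncomputable def expTrace {N k : ℕ} {Ω : Type*} [MeasurableSpace Ω] (P : Measure Ω)
    (A : Ω → Mat N k) : ℂ :=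
  ∫ ω, ((N : ℂ) ^ k)⁻¹ * (A ω).trace ∂P

/-- `ℰ_N(A) = ∑_η Φ_N[A U_η^*] U_η`. -/
noncomputable def condExpPerm {N k : ℕ} {Ω : Type*} [MeasurableSpace Ω] (P : Measure Ω)
    (A : Ω → Mat N k) : Mat N k :=
  ∑ η : Equiv.Perm (Fin k), expTrace P (fun ω => A ω * (permMatrix N η)ᴴ) • permMatrix N η

/-! ### The group algebra of the symmetric group as a `*`-algebra -/

/-- The group algebra `ℂ𝔖_k`. -/
abbrev SymAlg (k : ℕ) : Type := MonoidAlgebra ℂ (Equiv.Perm (Fin k))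

/-- The basis element `u_η` of `ℂ𝔖_k`. -/
noncomputable abbrev u {k : ℕ} (η : Equiv.Perm (Fin k)) : SymAlg k := MonoidAlgebra.single η 1

/-- The antilinear involution of `ℂ𝔖_k`, with coefficients `b^*(η) = conj (b(η⁻¹))`. -/
noncomputable instance instStarSymAlg (k : ℕ) : Star (SymAlg k) where
  star b := MonoidAlgebra.ofCoeff
    ((b.coeff.mapRange (fun z : ℂ => conj z) (map_zero _)).equivMapDomain (Equiv.inv _))

theorem star_coeff {k : ℕ} (b : SymAlg k) (η : Equiv.Perm (Fin k)) :
    (star b).coeff η = conj (b.coeff η⁻¹) := by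
  simp [star, Finsupp.equivMapDomain_apply]

theorem star_single {k : ℕ} (η : Equiv.Perm (Fin k)) (z : ℂ) :
    star (MonoidAlgebra.single η z : SymAlg k) = MonoidAlgebra.single η⁻¹ (conj z) := by
  ext g
  rw [star_coeff, MonoidAlgebra.coeff_single, MonoidAlgebra.coeff_single]
  classical
  rw [Finsupp.single_apply, Finsupp.single_apply]
  by_cases h : η = g⁻¹
  · subst h; simp
  · have h' : η⁻¹ ≠ g := fun e => h (by rw [← e, inv_inv])
    simp [h, h']

noncomputable instance instStarRingSymAlg (k : ℕ) : StarRing (SymAlg k) where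
  star_involutive b := by
    ext η
    simp [star_coeff]
  star_add a b := by
    ext η
    simp [star_coeff]
  star_mul a b := by
    have hadd : ∀ x y : SymAlg k, star (x + y) = star x + star y := by
      intro x y
      ext η
      simp [star_coeff]
    have hzero : star (0 : SymAlg k) = 0 := by
      ext η
      simp [star_coeff]
    induction a using MonoidAlgebra.induction_linear with
    | zero => simp [hzero]
    | add x y hx hy => rw [add_mul, hadd, hx, hy, hadd, mul_add]
    | single g r =>
      induction b using MonoidAlgebra.induction_linear with
      | zero => simp [hzero]
      | add x y hx hy => rw [mul_add, hadd, hx, hy, hadd, add_mul]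
      | single h t =>
        simp only [MonoidAlgebra.single_mul_single, star_single, mul_inv_rev, map_mul, mul_comm]

/-- Convergence of a sequence of elements of `ℂ𝔖_{N,k} = span (U_η)_η` to an element of `ℂ𝔖_k`:
the coefficients of `B N` (which are unique for `N ≥ k`) converge to those of `b`. -/
def ConvergesToSym {k : ℕ} (B : ∀ N, Mat N k) (b : SymAlg k) : Prop :=
  ∃ β : ℕ → Equiv.Perm (Fin k) → ℂ,
    (∀ᶠ N in atTop, B N = ∑ η, β N η • permMatrix N η) ∧
    ∀ η, Tendsto (fun N => β N η) atTop (𝓝 (b.coeff η))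

/-! ### Operator-valued probability spaces over `ℂ𝔖_k` -/

/-- Positive elements of a `*`-ring: finite sums of elements `x^* x`. -/
def IsPos {R : Type*} [Ring R] [StarRing R] (a : R) : Prop :=
  a ∈ AddSubmonoid.closure (Set.range fun x : R => star x * x)

/-- An operator-valued `*`-probability space over `ℂ𝔖_k` with underlying `*`-algebra `A`.
The map `incl` is automatically injective, see `OVSpace.incl_injective`. -/
structure OVSpace (k : ℕ) (A : Type*) [Ring A] [StarRing A] [Algebra ℂ A] where
  /-- The inclusion of `ℂ𝔖_k` in `A`. -/
  incl : SymAlg k →⋆ₐ[ℂ] A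
  /-- The conditional expectation. -/
  E : A →ₗ[ℂ] SymAlg k
  E_one : E 1 = 1
  E_bimodule : ∀ (b : SymAlg k) (a : A) (b' : SymAlg k), E (incl b * a * incl b') = b * E a * b'
  completely_positive : ∀ (p : ℕ) (X : Matrix (Fin p) (Fin p) A), IsPos X → IsPos (X.map E)

theorem OVSpace.E_incl {k : ℕ} {A : Type*} [Ring A] [StarRing A] [Algebra ℂ A]
    (S : OVSpace k A) (b : SymAlg k) : S.E (S.incl b) = b := by
  have h := S.E_bimodule b 1 1
  simpa [S.E_one] using h

theorem OVSpace.incl_injective {k : ℕ} {A : Type*} [Ring A] [StarRing A] [Algebra ℂ A]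
    (S : OVSpace k A) : Function.Injective S.incl :=
  Function.LeftInverse.injective S.E_incl

/-- `a^ε` for `ε ∈ {1, *}`; `true` stands for `*`. -/
def adj {R : Type*} [Star R] (ε : Bool) (a : R) : R := if ε then star a else a

/-- Convergence in `𝔖_k^*`-distribution of a family `(X N j)_{j ∈ J}` of random matrices. -/
def ConvergesInSymDistribution {k : ℕ} {Ω : ℕ → Type*} [∀ N, MeasurableSpace (Ω N)]
    (P : ∀ N, Measure (Ω N)) {J : Type*} (X : ∀ N, J → Ω N → Mat N k)
    {A : Type*} [Ring A] [StarRing A] [Algebra ℂ A] (S : OVSpace k A) (m : J → A) : Prop :=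
  ∀ L : ℕ, 1 ≤ L → ∀ (j : Fin L → J) (ε : Fin L → Bool) (η : Fin L → Equiv.Perm (Fin k)),
    ConvergesToSym
      (fun N => condExpPerm (P N) fun ω =>
        (List.ofFn fun l => adj (ε l) (X N (j l) ω) * permMatrix N (η l)).prod)
      (S.E (List.ofFn fun l => adj (ε l) (m (j l)) * S.incl (u (η l))).prod)

/-! ### Operator-valued free cumulants -/

/-- A partition of `[n]` is non-crossing if there are no `i < j < p < q` with `i, p` in one block
and `j, q` in another block. -/
def IsNonCrossing {n : ℕ} (ξ : Finpartition (Finset.univ : Finset (Fin n))) : Prop :=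
  ∀ B ∈ ξ.parts, ∀ B' ∈ ξ.parts, ∀ i ∈ B, ∀ p ∈ B, ∀ j ∈ B', ∀ q ∈ B',
    i < j → j < p → p < q → B = B'

/-- `B` is an interval block of the collection of blocks `ξ`: no position occupied by `ξ` outside
of `B` lies between two positions of `B`. -/
def IsIntervalBlock {ι : Type*} [LinearOrder ι] (ξ : Finset (Finset ι)) (B : Finset ι) : Prop :=
  B ∈ ξ ∧ ∀ x ∈ B, ∀ z ∈ B, ∀ y ∈ ξ.sup id, x < y → y < z → y ∈ B

/-- `B` is the interval block of smallest indices of `ξ`. -/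
def IsFirstIntervalBlock {ι : Type*} [LinearOrder ι] (ξ : Finset (Finset ι)) (B : Finset ι) :
    Prop :=
  IsIntervalBlock ξ B ∧ ∀ B', IsIntervalBlock ξ B' → ∃ x ∈ B, ∀ y ∈ B', x ≤ y

/-- The value of a sequence of maps `𝓜_n` on the arguments `a_i` with `i` in the block `B`, taken in
increasing order. -/
noncomputable def blockValue {k : ℕ} {A : Type*} (M : ∀ n : ℕ, (Fin n → A) → SymAlg k)
    {ι : Type*} [LinearOrder ι] (B : Finset ι) (a : ι → A) : SymAlg k :=
  M B.card fun i => a (B.orderEmbOfFin rfl i)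

open Classical in
/-- The extension `𝓜_ξ` of a sequence of maps `𝓜_n` to a non-crossing partition `ξ`, evaluated
at `(a_i)`. One removes the interval block `B` of smallest indices, and multiplies the last
remaining argument before `B` on the right by the value of `𝓜` on `B`; if `B` is at the beginning,
the value of `𝓜` on `B` multiplies the result on the left. The positions are not shifted when `B`
is removed: the positions of `ξ` are the elements of the union of its blocks. -/
noncomputable def nested {k : ℕ} {A : Type*} [Ring A] [StarRing A] [Algebra ℂ A] (S : OVSpace k A)
    (M : ∀ n : ℕ, (Fin n → A) → SymAlg k) {ι : Type*} [LinearOrder ι]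
    (ξ : Finset (Finset ι)) (a : ι → A) : SymAlg k :=
  if h : ∃ B, IsFirstIntervalBlock ξ B then
    let B := h.choose
    let b : SymAlg k := blockValue M B a
    let before : Finset ι := ((ξ.erase B).sup id).filter fun x => ∀ y ∈ B, x < y
    if hne : before.Nonempty then
      nested S M (ξ.erase B)
        (Function.update a (before.max' hne) (a (before.max' hne) * S.incl b))
    else
      b * nested S M (ξ.erase B) a
  else 1
termination_by ξ.card
decreasing_by
  all_goals exact Finset.card_erase_lt_of_mem h.choose_spec.1.1

open Classical in
/-- `K` is the collection of `𝔖_k`-free cumulants: multilinear maps satisfying the moment-cumulant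
relation over non-crossing partitions (which determines `K n` for all `n ≥ 1`, by induction). -/
def IsFreeCumulants {k : ℕ} {A : Type*} [Ring A] [StarRing A] [Algebra ℂ A] (S : OVSpace k A)
    (K : ∀ n : ℕ, MultilinearMap ℂ (fun _ : Fin n => A) (SymAlg k)) : Prop :=
  ∀ n : ℕ, 1 ≤ n → ∀ a : Fin n → A,
    S.E (List.ofFn a).prod =
      ∑ ξ : Finpartition (Finset.univ : Finset (Fin n)) with IsNonCrossing ξ,
        nested S (fun n => K n) ξ.parts a

/-- A family is `𝔖_k`-circular if its cumulants of order greater than two vanish. -/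
def IsSymCircular {k : ℕ} {A : Type*} [Ring A] [StarRing A] [Algebra ℂ A] (S : OVSpace k A)
    {J : Type*} (m : J → A) : Prop :=
  ∃ K : ∀ n : ℕ, MultilinearMap ℂ (fun _ : Fin n => A) (SymAlg k), IsFreeCumulants S K ∧
    ∀ L : ℕ, 3 ≤ L → ∀ (j : Fin L → J) (ε : Fin L → Bool) (b : Fin L → SymAlg k),
      K L (fun l => adj (ε l) (m (j l)) * S.incl (b l)) = 0

/-- A family is centered if `ℰ(m_j) = 0` (the first cumulant) for all `j`. -/
def IsCentered {k : ℕ} {A : Type*} [Ring A] [StarRing A] [Algebra ℂ A] (S : OVSpace k A)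
    {J : Type*} (m : J → A) : Prop :=
  ∀ j, S.E (m j) = 0

end TensorFlattening

namespace TensorFlattening

open MeasureTheory ProbabilityTheory Filter Topology
open scoped Matrix ComplexConjugate

/-! ### Permutations acting on concatenated multi-indices -/

/-! The proof is the method of moments. The normalized trace of a word in the flattenings, closed by
`U_ζ^*`, is expanded over the multi-indices at which the successive factors read the tensor.
Grouping these by the partition `π` of the positions that read the same entry, independence factors
the expectation over the blocks. The result is the exact formula `expTrace_prod_flattening`: a sum
over `π` of the product of `N^k` times the mixed moment of each block, multiplied by a count
`kerCount`. The moment factors converge, with limit `0` unless the block has two elements, and the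
counts lie between `0` and `1`. Hence only pairings survive. For these `kerCount` may be replaced by
`loopCount`, in which distinct blocks are allowed to carry the same multi-index: coincidences cost a
factor of order `1/N`, and the blocks can now be summed out one at a time.

The core is the contraction of two adjacent letters with the same multi-index. A letter is a matrix
unit whose position is read through a permutation `ρ` of the `2k` points. If `ρ = τ(1 ⊔ η)ρ'`,
summing over the common multi-index gives exactly `N^k U_η`; otherwise every entry of the sum is at
most `N^(k-1)`. In the first case the pair disappears and `U_η` is absorbed by the preceding letter,
or by the closing permutation when there is none; in the second the count is at most `1/N`. It is
also at most `1/N` for a nonempty pairing without interval pair, because its last new label is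
followed by a label already used. So crossing pairings are negligible. For a non-crossing pairing,
removing interval pairs is the recursion that defines `nested`, with second cumulant equal to the
contraction; this is `tendsto_loopCount_nested`.

The limit lives on the universal `*`-algebra `FlatAlg k` generated by the symbols `m_σ` and by
`ℂ𝔖_k`, with `ℰ` defined coefficientwise as the limit of `ℰ_N`. Bimodularity, compatibility with `*`
and positivity of the coefficient at `1` of `ℰ(a^* a)` hold at finite `N` and pass to the limit.
Complete positivity follows because a matrix over `ℂ𝔖_k` is positive once its associated scalar
kernel is positive semidefinite (`isPos_of_posSemidef`).

Free cumulants are constructed by recursion for any `OVSpace`. Comparing the moment-cumulant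
relation with the limit formula over pairings, a strong induction on the order kills every cumulant
of positive order other than two (`IsTensorModel.cumulant_eq_zero`). The covariances are the case of
two letters, and the three conditions on `σ, σ'` are the matching condition rewritten. -/

theorem append_comp_glue {N k : ℕ} (i j : Fin k → Fin N) (η η' : Equiv.Perm (Fin k)) :
    Fin.append i j ∘ glue η η' = Fin.append (i ∘ η) (j ∘ η') := by
  funext x
  refine Fin.addCases (fun p => ?_) (fun p => ?_) x
  · simp [-Fin.natAdd_eq_addNat, glue_castAdd]
  · simp [-Fin.natAdd_eq_addNat, glue_natAdd]

theorem append_comp_swapHalves {N k : ℕ} (i j : Fin k → Fin N) :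
    Fin.append i j ∘ swapHalves k = Fin.append j i := by
  funext x
  refine Fin.addCases (fun p => ?_) (fun p => ?_) x
  · simp [-Fin.natAdd_eq_addNat, swapHalves_castAdd]
  · simp [-Fin.natAdd_eq_addNat, swapHalves_natAdd]

theorem glue_mul {k : ℕ} (η₁ η₂ η₁' η₂' : Equiv.Perm (Fin k)) :
    glue η₁ η₂ * glue η₁' η₂' = glue (η₁ * η₁') (η₂ * η₂') := by
  ext x
  refine Fin.addCases (fun p => ?_) (fun p => ?_) x
  · simp [-Fin.natAdd_eq_addNat, glue_castAdd]
  · simp [-Fin.natAdd_eq_addNat, glue_natAdd]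

theorem glue_one {k : ℕ} : glue (1 : Equiv.Perm (Fin k)) 1 = 1 := by
  ext x
  refine Fin.addCases (fun p => ?_) (fun p => ?_) x
  · simp [-Fin.natAdd_eq_addNat, glue_castAdd]
  · simp [-Fin.natAdd_eq_addNat, glue_natAdd]

theorem glue_inv {k : ℕ} (η η' : Equiv.Perm (Fin k)) : (glue η η')⁻¹ = glue η⁻¹ η'⁻¹ := by
  rw [inv_eq_iff_mul_eq_one, glue_mul]
  simp [-Fin.natAdd_eq_addNat, glue_one]

theorem swapHalves_mul_self (k : ℕ) : swapHalves k * swapHalves k = 1 := by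
  ext x
  refine Fin.addCases (fun p => ?_) (fun p => ?_) x
  · simp [-Fin.natAdd_eq_addNat, swapHalves_castAdd, swapHalves_natAdd]
  · simp [-Fin.natAdd_eq_addNat, swapHalves_castAdd, swapHalves_natAdd]

theorem swapHalves_mul_glue {k : ℕ} (η η' : Equiv.Perm (Fin k)) :
    swapHalves k * glue η η' = glue η' η * swapHalves k := by
  ext x
  refine Fin.addCases (fun p => ?_) (fun p => ?_) x
  · simp [-Fin.natAdd_eq_addNat, glue_castAdd, glue_natAdd, swapHalves_castAdd]
  · simp [-Fin.natAdd_eq_addNat, glue_castAdd, glue_natAdd, swapHalves_natAdd]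

theorem glue_injective {k : ℕ} {η₁ η₂ η₁' η₂' : Equiv.Perm (Fin k)}
    (h : glue η₁ η₂ = glue η₁' η₂') : η₁ = η₁' ∧ η₂ = η₂' := by
  constructor
  · ext p
    have := congrArg (fun f => f (Fin.castAdd k p)) h
    simpa [-Fin.natAdd_eq_addNat, glue_castAdd, Fin.ext_iff] using this
  · ext p
    have := congrArg (fun f => f (Fin.natAdd k p)) h
    simpa [-Fin.natAdd_eq_addNat, glue_natAdd, Fin.ext_iff] using this

/-- A permutation fixing the first half pointwise acts on the second half only. -/
theorem exists_eq_glue_one {k : ℕ} (π : Equiv.Perm (Fin (k + k)))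
    (h : ∀ p, π (Fin.castAdd k p) = Fin.castAdd k p) :
    ∃ η, π = glue 1 η := by
  have hmem : (finSumFinEquiv.permCongr.symm π : Equiv.Perm (Fin k ⊕ Fin k)) ∈
      (Equiv.Perm.sumCongrHom (Fin k) (Fin k)).range := by
    -- On a finite set, preserving the left summand forces preserving the right one.
    apply Equiv.Perm.mem_sumCongrHom_range_of_perm_mapsTo_inl
    rintro _ ⟨p, rfl⟩
    refine ⟨p, ?_⟩
    simp [-Fin.natAdd_eq_addNat, Equiv.permCongr_symm, Equiv.permCongr_apply, h]
  obtain ⟨⟨a, b⟩, hab⟩ := hmem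
  have hπ : π = glue a b := by
    rw [glue, ← Equiv.symm_apply_eq]
    exact hab.symm
  refine ⟨b, ?_⟩
  have ha : a = 1 := by
    ext p
    have := h p
    rw [hπ, glue_castAdd] at this
    simpa [-Fin.natAdd_eq_addNat, Fin.ext_iff] using this
  rw [hπ, ha]

/-- The pairs of permutations `ρ, ρ'` whose contraction is asymptotically the permutation `η`. -/
def Matches {k : ℕ} (ρ ρ' : Equiv.Perm (Fin (k + k))) (η : Equiv.Perm (Fin k)) : Prop :=
  ρ = swapHalves k * glue 1 η * ρ'

/-- Cancellation in the group. It makes `contraction` independent of the choice of a matching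
permutation. -/
theorem Matches.unique {k : ℕ} {ρ ρ' : Equiv.Perm (Fin (k + k))} {η η' : Equiv.Perm (Fin k)}
    (h : Matches ρ ρ' η) (h' : Matches ρ ρ' η') : η = η' := by
  unfold Matches at h h'
  rw [h] at h'
  exact (glue_injective (mul_left_cancel (mul_right_cancel h'))).2

/-! ### Matrix units and permutation matrices with real entries -/

/-- The matrix unit whose position is given by the multi-index `v` read through `ρ`. -/
def unitMat {N k : ℕ} (ρ : Equiv.Perm (Fin (k + k))) (v : Fin (k + k) → Fin N) :
    Matrix (Fin k → Fin N) (Fin k → Fin N) ℝ :=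
  Matrix.of fun i j => if Fin.append i j ∘ ρ = v then 1 else 0

/-- The permutation matrix `U_η` with real entries. -/
def realPerm (N : ℕ) {k : ℕ} (η : Equiv.Perm (Fin k)) :
    Matrix (Fin k → Fin N) (Fin k → Fin N) ℝ :=
  Matrix.of fun i j => if i = j ∘ η.symm then 1 else 0

section Perm

variable {N k : ℕ}

theorem eq_comp_symm_iff {α : Type*} (η : Equiv.Perm (Fin k)) (i j : Fin k → α) :
    i = j ∘ η.symm ↔ j = i ∘ η := by
  constructor
  · rintro rfl; funext x; simp
  · rintro rfl; funext x; simp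

theorem realPerm_mul_apply (η : Equiv.Perm (Fin k))
    (A : Matrix (Fin k → Fin N) (Fin k → Fin N) ℝ) (i j : Fin k → Fin N) :
    (realPerm N η * A) i j = A (i ∘ η) j := by
  simp [Matrix.mul_apply, realPerm, eq_comp_symm_iff]

theorem mul_realPerm_apply (η : Equiv.Perm (Fin k))
    (A : Matrix (Fin k → Fin N) (Fin k → Fin N) ℝ) (i j : Fin k → Fin N) :
    (A * realPerm N η) i j = A i (j ∘ η.symm) := by
  simp [Matrix.mul_apply, realPerm]

theorem realPerm_mul_realPerm (η η' : Equiv.Perm (Fin k)) :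
    realPerm N η * realPerm N η' = realPerm N (η * η') := by
  ext i j
  rw [realPerm_mul_apply]
  simp only [realPerm, Matrix.of_apply, eq_comp_symm_iff]
  rfl

theorem realPerm_one : realPerm N (1 : Equiv.Perm (Fin k)) = 1 := by
  ext i j
  simp only [realPerm, Matrix.one_apply, Matrix.of_apply]
  rfl

/-- A permutation matrix next to a letter only changes the permutation through which that letter
reads its multi-index. Reductions of a word therefore produce words of the same kind. -/
theorem unitMat_mul_realPerm (ρ : Equiv.Perm (Fin (k + k))) (v : Fin (k + k) → Fin N)
    (η : Equiv.Perm (Fin k)) :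
    unitMat ρ v * realPerm N η = unitMat (glue 1 η⁻¹ * ρ) v := by
  ext i j
  rw [mul_realPerm_apply]
  simp only [unitMat, Matrix.of_apply, Equiv.Perm.coe_mul, ← Function.comp_assoc, append_comp_glue]
  rfl

theorem realPerm_mul_unitMat (ρ : Equiv.Perm (Fin (k + k))) (v : Fin (k + k) → Fin N)
    (η : Equiv.Perm (Fin k)) :
    realPerm N η * unitMat ρ v = unitMat (glue η 1 * ρ) v := by
  ext i j
  rw [realPerm_mul_apply]
  simp only [unitMat, Matrix.of_apply, Equiv.Perm.coe_mul, ← Function.comp_assoc, append_comp_glue]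
  rfl

theorem unitMat_nonneg (ρ : Equiv.Perm (Fin (k + k))) (v : Fin (k + k) → Fin N)
    (i j : Fin k → Fin N) : 0 ≤ unitMat ρ v i j := by
  simp only [unitMat, Matrix.of_apply]
  split_ifs <;> norm_num

theorem realPerm_nonneg (η : Equiv.Perm (Fin k)) (i j : Fin k → Fin N) :
    0 ≤ realPerm N η i j := by
  simp only [realPerm, Matrix.of_apply]
  split_ifs <;> norm_num

/-- The multi-index of the position of the matrix unit `unitMat ρ v`. -/
theorem append_comp_eq_iff (ρ : Equiv.Perm (Fin (k + k))) (v : Fin (k + k) → Fin N)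
    (i j : Fin k → Fin N) :
    Fin.append i j ∘ ρ = v ↔
      i = (fun p => v (ρ.symm (Fin.castAdd k p))) ∧ j = fun p => v (ρ.symm (Fin.natAdd k p)) := by
  constructor
  · rintro rfl
    constructor <;> funext p <;> simp [-Fin.natAdd_eq_addNat]
  · rintro ⟨rfl, rfl⟩
    funext x
    obtain ⟨y, rfl⟩ := ρ.symm.surjective x
    refine Fin.addCases (fun p => ?_) (fun p => ?_) y <;> simp [-Fin.natAdd_eq_addNat]

theorem sum_unitMat_apply (ρ : Equiv.Perm (Fin (k + k))) (i j : Fin k → Fin N) :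
    ∑ v, unitMat ρ v i j = 1 := by
  simp [unitMat]

theorem sum_sum_unitMat (ρ : Equiv.Perm (Fin (k + k))) (v : Fin (k + k) → Fin N) :
    ∑ i, ∑ j, unitMat ρ v i j = 1 := by
  simp only [unitMat, Matrix.of_apply, append_comp_eq_iff, ite_and]
  simp

theorem sum_unitMat_row (ρ : Equiv.Perm (Fin (k + k))) (v : Fin (k + k) → Fin N)
    (i : Fin k → Fin N) : ∑ j, unitMat ρ v i j ≤ 1 := by
  rw [← sum_sum_unitMat ρ v]
  exact Finset.single_le_sum (f := fun i => ∑ j, unitMat ρ v i j)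
    (fun i _ => Finset.sum_nonneg fun j _ => unitMat_nonneg ρ v i j) (Finset.mem_univ i)

end Perm

/-- A set of multi-indices in which one coordinate is determined by the others. -/
theorem card_le_of_determined {N k : ℕ} (s : Finset (Fin k → Fin N)) (p : Fin k)
    (h : ∀ i ∈ s, ∀ j ∈ s, (∀ q, q ≠ p → i q = j q) → i = j) : s.card ≤ N ^ (k - 1) := by
  have hcard : Fintype.card ({q : Fin k // q ≠ p} → Fin N) = N ^ (k - 1) := by
    simp [Fintype.card_subtype_compl]
  rw [← hcard, ← Finset.card_univ]
  refine Finset.card_le_card_of_injOn (fun i q => i q.1) (fun _ _ => Finset.mem_coe.2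
    (Finset.mem_univ _)) ?_
  intro i hi j hj hij
  exact h i hi j hj fun q hq => congrFun hij ⟨q, hq⟩

theorem trace_realPerm_one {N k : ℕ} :
    (realPerm N (1 : Equiv.Perm (Fin k))).trace = (N : ℝ) ^ k := by
  simp [realPerm_one, Matrix.trace_one]

theorem trace_realPerm_nonneg {N k : ℕ} (η : Equiv.Perm (Fin k)) :
    0 ≤ (realPerm N η).trace :=
  Finset.sum_nonneg fun i _ => realPerm_nonneg η i i

/-- The trace counts the multi-indices fixed by `η`; at a point moved by `η` the coordinate is
forced to equal another one. -/
theorem trace_realPerm_le {N k : ℕ} {η : Equiv.Perm (Fin k)} (hη : η ≠ 1) :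
    (realPerm N η).trace ≤ (N : ℝ) ^ (k - 1) := by
  obtain ⟨p, hp⟩ : ∃ p, η.symm p ≠ p := by
    by_contra hcon
    push Not at hcon
    apply hη
    ext p
    have := hcon (η p)
    simp at this
    simp [← this]
  have hcard := card_le_of_determined
    (Finset.univ.filter fun i : Fin k → Fin N => i = i ∘ η.symm) p (by
      intro i hi j hj hij
      simp only [Finset.mem_filter, Finset.mem_univ, true_and] at hi hj
      funext q
      by_cases hq : q = p
      · subst hq
        have h1 := congrFun hi q
        have h2 := congrFun hj q
        simp only [Function.comp_apply] at h1 h2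
        rw [h1, h2, hij _ hp]
      · exact hij q hq)
  have : (realPerm N η).trace =
      ((Finset.univ.filter fun i : Fin k → Fin N => i = i ∘ η.symm).card : ℝ) := by
    simp [Matrix.trace, realPerm]
  rw [this]
  exact_mod_cast hcard

/-- The contraction of two matrix units carrying the same multi-index. -/
theorem sum_unitMat_mul_unitMat_apply {N k : ℕ} (ρ ρ' : Equiv.Perm (Fin (k + k)))
    (i j : Fin k → Fin N) :
    (∑ v, unitMat ρ v * unitMat ρ' v) i j =
      ((Finset.univ.filter fun a : Fin k → Fin N =>
        Fin.append i a ∘ ρ = Fin.append a j ∘ ρ').card : ℝ) := by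
  simp only [Matrix.sum_apply, Matrix.mul_apply]
  rw [Finset.sum_comm]
  simp only [unitMat, Matrix.of_apply, ite_mul, one_mul, zero_mul, Finset.sum_ite_eq,
    Finset.mem_univ, if_true]
  simp [eq_comm]

/-- Undoing `ρ'`, the constraint on the summation index `a` becomes the equality of `append a (i ∘
η)` and `append a j`. It does not involve `a`, so all `N^k` values count or none does. -/
theorem sum_unitMat_mul_unitMat_of_matches {N k : ℕ} {ρ ρ' : Equiv.Perm (Fin (k + k))}
    {η : Equiv.Perm (Fin k)} (h : Matches ρ ρ' η) :
    ∑ v, unitMat (N := N) ρ v * unitMat ρ' v = (N : ℝ) ^ k • realPerm N η := by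
  ext i j
  have key : ∀ a : Fin k → Fin N,
      Fin.append i a ∘ ρ = Fin.append a j ∘ ρ' ↔ i = j ∘ η.symm := by
    intro a
    rw [h, Equiv.Perm.coe_mul, Equiv.Perm.coe_mul, ← Function.comp_assoc, ← Function.comp_assoc,
      append_comp_swapHalves, append_comp_glue, eq_comp_symm_iff]
    constructor
    · intro e
      have e' := congrArg (fun f => f ∘ ρ'.symm) e
      simp only [Function.comp_assoc, Equiv.self_comp_symm, Function.comp_id] at e'
      funext p
      have := congrFun e' (Fin.natAdd k p)
      simpa [-Fin.natAdd_eq_addNat] using this.symm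
    · rintro rfl
      simp
  rw [sum_unitMat_mul_unitMat_apply]
  simp only [key, Matrix.smul_apply, realPerm, Matrix.of_apply, smul_eq_mul]
  by_cases hij : i = j ∘ η.symm <;> simp [hij]

/-- If `ρ * ρ'⁻¹` sent every `p` of the first half to its copy in the second half,
`exists_eq_glue_one` would produce a match. So it fails at some `p`, and the constraint read there
expresses `a p` through `i` or through another coordinate of `a`: one degree of freedom is lost. -/
theorem sum_unitMat_mul_unitMat_le {N k : ℕ} {ρ ρ' : Equiv.Perm (Fin (k + k))}
    (h : ¬ ∃ η, Matches ρ ρ' η) (i j : Fin k → Fin N) :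
    (∑ v, unitMat ρ v * unitMat ρ' v) i j ≤ (N : ℝ) ^ (k - 1) := by
  rw [sum_unitMat_mul_unitMat_apply]
  have hp : ∃ p, (ρ * ρ'⁻¹) (Fin.castAdd k p) ≠ Fin.natAdd k p := by
    by_contra hcon
    push Not at hcon
    obtain ⟨η, hη⟩ := exists_eq_glue_one (swapHalves k * (ρ * ρ'⁻¹)) (fun p => by
      rw [Equiv.Perm.mul_apply, hcon, swapHalves_natAdd])
    refine h ⟨η, ?_⟩
    rw [Matches, ← hη, ← mul_assoc, swapHalves_mul_self]
    simp
  obtain ⟨p, hp⟩ := hp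
  have hcard := card_le_of_determined (Finset.univ.filter fun a : Fin k → Fin N =>
        Fin.append i a ∘ ρ = Fin.append a j ∘ ρ') p (by
      intro a ha b hb hab
      simp only [Finset.mem_filter, Finset.mem_univ, true_and] at ha hb
      have hdet : ∀ a : Fin k → Fin N, Fin.append i a ∘ ρ = Fin.append a j ∘ ρ' →
          a p = Fin.append i a ((ρ * ρ'⁻¹) (Fin.castAdd k p)) := by
        intro a ha
        have := congrFun ha (ρ'⁻¹ (Fin.castAdd k p))
        simp only [Function.comp_apply, Equiv.Perm.inv_def, Equiv.apply_symm_apply, Fin.append_left] at this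
        rw [← this]
        rfl
      have h1 := hdet a ha
      have h2 := hdet b hb
      funext q
      by_cases hq : q = p
      · subst hq
        revert h1 h2 hp
        refine Fin.addCases (fun r => ?_) (fun r => ?_) ((ρ * ρ'⁻¹) (Fin.castAdd k q))
        · intro _ h1 h2
          rw [h1, h2]
          simp
        · intro hp h1 h2
          rw [h1, h2]
          simp only [Fin.append_right]
          exact hab r fun e => hp (by rw [e])
      · exact hab q hq)
  exact_mod_cast hcard


/-! ### Averages over labellings -/

section Average

variable {β V : Type*} [Fintype β] [DecidableEq β] [Fintype V]

/-- The average of a function of a labelling of `β` by elements of `V`. -/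
noncomputable def average (f : (β → V) → ℝ) : ℝ :=
  (Fintype.card (β → V) : ℝ)⁻¹ * ∑ γ, f γ

/-- Exchanging the value of `γ` at `b` with `v` is an involution of the pairs `(γ, v)`. -/
theorem sum_sum_update (b : β) (f : (β → V) → ℝ) :
    ∑ γ : β → V, ∑ v : V, f (Function.update γ b v) = Fintype.card V * ∑ γ, f γ := by
  have hinv : Function.Involutive fun x : (β → V) × V => (Function.update x.1 b x.2, x.1 b) := by
    rintro ⟨γ, v⟩
    simp
  rw [← Fintype.sum_prod_type' (f := fun (γ : β → V) (v : V) => f (Function.update γ b v)),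
    ← Equiv.sum_comp hinv.toPerm]
  simp [Fintype.sum_prod_type, Finset.mul_sum]

/-- Averaging first over the value at `b` alone. This is how the labels of a word are summed out one
by one. -/
theorem average_le_of_resample [Nonempty V] (b : β) {f g : (β → V) → ℝ}
    (h : ∀ γ, ∑ v, f (Function.update γ b v) ≤ Fintype.card V * g γ) :
    average f ≤ average g := by
  have hV : (0 : ℝ) < Fintype.card V := by exact_mod_cast Fintype.card_pos
  refine mul_le_mul_of_nonneg_left ?_ (by positivity)
  refine le_of_mul_le_mul_left ?_ hV
  rw [← sum_sum_update b, Finset.mul_sum]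
  exact Finset.sum_le_sum fun γ _ => h γ

theorem average_eq_of_resample [Nonempty V] (b : β) {f g : (β → V) → ℝ}
    (h : ∀ γ, ∑ v, f (Function.update γ b v) = Fintype.card V * g γ) :
    average f = average g := by
  have hV : (0 : ℝ) < Fintype.card V := by exact_mod_cast Fintype.card_pos
  unfold average
  congr 1
  refine mul_left_cancel₀ hV.ne' ?_
  rw [← sum_sum_update b, Finset.mul_sum]
  exact Finset.sum_congr rfl fun γ _ => h γ

theorem average_mono {f g : (β → V) → ℝ} (h : ∀ γ, f γ ≤ g γ) : average f ≤ average g :=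
  mul_le_mul_of_nonneg_left (Finset.sum_le_sum fun γ _ => h γ) (by positivity)

theorem average_nonneg {f : (β → V) → ℝ} (h : ∀ γ, 0 ≤ f γ) : 0 ≤ average f :=
  mul_nonneg (by positivity) (Finset.sum_nonneg fun γ _ => h γ)

theorem average_mul_left (c : ℝ) (f : (β → V) → ℝ) :
    average (fun γ => c * f γ) = c * average f := by
  simp only [average, ← Finset.mul_sum]
  ring

theorem average_const [Nonempty V] (c : ℝ) : average (fun _ : β → V => c) = c := by
  simp [average]

end Average

/-! ### Words of labelled matrix units -/

section Words

variable {N k : ℕ} {β : Type*}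

/-- The sum of the entries of a matrix. -/
def entrySum {m n : Type*} [Fintype m] [Fintype n] (A : Matrix m n ℝ) : ℝ := ∑ i, ∑ j, A i j

/-- The product of the matrix units along a word, the label `b` carrying the multi-index `γ b`. -/
def wordMat (γ : β → Fin (k + k) → Fin N) (w : List (β × Equiv.Perm (Fin (k + k)))) :
    Matrix (Fin k → Fin N) (Fin k → Fin N) ℝ :=
  (w.map fun x => unitMat x.2 (γ x.1)).prod

@[simp] theorem wordMat_nil (γ : β → Fin (k + k) → Fin N) : wordMat γ [] = 1 := rfl

@[simp] theorem wordMat_cons (γ : β → Fin (k + k) → Fin N)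
    (x : β × Equiv.Perm (Fin (k + k))) (w : List (β × Equiv.Perm (Fin (k + k)))) :
    wordMat γ (x :: w) = unitMat x.2 (γ x.1) * wordMat γ w := by
  simp [wordMat]

@[simp] theorem wordMat_append (γ : β → Fin (k + k) → Fin N)
    (w w' : List (β × Equiv.Perm (Fin (k + k)))) :
    wordMat γ (w ++ w') = wordMat γ w * wordMat γ w' := by
  simp [wordMat]

theorem mul_apply_nonneg {n : Type*} [Fintype n] {A B : Matrix n n ℝ} (hA : ∀ i j, 0 ≤ A i j)
    (hB : ∀ i j, 0 ≤ B i j) (i j : n) : 0 ≤ (A * B) i j := by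
  rw [Matrix.mul_apply]
  exact Finset.sum_nonneg fun a _ => mul_nonneg (hA i a) (hB a j)

theorem wordMat_nonneg (γ : β → Fin (k + k) → Fin N)
    (w : List (β × Equiv.Perm (Fin (k + k)))) (i j : Fin k → Fin N) : 0 ≤ wordMat γ w i j := by
  induction w generalizing i j with
  | nil =>
    rw [wordMat_nil, Matrix.one_apply]
    split_ifs <;> norm_num
  | cons x w ih =>
    rw [wordMat_cons]
    exact mul_apply_nonneg (unitMat_nonneg _ _) ih i j

variable [DecidableEq β]

/-- The labels of a word. -/
def labels (w : List (β × Equiv.Perm (Fin (k + k)))) : Finset β := (w.map Prod.fst).toFinset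

@[simp] theorem labels_nil : labels ([] : List (β × Equiv.Perm (Fin (k + k)))) = ∅ := rfl

@[simp] theorem labels_cons (x : β × Equiv.Perm (Fin (k + k)))
    (w : List (β × Equiv.Perm (Fin (k + k)))) : labels (x :: w) = insert x.1 (labels w) := by
  simp [labels]

@[simp] theorem labels_append (w w' : List (β × Equiv.Perm (Fin (k + k)))) :
    labels (w ++ w') = labels w ∪ labels w' := by
  simp [labels]

theorem wordMat_update {b : β} {w : List (β × Equiv.Perm (Fin (k + k)))} (hb : b ∉ labels w)
    (γ : β → Fin (k + k) → Fin N) (v : Fin (k + k) → Fin N) :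
    wordMat (Function.update γ b v) w = wordMat γ w := by
  induction w with
  | nil => rfl
  | cons x w ih =>
    rw [labels_cons, Finset.mem_insert, not_or] at hb
    rw [wordMat_cons, wordMat_cons, ih hb.2, Function.update_of_ne (Ne.symm hb.1)]

theorem entrySum_mul {l m n : Type*} [Fintype l] [Fintype m] [Fintype n] (A : Matrix l m ℝ)
    (B : Matrix m n ℝ) : entrySum (A * B) = ∑ i, ∑ a, A i a * ∑ j, B a j := by
  simp only [entrySum, Matrix.mul_apply, Finset.mul_sum]
  exact Finset.sum_congr rfl fun i _ => Finset.sum_comm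

/-- Used to discard, from the right end of a word, letters and permutation matrices that can only
restrict the count. -/
theorem entrySum_mul_le {n : Type*} [Fintype n] {A B : Matrix n n ℝ}
    (hA : ∀ i j, 0 ≤ A i j) (hB : ∀ i, ∑ j, B i j ≤ 1) : entrySum (A * B) ≤ entrySum A := by
  rw [entrySum_mul]
  exact Finset.sum_le_sum fun i _ => Finset.sum_le_sum fun a _ =>
    mul_le_of_le_one_right (hA i a) (hB a)

theorem trace_le_entrySum {n : Type*} [Fintype n] {A : Matrix n n ℝ} (hA : ∀ i j, 0 ≤ A i j) :
    A.trace ≤ entrySum A :=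
  Finset.sum_le_sum fun i _ => Finset.single_le_sum (f := fun j => A i j) (fun j _ => hA i j)
    (Finset.mem_univ i)

theorem sum_realPerm_row (η : Equiv.Perm (Fin k)) (i : Fin k → Fin N) :
    ∑ j, realPerm N η i j = 1 := by
  simp [realPerm, eq_comp_symm_iff]

theorem card_multiIndex : (Fintype.card (Fin (k + k) → Fin N) : ℝ) = (N : ℝ) ^ k * (N : ℝ) ^ k := by
  simp [pow_add]

theorem sum_unitMat (ρ : Equiv.Perm (Fin (k + k))) :
    ∑ v, unitMat (N := N) ρ v = Matrix.of fun _ _ => 1 := by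
  ext i j
  rw [Matrix.sum_apply, sum_unitMat_apply]
  rfl

variable [Fintype β]

theorem nonempty_multiIndex (hN : 0 < N) : Nonempty (Fin (k + k) → Fin N) :=
  ⟨fun _ => ⟨0, hN⟩⟩

/-- The number of composable labellings of a word. -/
theorem average_entrySum_wordMat_le (hN : 0 < N) (w : List (β × Equiv.Perm (Fin (k + k)))) :
    average (fun γ : β → Fin (k + k) → Fin N => entrySum (wordMat γ w)) ≤
      (N : ℝ) ^ k * ((N : ℝ) ^ k)⁻¹ ^ (labels w).card := by
  have hN' : (0 : ℝ) < (N : ℝ) ^ k := by positivity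
  have := nonempty_multiIndex (k := k) hN
  induction w using List.reverseRecOn with
  | nil =>
    simp [average_const, entrySum, Matrix.one_apply]
  | append_singleton w x ih =>
    -- A repeated label only adds constraints. A new label averages to `N^(-2k)` times the all-ones
    -- matrix, whose row sums are `N^k`, so it contributes `N^(-k)`.
    by_cases hx : x.1 ∈ labels w
    · have : labels (w ++ [x]) = labels w := by simp [hx]
      rw [this]
      refine le_trans (average_mono fun γ => ?_) ih
      rw [wordMat_append]
      refine entrySum_mul_le (wordMat_nonneg _ _) fun i => ?_
      rw [wordMat_cons, wordMat_nil, mul_one]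
      exact sum_unitMat_row _ _ _
    · have hc : (labels (w ++ [x])).card = (labels w).card + 1 := by
        simp [Finset.union_comm, hx]
      have hle : average (fun γ : β → Fin (k + k) → Fin N => entrySum (wordMat γ (w ++ [x]))) ≤
          average (fun γ : β → Fin (k + k) → Fin N =>
            ((N : ℝ) ^ k)⁻¹ * entrySum (wordMat γ w)) := by
        refine average_le_of_resample x.1 fun γ => le_of_eq ?_
        have : ∑ v, entrySum (wordMat (Function.update γ x.1 v) (w ++ [x])) =
            entrySum (wordMat γ w * ∑ v, unitMat x.2 v) := by
          rw [Matrix.mul_sum]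
          simp only [entrySum, Matrix.sum_apply]
          rw [Finset.sum_comm]
          refine Finset.sum_congr rfl fun i _ => ?_
          rw [Finset.sum_comm]
          refine Finset.sum_congr rfl fun j _ => Finset.sum_congr rfl fun v _ => ?_
          rw [wordMat_append, wordMat_update hx, wordMat_cons, Function.update_self, wordMat_nil,
            mul_one]
        rw [this, sum_unitMat, entrySum_mul, card_multiIndex]
        have : ∀ i, ∑ a, wordMat γ w i a * ∑ j : Fin k → Fin N,
            (Matrix.of fun _ _ => (1 : ℝ) : Matrix (Fin k → Fin N) (Fin k → Fin N) ℝ) a j =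
            (N : ℝ) ^ k * ∑ a, wordMat γ w i a := by
          intro i
          simp [Finset.mul_sum, mul_comm]
        simp only [this, ← Finset.mul_sum]
        rw [← entrySum]
        field_simp
      refine hle.trans ?_
      rw [average_mul_left, hc, pow_succ]
      calc ((N : ℝ) ^ k)⁻¹ * average (fun γ : β → Fin (k + k) → Fin N => entrySum (wordMat γ w))
          ≤ ((N : ℝ) ^ k)⁻¹ * ((N : ℝ) ^ k * ((N : ℝ) ^ k)⁻¹ ^ (labels w).card) :=
            mul_le_mul_of_nonneg_left ih (by positivity)
        _ = _ := by ring

/-- The normalized number of labellings of a word that close up along the permutation `ζ`. -/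
noncomputable def loopCount (N : ℕ) (w : List (β × Equiv.Perm (Fin (k + k))))
    (ζ : Equiv.Perm (Fin k)) : ℝ :=
  ((N : ℝ) ^ k)⁻¹ * ((N : ℝ) ^ k) ^ (labels w).card *
    average fun γ : β → Fin (k + k) → Fin N => (wordMat γ w * realPerm N ζ⁻¹).trace

theorem loopCount_nonneg (w : List (β × Equiv.Perm (Fin (k + k)))) (ζ : Equiv.Perm (Fin k)) :
    0 ≤ loopCount N w ζ :=
  mul_nonneg (by positivity) (average_nonneg fun γ => Finset.sum_nonneg fun i _ =>
    mul_apply_nonneg (wordMat_nonneg _ _) (realPerm_nonneg _) i i)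

/-- Asymptotic orthogonality of the permutation matrices for the normalized trace. This is the value
left once all pairs have been removed. -/
theorem tendsto_loopCount_nil (ζ : Equiv.Perm (Fin k)) :
    Tendsto (fun N => loopCount N ([] : List (β × Equiv.Perm (Fin (k + k)))) ζ) atTop
      (𝓝 (if ζ = 1 then 1 else 0)) := by
  have hval : ∀ᶠ N : ℕ in atTop, loopCount N ([] : List (β × Equiv.Perm (Fin (k + k)))) ζ =
      ((N : ℝ) ^ k)⁻¹ * (realPerm N ζ⁻¹).trace := by
    filter_upwards [eventually_gt_atTop 0] with N hN
    have := nonempty_multiIndex (k := k) hN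
    simp [loopCount, average_const]
  refine Tendsto.congr' (EventuallyEq.symm hval) ?_
  by_cases hζ : ζ = 1
  · subst hζ
    rw [if_pos rfl]
    refine tendsto_const_nhds.congr' ?_
    filter_upwards [eventually_gt_atTop 0] with N hN
    rw [inv_one, trace_realPerm_one]
    field_simp
  · rw [if_neg hζ]
    refine squeeze_zero' (Eventually.of_forall fun N => mul_nonneg (by positivity)
      (trace_realPerm_nonneg _)) ?_ tendsto_inv_atTop_nhds_zero_nat
    filter_upwards [eventually_gt_atTop 0] with N hN
    have h := trace_realPerm_le (N := N) (η := ζ⁻¹) (by simpa using hζ)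
    have hk : k ≠ 0 := by
      rintro rfl
      exact hζ (Subsingleton.elim _ _)
    calc ((N : ℝ) ^ k)⁻¹ * (realPerm N ζ⁻¹).trace
        ≤ ((N : ℝ) ^ k)⁻¹ * (N : ℝ) ^ (k - 1) := mul_le_mul_of_nonneg_left h (by positivity)
      _ = (N : ℝ)⁻¹ := by
        obtain ⟨m, rfl⟩ := Nat.exists_eq_succ_of_ne_zero hk
        simp only [Nat.succ_eq_add_one, Nat.add_sub_cancel, pow_succ]
        field_simp

/-- Replacing an interval pair with matching permutations by a permutation matrix. -/
theorem loopCount_of_matches (hN : 0 < N) {b : β} {ρ ρ' : Equiv.Perm (Fin (k + k))}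
    {η : Equiv.Perm (Fin k)} (hη : Matches ρ ρ' η)
    {w₁ w₂ w' : List (β × Equiv.Perm (Fin (k + k)))} (h₁ : b ∉ labels w₁) (h₂ : b ∉ labels w₂)
    {ζ ζ' : Equiv.Perm (Fin k)} (hl : labels w' = labels (w₁ ++ w₂))
    (hw' : ∀ γ : β → Fin (k + k) → Fin N,
      (wordMat γ w' * realPerm N ζ'⁻¹).trace =
        (wordMat γ w₁ * realPerm N η * wordMat γ w₂ * realPerm N ζ⁻¹).trace) :
    loopCount N (w₁ ++ (b, ρ) :: (b, ρ') :: w₂) ζ = loopCount N w' ζ' := by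
  have hN' : (0 : ℝ) < (N : ℝ) ^ k := by positivity
  have := nonempty_multiIndex (k := k) hN
  have hc : (labels (w₁ ++ (b, ρ) :: (b, ρ') :: w₂)).card = (labels w').card + 1 := by
    rw [hl]
    simp [h₁, h₂]
  have havg : average (fun γ : β → Fin (k + k) → Fin N =>
      (wordMat γ (w₁ ++ (b, ρ) :: (b, ρ') :: w₂) * realPerm N ζ⁻¹).trace) =
      average (fun γ : β → Fin (k + k) → Fin N =>
        ((N : ℝ) ^ k)⁻¹ * (wordMat γ w' * realPerm N ζ'⁻¹).trace) := by
    refine average_eq_of_resample b fun γ => ?_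
    have : ∀ v, wordMat (Function.update γ b v) (w₁ ++ (b, ρ) :: (b, ρ') :: w₂) =
        wordMat γ w₁ * (unitMat ρ v * unitMat ρ' v) * wordMat γ w₂ := by
      intro v
      rw [wordMat_append, wordMat_cons, wordMat_cons, wordMat_update h₁, wordMat_update h₂]
      simp only [Function.update_self, mul_assoc]
    simp only [this, ← Matrix.trace_sum, ← Matrix.sum_mul, ← Matrix.mul_sum]
    -- The contraction gives `N^k` out of `N^(2k)` labellings. The remaining `N^(-k)` is compensated
    -- by the normalization of the removed label, so the reduction is an exact equality.
    rw [sum_unitMat_mul_unitMat_of_matches hη, hw', Matrix.mul_smul, Matrix.smul_mul,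
      Matrix.smul_mul, Matrix.trace_smul, card_multiIndex, smul_eq_mul]
    field_simp
  rw [loopCount, loopCount, havg, average_mul_left, hc, pow_succ]
  field_simp

/-- An interval pair without matching permutations makes the count negligible. -/
theorem loopCount_le_of_not_matches (hN : 0 < N) (hk : 1 ≤ k) {b : β}
    {ρ ρ' : Equiv.Perm (Fin (k + k))} (hρ : ¬ ∃ η, Matches ρ ρ' η)
    {w₁ w₂ : List (β × Equiv.Perm (Fin (k + k)))} (h₁ : b ∉ labels w₁) (h₂ : b ∉ labels w₂)
    (ζ : Equiv.Perm (Fin k)) :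
    loopCount N (w₁ ++ (b, ρ) :: (b, ρ') :: w₂) ζ ≤ (N : ℝ)⁻¹ := by
  have hN' : (0 : ℝ) < (N : ℝ) ^ k := by positivity
  have := nonempty_multiIndex (k := k) hN
  -- After a cyclic rotation `U_ζ^*` stands between `w₂` and `w₁`. The first letter of `w₁` absorbs
  -- it; if `w₁` is empty it is dropped, its row sums being `1`.
  obtain ⟨w', hl, hw'⟩ : ∃ w' : List (β × Equiv.Perm (Fin (k + k))),
      labels w' = labels (w₁ ++ w₂) ∧ ∀ γ : β → Fin (k + k) → Fin N,
        entrySum (wordMat γ w₂ * realPerm N ζ⁻¹ * wordMat γ w₁) = entrySum (wordMat γ w') := by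
    cases w₁ with
    | nil =>
      refine ⟨w₂, rfl, fun γ => ?_⟩
      rw [wordMat_nil, mul_one, entrySum_mul]
      simp [sum_realPerm_row, entrySum]
    | cons x w₁ =>
      refine ⟨w₂ ++ (x.1, glue ζ⁻¹ 1 * x.2) :: w₁, ?_, fun γ => ?_⟩
      · simp [Finset.union_comm]
      · rw [wordMat_append, wordMat_cons, wordMat_cons, ← realPerm_mul_unitMat]
        simp only [mul_assoc]
  have hc : (labels (w₁ ++ (b, ρ) :: (b, ρ') :: w₂)).card = (labels w').card + 1 := by
    rw [hl]
    simp [h₁, h₂]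
  have havg : average (fun γ : β → Fin (k + k) → Fin N =>
      (wordMat γ (w₁ ++ (b, ρ) :: (b, ρ') :: w₂) * realPerm N ζ⁻¹).trace) ≤
      average (fun γ : β → Fin (k + k) → Fin N =>
        ((N : ℝ) ^ k * (N : ℝ) ^ k)⁻¹ * (N : ℝ) ^ (k - 1) * entrySum (wordMat γ w')) := by
    refine average_le_of_resample b fun γ => ?_
    have : ∀ v, wordMat (Function.update γ b v) (w₁ ++ (b, ρ) :: (b, ρ') :: w₂) =
        wordMat γ w₁ * (unitMat ρ v * unitMat ρ' v) * wordMat γ w₂ := by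
      intro v
      rw [wordMat_append, wordMat_cons, wordMat_cons, wordMat_update h₁, wordMat_update h₂]
      simp only [Function.update_self, mul_assoc]
    simp only [this, ← Matrix.trace_sum, ← Matrix.sum_mul, ← Matrix.mul_sum]
    -- Rotating isolates the contraction, whose entries are bounded uniformly, against the rest `C`
    -- of the word.
    rw [mul_assoc, Matrix.trace_mul_comm, ← mul_assoc, ← hw', card_multiIndex]
    set C := wordMat γ w₂ * realPerm N ζ⁻¹ * wordMat γ w₁ with hC
    have hC0 : ∀ i j, 0 ≤ C i j := fun i j => mul_apply_nonneg
      (mul_apply_nonneg (wordMat_nonneg _ _) (realPerm_nonneg _)) (wordMat_nonneg _ _) i j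
    calc (C * ∑ v, unitMat ρ v * unitMat ρ' v).trace
        = ∑ i, ∑ j, C i j * (∑ v, unitMat ρ v * unitMat ρ' v) j i := by
          simp only [Matrix.trace, Matrix.diag, Matrix.mul_apply (M := C)]
      _ ≤ ∑ i, ∑ j, C i j * (N : ℝ) ^ (k - 1) := by
          gcongr with i _ j _
          · exact hC0 i j
          · exact sum_unitMat_mul_unitMat_le hρ j i
      _ = (N : ℝ) ^ (k - 1) * entrySum C := by
          simp only [entrySum, Finset.mul_sum, mul_comm]
      _ ≤ _ := by
          apply le_of_eq
          field_simp
  rw [loopCount, hc]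
  have hS := average_entrySum_wordMat_le (β := β) hN w'
  rw [average_mul_left] at havg
  -- With `r` labels in `w'`, the exponents add up to `-k + k(r+1) - 2k + (k-1) + k - kr = -1`.
  calc ((N : ℝ) ^ k)⁻¹ * ((N : ℝ) ^ k) ^ ((labels w').card + 1) * _
      ≤ ((N : ℝ) ^ k)⁻¹ * ((N : ℝ) ^ k) ^ ((labels w').card + 1) *
        (((N : ℝ) ^ k * (N : ℝ) ^ k)⁻¹ * (N : ℝ) ^ (k - 1) *
          ((N : ℝ) ^ k * ((N : ℝ) ^ k)⁻¹ ^ (labels w').card)) := by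
        refine mul_le_mul_of_nonneg_left (havg.trans ?_) (by positivity)
        exact mul_le_mul_of_nonneg_left hS (by positivity)
    _ = (N : ℝ)⁻¹ := by
        have hkk : (N : ℝ) ^ k = (N : ℝ) ^ (k - 1) * N := by
          rw [← pow_succ, Nat.sub_add_cancel hk]
        have hN0 : (0 : ℝ) < (N : ℝ) ^ (k - 1) := by positivity
        rw [pow_succ ((N : ℝ) ^ k), inv_pow]
        have : ((N : ℝ) ^ k) ^ (labels w').card ≠ 0 := by positivity
        field_simp
        rw [hkk]

/-- A word in which the last new label is followed by a different label is negligible. -/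
theorem loopCount_le_of_last_new (hN : 0 < N) (hk : 1 ≤ k) {b b' : β}
    {ρ ρ' : Equiv.Perm (Fin (k + k))} {w₁ w₂ : List (β × Equiv.Perm (Fin (k + k)))}
    (h₁ : b ∉ labels w₁) (hb' : b' ∈ labels w₁) (h₂ : labels w₂ ⊆ insert b (labels w₁))
    (ζ : Equiv.Perm (Fin k)) :
    loopCount N (w₁ ++ (b, ρ) :: (b', ρ') :: w₂) ζ ≤ (N : ℝ)⁻¹ := by
  have hN' : (0 : ℝ) < (N : ℝ) ^ k := by positivity
  have hN1 : (1 : ℝ) ≤ N := by exact_mod_cast hN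
  have := nonempty_multiIndex (k := k) hN
  have hbb : b' ≠ b := fun e => h₁ (e ▸ hb')
  have hl : labels (w₁ ++ (b, ρ) :: (b', ρ') :: w₂) = insert b (labels w₁) := by
    ext y
    have := @h₂ y
    simp only [labels_append, labels_cons, Finset.mem_union, Finset.mem_insert] at this ⊢
    constructor
    · rintro (h | h | h | h)
      · exact Or.inr h
      · exact Or.inl h
      · exact Or.inr (h ▸ hb')
      · exact this h
    · rintro (h | h)
      · exact Or.inr (Or.inl h)
      · exact Or.inl h
  have havg : average (fun γ : β → Fin (k + k) → Fin N =>
      (wordMat γ (w₁ ++ (b, ρ) :: (b', ρ') :: w₂) * realPerm N ζ⁻¹).trace) ≤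
      average (fun γ : β → Fin (k + k) → Fin N =>
        entrySum (wordMat γ w₁ * (unitMat ρ (γ b) * unitMat ρ' (γ b')))) := by
    -- Only an upper bound is needed: the closing condition and all letters after `b'` are dropped,
    -- since these factors have row sums at most `1`.
    refine average_mono fun γ => ?_
    refine (trace_le_entrySum fun i j => mul_apply_nonneg (wordMat_nonneg _ _)
      (realPerm_nonneg _) i j).trans ?_
    refine (entrySum_mul_le (wordMat_nonneg _ _) fun i => (sum_realPerm_row _ i).le).trans ?_
    have : wordMat γ (w₁ ++ (b, ρ) :: (b', ρ') :: w₂) =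
        wordMat γ w₁ * (unitMat ρ (γ b) * unitMat ρ' (γ b')) * wordMat γ w₂ := by
      simp [mul_assoc]
    rw [this]
    have hrow : ∀ (w : List (β × Equiv.Perm (Fin (k + k)))) (i : Fin k → Fin N),
        ∑ j, wordMat γ w i j ≤ 1 := by
      intro w
      induction w with
      | nil => intro i; simp [Matrix.one_apply]
      | cons x w ih =>
        intro i
        rw [wordMat_cons]
        simp only [Matrix.mul_apply]
        rw [Finset.sum_comm]
        simp only [← Finset.mul_sum]
        exact (Finset.sum_le_sum fun a _ => mul_le_of_le_one_right (unitMat_nonneg _ _ i a)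
          (ih a)).trans (sum_unitMat_row _ _ i)
    refine entrySum_mul_le (fun i j => mul_apply_nonneg (wordMat_nonneg _ _) (fun a c =>
      mul_apply_nonneg (unitMat_nonneg _ _) (unitMat_nonneg _ _) a c) i j) (hrow w₂)
  have havg' : average (fun γ : β → Fin (k + k) → Fin N =>
        entrySum (wordMat γ w₁ * (unitMat ρ (γ b) * unitMat ρ' (γ b')))) ≤
      average (fun γ : β → Fin (k + k) → Fin N =>
        ((N : ℝ) ^ k * (N : ℝ) ^ k)⁻¹ * entrySum (wordMat γ w₁)) := by
    refine average_le_of_resample b fun γ => le_of_eq ?_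
    have : ∑ v, entrySum (wordMat (Function.update γ b v) w₁ *
        (unitMat ρ (Function.update γ b v b) * unitMat ρ' (Function.update γ b v b'))) =
        entrySum (wordMat γ w₁ * ((∑ v, unitMat ρ v) * unitMat ρ' (γ b'))) := by
      rw [Matrix.sum_mul, Matrix.mul_sum]
      simp only [entrySum, Matrix.sum_apply]
      rw [Finset.sum_comm]
      refine Finset.sum_congr rfl fun i _ => ?_
      rw [Finset.sum_comm]
      refine Finset.sum_congr rfl fun j _ => Finset.sum_congr rfl fun v _ => ?_
      rw [wordMat_update h₁, Function.update_self, Function.update_of_ne hbb]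
    rw [this, sum_unitMat, entrySum_mul, card_multiIndex]
    -- The gain: the all-ones matrix produced by the fresh label `b` is followed by a matrix unit
    -- that is already fixed, so row sums drop from `N^k` to `1` and `b` contributes `N^(-2k)`
    -- instead of `N^(-k)`.
    have hone : ∀ a : Fin k → Fin N, ∑ j, ((Matrix.of fun _ _ => (1 : ℝ) :
        Matrix (Fin k → Fin N) (Fin k → Fin N) ℝ) * unitMat ρ' (γ b')) a j = 1 := by
      intro a
      simp only [Matrix.mul_apply, Matrix.of_apply, one_mul]
      rw [Finset.sum_comm]
      exact sum_sum_unitMat _ _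
    simp only [hone, mul_one]
    rw [← entrySum]
    field_simp
  rw [loopCount, hl, Finset.card_insert_of_notMem h₁]
  have hS := average_entrySum_wordMat_le (β := β) hN w₁
  rw [average_mul_left] at havg'
  calc ((N : ℝ) ^ k)⁻¹ * ((N : ℝ) ^ k) ^ ((labels w₁).card + 1) * _
      ≤ ((N : ℝ) ^ k)⁻¹ * ((N : ℝ) ^ k) ^ ((labels w₁).card + 1) *
        (((N : ℝ) ^ k * (N : ℝ) ^ k)⁻¹ * ((N : ℝ) ^ k * ((N : ℝ) ^ k)⁻¹ ^ (labels w₁).card)) := by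
        refine mul_le_mul_of_nonneg_left (havg.trans (havg'.trans ?_)) (by positivity)
        exact mul_le_mul_of_nonneg_left hS (by positivity)
    _ = ((N : ℝ) ^ k)⁻¹ := by
        rw [pow_succ ((N : ℝ) ^ k), inv_pow]
        have : ((N : ℝ) ^ k) ^ (labels w₁).card ≠ 0 := by positivity
        field_simp
    _ ≤ (N : ℝ)⁻¹ := by
        apply inv_anti₀ (by positivity)
        exact le_self_pow₀ hN1 (by omega)

end Words


/-! ### Collections of pairs and their words -/

/-- The last new label of a word. -/
theorem exists_last_new {α β : Type*} (f : α → β) (l : List α) (hl : l ≠ []) :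
    ∃ l₁ x l₂, l = l₁ ++ x :: l₂ ∧ (∀ y ∈ l₁, f y ≠ f x) ∧
      ∀ y ∈ l₂, f y = f x ∨ ∃ z ∈ l₁, f z = f y := by
  induction l using List.reverseRecOn with
  | nil => exact absurd rfl hl
  | append_singleton t y ih =>
    by_cases hy : ∃ z ∈ t, f z = f y
    · obtain ⟨z, hz, hzy⟩ := hy
      obtain ⟨l₁, x, l₂, rfl, h₁, h₂⟩ := ih (List.ne_nil_of_mem hz)
      refine ⟨l₁, x, l₂ ++ [y], by simp, h₁, fun w hw => ?_⟩
      rcases List.mem_append.1 hw with hw | hw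
      · exact h₂ w hw
      · rw [List.mem_singleton.1 hw]
        rcases List.mem_append.1 hz with hz | hz
        · exact Or.inr ⟨z, hz, hzy⟩
        · rcases List.mem_cons.1 hz with rfl | hz
          · exact Or.inl hzy.symm
          · rcases h₂ z hz with h | ⟨a, ha, haz⟩
            · exact Or.inl (hzy ▸ h)
            · exact Or.inr ⟨a, ha, haz.trans hzy⟩
    · push Not at hy
      exact ⟨t, y, [], rfl, hy, by simp⟩

/-- `ξ` is a collection of pairs, told apart by the labels of their elements. -/
structure IsPairing {ι β : Type*} (lab : ι → β) (ξ : Finset (Finset ι)) : Prop where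
  card_eq : ∀ B ∈ ξ, B.card = 2
  lab_iff : ∀ B ∈ ξ, ∀ B' ∈ ξ, ∀ x ∈ B, ∀ x' ∈ B', lab x = lab x' ↔ B = B'

namespace IsPairing

variable {ι β : Type*} {lab : ι → β} {ξ : Finset (Finset ι)}

theorem mono (h : IsPairing lab ξ) {ξ' : Finset (Finset ι)} (hs : ξ' ⊆ ξ) : IsPairing lab ξ' :=
  ⟨fun B hB => h.card_eq B (hs hB), fun B hB B' hB' => h.lab_iff B (hs hB) B' (hs hB')⟩

theorem eq_of_mem (h : IsPairing lab ξ) {B B' : Finset ι} (hB : B ∈ ξ) (hB' : B' ∈ ξ) {x : ι}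
    (hx : x ∈ B) (hx' : x ∈ B') : B = B' :=
  (h.lab_iff B hB B' hB' x hx x hx').1 rfl

end IsPairing

section Pairs

variable {ι : Type*} [LinearOrder ι]

/-- A sorted list without repetitions is the sorted list of its elements. -/
theorem sort_eq_of_sortedLT (s : Finset ι) (l : List ι) (hl : l.SortedLT)
    (h : ∀ x, x ∈ l ↔ x ∈ s) : s.sort = l := by
  have : l.toFinset = s := by ext x; simp [h]
  rw [← this]
  exact List.Perm.eq_of_sortedLE (Finset.sortedLT_sort _).sortedLE hl.sortedLE
    ((List.perm_ext_iff_of_nodup (Finset.sort_nodup _ _) hl.nodup).2 (by simp))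

theorem sort_eq_append (s t t' : Finset ι) (hst : ∀ x, x ∈ s ↔ x ∈ t ∨ x ∈ t')
    (hlt : ∀ x ∈ t, ∀ y ∈ t', x < y) : s.sort = t.sort ++ t'.sort := by
  refine sort_eq_of_sortedLT _ _ ?_ (by simp [hst])
  rw [List.sortedLT_iff_pairwise, List.pairwise_append]
  exact ⟨(Finset.sortedLT_sort t).pairwise, (Finset.sortedLT_sort t').pairwise, by simpa using hlt⟩

theorem sort_pair {x y : ι} (h : x < y) : ({x, y} : Finset ι).sort = [x, y] :=
  sort_eq_of_sortedLT _ _ (by simp [List.sortedLT_iff_pairwise, h]) (by simp)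

/-- The positions of `ξ` outside of `B` lying before `B`. -/
def beforeBlock (ξ : Finset (Finset ι)) (B : Finset ι) : Finset ι :=
  ((ξ.erase B).sup id).filter fun x => ∀ y ∈ B, x < y

/-- The positions of `ξ` outside of `B` lying after `B`. -/
def afterBlock (ξ : Finset (Finset ι)) (B : Finset ι) : Finset ι :=
  ((ξ.erase B).sup id).filter fun x => ∀ y ∈ B, y < x

theorem mem_sup_id {ξ : Finset (Finset ι)} {x : ι} : x ∈ ξ.sup id ↔ ∃ B ∈ ξ, x ∈ B := by
  simp [Finset.mem_sup]

namespace IsPairing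

variable {β : Type*} {lab : ι → β} {ξ : Finset (Finset ι)}

theorem exists_eq_pair (h : IsPairing lab ξ) {B : Finset ι} (hB : B ∈ ξ) :
    ∃ x y, x < y ∧ B = {x, y} := by
  obtain ⟨x, y, hne, rfl⟩ := Finset.card_eq_two.1 (h.card_eq B hB)
  rcases lt_or_gt_of_ne hne with hlt | hlt
  · exact ⟨x, y, hlt, rfl⟩
  · exact ⟨y, x, hlt, Finset.pair_comm x y⟩

/-- The interval property excludes any other position between `x` and `y`, and disjointness of the
blocks excludes `x` and `y` themselves. -/
theorem sup_split (h : IsPairing lab ξ) {x y : ι} (hxy : x < y)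
    (hB : IsIntervalBlock ξ {x, y}) (z : ι) :
    z ∈ (ξ.erase {x, y}).sup id ↔ z ∈ beforeBlock ξ {x, y} ∨ z ∈ afterBlock ξ {x, y} := by
  simp only [beforeBlock, afterBlock, Finset.mem_filter, ← and_or_left]
  refine ⟨fun hz => ⟨hz, ?_⟩, fun hz => hz.1⟩
  obtain ⟨B', hB', hzB'⟩ := mem_sup_id.1 hz
  rw [Finset.mem_erase] at hB'
  have hz' : z ∉ ({x, y} : Finset ι) := fun hmem => hB'.1 (h.eq_of_mem hB'.2 hB.1 hzB' hmem)
  have hzs : z ∈ ξ.sup id := mem_sup_id.2 ⟨B', hB'.2, hzB'⟩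
  have hzne : z ≠ x ∧ z ≠ y := by simpa using hz'
  by_cases hzx : z < x
  · left
    intro w hw
    rcases Finset.mem_insert.1 hw with rfl | hw
    · exact hzx
    · rw [Finset.mem_singleton.1 hw]
      exact hzx.trans hxy
  · right
    have hxz : x < z := lt_of_le_of_ne (not_lt.1 hzx) (Ne.symm hzne.1)
    have hyz : y < z := by
      by_contra hcon
      have hzy : z < y := lt_of_le_of_ne (not_lt.1 hcon) hzne.2
      exact hz' (hB.2 x (by simp) y (by simp) z hzs hxz hzy)
    intro w hw
    rcases Finset.mem_insert.1 hw with rfl | hw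
    · exact hxz
    · rw [Finset.mem_singleton.1 hw]
      exact hyz

end IsPairing

/-- The word of labelled permutations read at the positions `s`. -/
def wordOf {β : Type*} {k : ℕ} (lab : ι → β) (ρ : ι → Equiv.Perm (Fin (k + k))) (s : Finset ι) :
    List (β × Equiv.Perm (Fin (k + k))) :=
  s.sort.map fun l => (lab l, ρ l)

variable {β : Type*} {k : ℕ} {lab : ι → β} {ξ : Finset (Finset ι)}

theorem wordOf_congr {ρ ρ' : ι → Equiv.Perm (Fin (k + k))} {s : Finset ι}
    (h : ∀ x ∈ s, ρ x = ρ' x) : wordOf lab ρ s = wordOf lab ρ' s :=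
  List.map_congr_left fun x hx => by rw [h x (by simpa using hx)]

theorem wordOf_erase_max {ρ : ι → Equiv.Perm (Fin (k + k))} {s : Finset ι} (hs : s.Nonempty) :
    wordOf lab ρ s = wordOf lab ρ (s.erase (s.max' hs)) ++ [(lab (s.max' hs), ρ (s.max' hs))] := by
  rw [wordOf, sort_eq_append s (s.erase (s.max' hs)) {s.max' hs}]
  · simp [wordOf]
  · intro x
    by_cases hx : x = s.max' hs
    · simp [hx, Finset.max'_mem]
    · simp [hx]
  · intro x hx y hy
    rw [Finset.mem_singleton.1 hy]
    exact s.lt_max'_of_mem_erase_max' hs hx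

theorem wordOf_erase_block (h : IsPairing lab ξ) (ρ : ι → Equiv.Perm (Fin (k + k))) {x y : ι}
    (hxy : x < y) (hB : IsIntervalBlock ξ {x, y}) :
    wordOf lab ρ ((ξ.erase {x, y}).sup id) =
      wordOf lab ρ (beforeBlock ξ {x, y}) ++ wordOf lab ρ (afterBlock ξ {x, y}) := by
  rw [wordOf, sort_eq_append _ _ _ (h.sup_split hxy hB), List.map_append]
  · rfl
  · intro z hz w hw
    exact ((Finset.mem_filter.1 hz).2 x (by simp)).trans ((Finset.mem_filter.1 hw).2 x (by simp))

theorem wordOf_block (h : IsPairing lab ξ) (ρ : ι → Equiv.Perm (Fin (k + k))) {x y : ι}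
    (hxy : x < y) (hB : IsIntervalBlock ξ {x, y}) :
    wordOf lab ρ (ξ.sup id) = wordOf lab ρ (beforeBlock ξ {x, y}) ++
      (lab x, ρ x) :: (lab x, ρ y) :: wordOf lab ρ (afterBlock ξ {x, y}) := by
  have hlab : lab x = lab y := (h.lab_iff _ hB.1 _ hB.1 x (by simp) y (by simp)).2 rfl
  have hbef : ∀ z ∈ beforeBlock ξ {x, y}, z < x := fun z hz =>
    (Finset.mem_filter.1 hz).2 x (by simp)
  have haft : ∀ z ∈ afterBlock ξ {x, y}, y < z := fun z hz =>
    (Finset.mem_filter.1 hz).2 y (by simp)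
  rw [wordOf, sort_eq_append (ξ.sup id) (beforeBlock ξ {x, y}) ({x, y} ∪ afterBlock ξ {x, y}),
    sort_eq_append ({x, y} ∪ afterBlock ξ {x, y}) {x, y} (afterBlock ξ {x, y}), sort_pair hxy]
  · simp [wordOf, hlab]
  · simp [or_assoc]
  · intro z hz w hw
    rcases Finset.mem_insert.1 hz with rfl | hz
    · exact hxy.trans (haft w hw)
    · rw [Finset.mem_singleton.1 hz]
      exact haft w hw
  · intro z
    have hsplit : z ∈ ξ.sup id ↔ z ∈ ({x, y} : Finset ι) ∨ z ∈ (ξ.erase {x, y}).sup id := by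
      conv_lhs => rw [← Finset.insert_erase hB.1, Finset.sup_insert]
      simp [or_assoc]
    rw [hsplit, h.sup_split hxy hB, Finset.mem_union]
    tauto
  · intro z hz w hw
    have hzx := hbef z hz
    rcases Finset.mem_union.1 hw with hw | hw
    · rcases Finset.mem_insert.1 hw with rfl | hw
      · exact hzx
      · rw [Finset.mem_singleton.1 hw]
        exact hzx.trans hxy
    · exact hzx.trans (hxy.trans (haft w hw))

variable [DecidableEq β]

theorem mem_labels_wordOf {ρ : ι → Equiv.Perm (Fin (k + k))} {s : Finset ι} {b : β} :
    b ∈ labels (wordOf lab ρ s) ↔ ∃ x ∈ s, lab x = b := by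
  simp [labels, wordOf]

/-- Distinct blocks carry distinct labels, so the label of `B` can be resampled without affecting
the letters outside `B`. -/
theorem lab_notMem_labels (h : IsPairing lab ξ) (ρ : ι → Equiv.Perm (Fin (k + k)))
    {B : Finset ι} {x : ι} (hB : B ∈ ξ) (hx : x ∈ B) {s : Finset ι}
    (hs : s ⊆ (ξ.erase B).sup id) : lab x ∉ labels (wordOf lab ρ s) := by
  rw [mem_labels_wordOf]
  rintro ⟨z, hz, hzx⟩
  obtain ⟨B', hB', hzB'⟩ := mem_sup_id.1 (hs hz)
  rw [Finset.mem_erase] at hB'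
  exact hB'.1 ((h.lab_iff B' hB'.2 B hB z hzB' x hx).1 hzx)

theorem beforeBlock_subset {B : Finset ι} : beforeBlock ξ B ⊆ (ξ.erase B).sup id :=
  Finset.filter_subset _ _

theorem afterBlock_subset {B : Finset ι} : afterBlock ξ B ⊆ (ξ.erase B).sup id :=
  Finset.filter_subset _ _

variable [Fintype β] {N : ℕ}

/-- Removing an interval pair with matching permutations, when some position lies before it. -/
theorem loopCount_erase_of_before (hN : 0 < N) (h : IsPairing lab ξ)
    (ρ : ι → Equiv.Perm (Fin (k + k))) {x y : ι} (hxy : x < y)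
    (hB : IsIntervalBlock ξ {x, y}) {η : Equiv.Perm (Fin k)} (hη : Matches (ρ x) (ρ y) η)
    (hne : (beforeBlock ξ {x, y}).Nonempty) (ζ : Equiv.Perm (Fin k)) :
    loopCount N (wordOf lab ρ (ξ.sup id)) ζ =
      loopCount N (wordOf lab (Function.update ρ ((beforeBlock ξ {x, y}).max' hne)
        (glue 1 η⁻¹ * ρ ((beforeBlock ξ {x, y}).max' hne))) ((ξ.erase {x, y}).sup id)) ζ := by
  set p := (beforeBlock ξ {x, y}).max' hne with hp
  have hpm : p ∈ beforeBlock ξ {x, y} := Finset.max'_mem _ _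
  have hpa : ∀ z ∈ afterBlock ξ {x, y}, z ≠ p := by
    rintro z hz rfl
    exact lt_asymm ((Finset.mem_filter.1 hz).2 x (by simp)) ((Finset.mem_filter.1 hpm).2 x (by simp))
  rw [wordOf_block h ρ hxy hB]
  refine loopCount_of_matches hN hη (lab_notMem_labels h ρ hB.1 (by simp) beforeBlock_subset)
    (lab_notMem_labels h ρ hB.1 (by simp) afterBlock_subset) ?_ fun γ => ?_
  · rw [← wordOf_erase_block h ρ hxy hB]
    ext b
    simp only [mem_labels_wordOf]
  -- The letter at `p`, the last one before the pair, absorbs `U_η`; no other letter changes.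
  · rw [wordOf_erase_block h _ hxy hB, wordMat_append, wordOf_erase_max hne,
      wordOf_erase_max hne (ρ := ρ), ← hp, Function.update_self,
      wordOf_congr (ρ := Function.update ρ p _) (ρ' := ρ) (s := afterBlock ξ {x, y})
        (fun z hz => Function.update_of_ne (hpa z hz) _ _),
      wordOf_congr (ρ := Function.update ρ p _) (ρ' := ρ) (s := (beforeBlock ξ {x, y}).erase p)
        (fun z hz => Function.update_of_ne (Finset.ne_of_mem_erase hz) _ _)]
    simp only [wordMat_append, wordMat_cons, wordMat_nil, mul_one, ← unitMat_mul_realPerm,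
      mul_assoc]

/-- Removing an interval pair with matching permutations at the beginning. -/
theorem loopCount_erase_of_first (hN : 0 < N) (h : IsPairing lab ξ)
    (ρ : ι → Equiv.Perm (Fin (k + k))) {x y : ι} (hxy : x < y)
    (hB : IsIntervalBlock ξ {x, y}) {η : Equiv.Perm (Fin k)} (hη : Matches (ρ x) (ρ y) η)
    (hemp : beforeBlock ξ {x, y} = ∅) (ζ : Equiv.Perm (Fin k)) :
    loopCount N (wordOf lab ρ (ξ.sup id)) ζ =
      loopCount N (wordOf lab ρ ((ξ.erase {x, y}).sup id)) (η⁻¹ * ζ) := by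
  rw [wordOf_block h ρ hxy hB]
  refine loopCount_of_matches hN hη (lab_notMem_labels h ρ hB.1 (by simp) beforeBlock_subset)
    (lab_notMem_labels h ρ hB.1 (by simp) afterBlock_subset) ?_ fun γ => ?_
  · rw [← wordOf_erase_block h ρ hxy hB]
  · rw [wordOf_erase_block h _ hxy hB, hemp]
    have : wordOf lab ρ (∅ : Finset ι) = [] := by simp [wordOf]
    -- No letter precedes the pair. By cyclicity `U_η` moves to the end and joins the closing
    -- permutation: `U_ζ⁻¹ U_η` is the inverse of `U` at `η⁻¹ * ζ`.
    rw [this, List.nil_append, wordMat_nil, one_mul, mul_assoc, Matrix.trace_mul_comm (realPerm N η),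
      mul_assoc, realPerm_mul_realPerm, mul_inv_rev, inv_inv]

theorem loopCount_le_of_interval_not_matches (hN : 0 < N) (hk : 1 ≤ k) (h : IsPairing lab ξ)
    (ρ : ι → Equiv.Perm (Fin (k + k))) {x y : ι} (hxy : x < y)
    (hB : IsIntervalBlock ξ {x, y}) (hη : ¬ ∃ η, Matches (ρ x) (ρ y) η)
    (ζ : Equiv.Perm (Fin k)) :
    loopCount N (wordOf lab ρ (ξ.sup id)) ζ ≤ (N : ℝ)⁻¹ := by
  rw [wordOf_block h ρ hxy hB]
  exact loopCount_le_of_not_matches hN hk hη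
    (lab_notMem_labels h ρ hB.1 (by simp) beforeBlock_subset)
    (lab_notMem_labels h ρ hB.1 (by simp) afterBlock_subset) ζ

/-- A nonempty pairing without interval pair has a negligible count. -/
theorem loopCount_le_of_no_interval (hN : 0 < N) (hk : 1 ≤ k) (h : IsPairing lab ξ)
    (ρ : ι → Equiv.Perm (Fin (k + k))) (hne : ξ.Nonempty) (hB : ∀ B, ¬ IsIntervalBlock ξ B)
    (ζ : Equiv.Perm (Fin k)) :
    loopCount N (wordOf lab ρ (ξ.sup id)) ζ ≤ (N : ℝ)⁻¹ := by
  have hsort : (ξ.sup id).sort ≠ [] := by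
    obtain ⟨B, hB'⟩ := hne
    obtain ⟨x, y, -, rfl⟩ := h.exists_eq_pair hB'
    exact List.ne_nil_of_mem ((Finset.mem_sort _).2 (mem_sup_id.2 ⟨_, hB', by simp⟩) : x ∈ _)
  -- The partner of the last new position `x` comes after it, so `x` has a successor `y`. Were `y`
  -- that partner, two consecutive positions would form an interval pair; hence `y` carries an older
  -- label.
  obtain ⟨l₁, x, l₂, hl, h₁, h₂⟩ := exists_last_new lab _ hsort
  have hsl : (l₁ ++ x :: l₂).SortedLT := hl ▸ Finset.sortedLT_sort _
  have hmem : ∀ z, z ∈ ξ.sup id ↔ z ∈ l₁ ++ x :: l₂ := fun z => by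
    rw [← hl, Finset.mem_sort]
  obtain ⟨B, hBξ, hxB⟩ := mem_sup_id.1 ((hmem x).2 (by simp))
  obtain ⟨z, hzB, hzx⟩ := (Finset.one_lt_card_iff_nontrivial.1
    (by rw [h.card_eq B hBξ]; norm_num : 1 < B.card)).exists_ne x
  have hlab : lab z = lab x := (h.lab_iff B hBξ B hBξ z hzB x hxB).2 rfl
  have hz₂ : z ∈ l₂ := by
    have := (hmem z).1 (mem_sup_id.2 ⟨B, hBξ, hzB⟩)
    rcases List.mem_append.1 this with hz | hz
    · exact absurd hlab (h₁ z hz)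
    · exact (List.mem_cons.1 hz).resolve_left hzx
  rw [List.sortedLT_iff_pairwise, List.pairwise_append, List.pairwise_cons] at hsl
  obtain ⟨-, ⟨hxl₂, hpl₂⟩, hl₁l₂⟩ := hsl
  cases l₂ with
  | nil => simp at hz₂
  | cons y l₂ =>
    have hxy : x < y := hxl₂ y (by simp)
    have hyx : lab y ≠ lab x := by
      intro hyx
      obtain ⟨B', hB'ξ, hyB'⟩ := mem_sup_id.1 ((hmem y).2 (by simp))
      obtain rfl := (h.lab_iff B' hB'ξ B hBξ y hyB' x hxB).1 hyx
      have hBeq : B' = {x, y} := by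
        symm
        refine Finset.eq_of_subset_of_card_le ?_ ?_
        · intro w hw
          rcases Finset.mem_insert.1 hw with rfl | hw
          · exact hxB
          · rw [Finset.mem_singleton.1 hw]; exact hyB'
        · rw [h.card_eq B' hBξ, Finset.card_pair hxy.ne]
      refine hB B' ⟨hBξ, ?_⟩
      have hcov : ∀ w ∈ ξ.sup id, x < w → y ≤ w := by
        intro w hw hxw
        rcases List.mem_append.1 ((hmem w).1 hw) with hw | hw
        · exact absurd (hl₁l₂ w hw x (by simp)) (lt_asymm hxw)
        · rcases List.mem_cons.1 hw with rfl | hw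
          · exact absurd hxw (lt_irrefl _)
          · rcases List.mem_cons.1 hw with rfl | hw
            · exact le_rfl
            · exact ((List.pairwise_cons.1 hpl₂).1 w hw).le
      subst hBeq
      intro a ha c hc w hw haw hwc
      have hxa : x ≤ a := by
        rcases Finset.mem_insert.1 ha with rfl | ha
        · exact le_rfl
        · rw [Finset.mem_singleton.1 ha]; exact hxy.le
      have hcy : c ≤ y := by
        rcases Finset.mem_insert.1 hc with rfl | hc
        · exact hxy.le
        · rw [Finset.mem_singleton.1 hc]
      exact absurd (hcov w hw (hxa.trans_lt haw)) (not_le.2 (hwc.trans_le hcy))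
    have hword : wordOf lab ρ (ξ.sup id) = l₁.map (fun l => (lab l, ρ l)) ++
        (lab x, ρ x) :: (lab y, ρ y) :: l₂.map (fun l => (lab l, ρ l)) := by
      simp [wordOf, hl]
    rw [hword]
    refine loopCount_le_of_last_new hN hk ?_ ?_ ?_ ζ
    · simpa [labels] using h₁
    · simpa [labels] using (h₂ y (by simp)).resolve_left hyx
    · intro b hb
      simp only [labels, List.map_map, List.mem_toFinset, List.mem_map, Function.comp_apply,
        Finset.mem_insert] at hb ⊢
      obtain ⟨w, hw, rfl⟩ := hb
      exact h₂ w (by simp [hw])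

end Pairs


/-! ### Interval blocks of non-crossing collections -/

/-- A collection of disjoint nonempty blocks. -/
structure IsBlocks {ι : Type*} (ξ : Finset (Finset ι)) : Prop where
  nonempty : ∀ B ∈ ξ, B.Nonempty
  eq_of_mem : ∀ B ∈ ξ, ∀ B' ∈ ξ, ∀ x, x ∈ B → x ∈ B' → B = B'

theorem IsBlocks.mono {ι : Type*} {ξ ξ' : Finset (Finset ι)} (h : IsBlocks ξ) (hs : ξ' ⊆ ξ) :
    IsBlocks ξ' :=
  ⟨fun B hB => h.nonempty B (hs hB), fun B hB B' hB' => h.eq_of_mem B (hs hB) B' (hs hB')⟩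

/-- A collection of blocks no two of which cross. -/
def NonCrossing {ι : Type*} [LT ι] (ξ : Finset (Finset ι)) : Prop :=
  ∀ B ∈ ξ, ∀ B' ∈ ξ, ∀ i ∈ B, ∀ p ∈ B, ∀ j ∈ B', ∀ q ∈ B', i < j → j < p → p < q → B = B'

theorem NonCrossing.mono {ι : Type*} [LT ι] {ξ ξ' : Finset (Finset ι)} (h : NonCrossing ξ)
    (hs : ξ' ⊆ ξ) : NonCrossing ξ' :=
  fun B hB B' hB' => h B (hs hB) B' (hs hB')

section Interval

variable {ι : Type*} [LinearOrder ι]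

/-- A nonempty non-crossing collection has an interval block. -/
theorem exists_isIntervalBlock {ξ : Finset (Finset ι)} (hξ : IsBlocks ξ) (hnc : NonCrossing ξ)
    (hne : ξ.Nonempty) : ∃ B, IsIntervalBlock ξ B := by
  classical
  -- A block with the fewest positions between its extremes is an interval: a block meeting its
  -- inside would be nested in it and have strictly fewer.
  let inside : Finset ι → Finset ι := fun B =>
    (ξ.sup id).filter fun y => ∃ x ∈ B, ∃ z ∈ B, x < y ∧ y < z
  obtain ⟨B, hB, hmin⟩ := ξ.exists_min_image (fun B => (inside B).card) hne
  refine ⟨B, hB, ?_⟩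
  intro x hx z hz y hy hxy hyz
  by_contra hyB
  obtain ⟨B', hB', hyB'⟩ := mem_sup_id.1 hy
  have hBB' : B ≠ B' := fun e => hyB (e ▸ hyB')
  -- One element `y` of `B'` lies between `x` and `z`; an element of `B'` outside this range would
  -- make a crossing with `B`.
  have hsub : ∀ v ∈ B', (∃ x ∈ B, x < v) ∧ ∃ z ∈ B, v < z := by
    intro v hv
    have hvx : v ≠ x := fun e => hBB' (hξ.eq_of_mem B hB B' hB' v (e ▸ hx) hv)
    have hvz : v ≠ z := fun e => hBB' (hξ.eq_of_mem B hB B' hB' v (e ▸ hz) hv)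
    rcases lt_trichotomy v y with hvy | rfl | hvy
    · refine ⟨⟨x, hx, ?_⟩, z, hz, hvy.trans hyz⟩
      by_contra hcon
      have hlt : v < x := lt_of_le_of_ne (not_lt.1 hcon) hvx
      exact hBB' (hnc B' hB' B hB v hv y hyB' x hx z hz hlt hxy hyz).symm
    · exact ⟨⟨x, hx, hxy⟩, z, hz, hyz⟩
    · refine ⟨⟨x, hx, hxy.trans hvy⟩, z, hz, ?_⟩
      by_contra hcon
      have hlt : z < v := lt_of_le_of_ne (not_lt.1 hcon) (Ne.symm hvz)
      exact hBB' (hnc B hB B' hB' x hx z hz y hyB' v hv hxy hyz hlt)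
  have hlt : (inside B').card < (inside B).card := by
    refine Finset.card_lt_card ⟨?_, ?_⟩
    · intro w hw
      obtain ⟨hws, x', hx', z', hz', hxw, hwz⟩ := Finset.mem_filter.1 hw
      obtain ⟨x'', hx'', hlt⟩ := (hsub x' hx').1
      obtain ⟨z'', hz'', hlt'⟩ := (hsub z' hz').2
      exact Finset.mem_filter.2 ⟨hws, x'', hx'', z'', hz'', hlt.trans hxw, hwz.trans hlt'⟩
    -- The inclusion is strict: the smallest element of `B'` is inside `B` but not inside `B'`.
    · intro hcon
      have hne' := hξ.nonempty B' hB'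
      have hmem := B'.min'_mem hne'
      obtain ⟨⟨x', hx', hlt⟩, z', hz', hlt'⟩ := hsub _ hmem
      have := hcon (Finset.mem_filter.2 ⟨mem_sup_id.2 ⟨B', hB', hmem⟩, x', hx', z', hz', hlt, hlt'⟩)
      obtain ⟨-, v, hv, -, -, hvm, -⟩ := Finset.mem_filter.1 this
      exact absurd (B'.min'_le v hv) (not_le.2 hvm)
  exact absurd (hmin B' hB') (not_le.2 hlt)

/-- Take the interval block containing the least position covered by interval blocks. -/
theorem exists_isFirstIntervalBlock {ξ : Finset (Finset ι)} (hξ : IsBlocks ξ)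
    (h : ∃ B, IsIntervalBlock ξ B) : ∃ B, IsFirstIntervalBlock ξ B := by
  classical
  let s := (ξ.filter fun B => IsIntervalBlock ξ B).sup id
  have hs : s.Nonempty := by
    obtain ⟨B, hB⟩ := h
    obtain ⟨x, hx⟩ := hξ.nonempty B hB.1
    exact ⟨x, mem_sup_id.2 ⟨B, Finset.mem_filter.2 ⟨hB.1, hB⟩, hx⟩⟩
  obtain ⟨B, hB, hmB⟩ := mem_sup_id.1 (s.min'_mem hs)
  refine ⟨B, (Finset.mem_filter.1 hB).2, fun B' hB' => ⟨_, hmB, fun y hy => ?_⟩⟩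
  exact s.min'_le y (mem_sup_id.2 ⟨B', Finset.mem_filter.2 ⟨hB'.1, hB'⟩, hy⟩)

end Interval

/-! ### Nested evaluations -/

section BlockValue

variable {k : ℕ} {A : Type*} {ι : Type*} [LinearOrder ι]

theorem blockValue_eq (M : ∀ n : ℕ, (Fin n → A) → SymAlg k) (B : Finset ι) (a : ι → A) {m : ℕ}
    (h : B.card = m) : blockValue M B a = M m fun i => a (B.orderEmbOfFin h i) := by
  subst h
  rfl

theorem blockValue_pair (M : ∀ n : ℕ, (Fin n → A) → SymAlg k) (a : ι → A) {x y : ι}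
    (h : x < y) : blockValue M {x, y} a = M 2 ![a x, a y] := by
  have hcard : ({x, y} : Finset ι).card = 2 := Finset.card_pair h.ne
  rw [blockValue_eq M _ a hcard]
  have huniq := Finset.orderEmbOfFin_unique hcard (f := ![x, y]) (by
    intro i; fin_cases i <;> simp) (by
    intro i j hij
    fin_cases i <;> fin_cases j <;> first | exact h | exact absurd hij (by decide))
  rw [← huniq]
  congr 1
  funext i
  fin_cases i <;> rfl

theorem blockValue_univ {n : ℕ} (M : ∀ n : ℕ, (Fin n → A) → SymAlg k) (a : Fin n → A) :
    blockValue M Finset.univ a = M n a := by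
  have hcard : (Finset.univ : Finset (Fin n)).card = n := by simp
  rw [blockValue_eq M _ a hcard]
  have huniq := Finset.orderEmbOfFin_unique hcard (f := id) (by simp) strictMono_id
  rw [← huniq]
  rfl

theorem blockValue_congr {M M' : ∀ n : ℕ, (Fin n → A) → SymAlg k} {B : Finset ι} {a a' : ι → A}
    (hM : M B.card = M' B.card) (ha : ∀ x ∈ B, a x = a' x) :
    blockValue M B a = blockValue M' B a' := by
  rw [blockValue, blockValue, hM]
  congr 1
  funext i
  exact ha _ (B.orderEmbOfFin_mem rfl i)

/-- Multilinearity is stated as the existence of a multilinear map with the given values because,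
while the cumulants are being constructed, they are only plain functions. -/
theorem isLinearMap_blockValue [Ring A] [Algebra ℂ A] {M : ∀ n : ℕ, (Fin n → A) → SymAlg k}
    (hM : ∀ n, ∃ g : MultilinearMap ℂ (fun _ : Fin n => A) (SymAlg k), M n = g)
    {B : Finset ι} {x : ι} (hx : x ∈ B) (a : ι → A) :
    IsLinearMap ℂ fun y => blockValue M B (Function.update a x y) := by
  obtain ⟨g, hg⟩ := hM B.card
  obtain ⟨i, hi⟩ : ∃ i, B.orderEmbOfFin rfl i = x := by
    have : x ∈ Set.range (B.orderEmbOfFin rfl) := by simpa using hx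
    exact this
  have hupd : ∀ y, blockValue M B (Function.update a x y) =
      g (Function.update (fun j => a (B.orderEmbOfFin rfl j)) i y) := by
    intro y
    rw [blockValue, hg]
    congr 1
    funext j
    by_cases hj : j = i
    · subst hj
      rw [Function.update_self, hi, Function.update_self]
    · rw [Function.update_of_ne hj, Function.update_of_ne]
      rw [← hi]
      exact fun e => hj ((B.orderEmbOfFin rfl).injective e)
  constructor
  · intro y z
    rw [hupd, hupd, hupd, g.map_update_add]
  · intro c y
    rw [hupd, hupd, g.map_update_smul]

end BlockValue

section Nested

variable {k : ℕ} {A : Type*} [Ring A] [StarRing A] [Algebra ℂ A] (S : OVSpace k A)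
  {ι : Type*} [LinearOrder ι]

/-- The block selected by `nested` depends on `ξ` alone, so a single `B` serves all maps `M` and all
arguments. Comparing two evaluations relies on this uniformity. -/
theorem nested_of_exists {ξ : Finset (Finset ι)} (h : ∃ B, IsFirstIntervalBlock ξ B) :
    ∃ B, IsFirstIntervalBlock ξ B ∧ ∀ (M : ∀ n : ℕ, (Fin n → A) → SymAlg k) (a : ι → A),
      (∀ hne : (beforeBlock ξ B).Nonempty, nested S M ξ a =
        nested S M (ξ.erase B) (Function.update a ((beforeBlock ξ B).max' hne)
          (a ((beforeBlock ξ B).max' hne) * S.incl (blockValue M B a)))) ∧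
      (¬ (beforeBlock ξ B).Nonempty →
        nested S M ξ a = blockValue M B a * nested S M (ξ.erase B) a) := by
  refine ⟨h.choose, h.choose_spec, fun M a => ⟨fun hne => ?_, fun hne => ?_⟩⟩
  · rw [nested, dif_pos h]
    exact dif_pos hne
  · rw [nested, dif_pos h]
    exact dif_neg hne

theorem nested_empty (M : ∀ n : ℕ, (Fin n → A) → SymAlg k) (a : ι → A) :
    nested S M ∅ a = 1 := by
  rw [nested, dif_neg]
  rintro ⟨B, hB⟩
  exact absurd hB.1.1 (Finset.notMem_empty _)

theorem nested_singleton (M : ∀ n : ℕ, (Fin n → A) → SymAlg k) {B : Finset ι} (hB : B.Nonempty)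
    (a : ι → A) : nested S M {B} a = blockValue M B a := by
  have hfirst : IsFirstIntervalBlock {B} B := by
    refine ⟨⟨Finset.mem_singleton_self B, ?_⟩, ?_⟩
    · intro x _ z _ y hy _ _
      simpa using hy
    · intro B' hB'
      rw [Finset.mem_singleton.1 hB'.1]
      exact ⟨_, B.min'_mem hB, fun y hy => B.min'_le y hy⟩
  obtain ⟨B', hB', hstep⟩ := nested_of_exists S ⟨B, hfirst⟩
  obtain rfl := Finset.mem_singleton.1 hB'.1.1
  rw [(hstep M a).2 (by simp [beforeBlock]), Finset.erase_singleton, nested_empty, mul_one]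

/-- Only the orders that occur as block sizes and the positions covered by `ξ` enter the recursion.
This is what allows truncated cumulants to be exchanged for the full ones. -/
theorem nested_congr {M M' : ∀ n : ℕ, (Fin n → A) → SymAlg k} {ξ : Finset (Finset ι)}
    {a a' : ι → A} (hM : ∀ B ∈ ξ, M B.card = M' B.card) (ha : ∀ x ∈ ξ.sup id, a x = a' x) :
    nested S M ξ a = nested S M' ξ a' := by
  induction hn : ξ.card generalizing ξ a a' with
  | zero =>
    rw [Finset.card_eq_zero.1 hn, nested_empty, nested_empty]
  | succ n ih =>
    by_cases hex : ∃ B, IsFirstIntervalBlock ξ B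
    · obtain ⟨B, hB, hstep⟩ := nested_of_exists S hex
      have hBξ := hB.1.1
      have hsub : (ξ.erase B).sup id ⊆ ξ.sup id := Finset.sup_mono (Finset.erase_subset _ _)
      have hcard : (ξ.erase B).card = n := by rw [Finset.card_erase_of_mem hBξ, hn]; rfl
      have hbv : blockValue M B a = blockValue M' B a' :=
        blockValue_congr (hM B hBξ) fun x hx => ha x (mem_sup_id.2 ⟨B, hBξ, hx⟩)
      have hM' : ∀ B' ∈ ξ.erase B, M B'.card = M' B'.card := fun B' hB' =>
        hM B' (Finset.mem_of_mem_erase hB')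
      by_cases hne : (beforeBlock ξ B).Nonempty
      · rw [(hstep M a).1 hne, (hstep M' a').1 hne, hbv]
        refine ih hM' (fun x hx => ?_) hcard
        have hmem := hsub (beforeBlock_subset ((beforeBlock ξ B).max'_mem hne))
        by_cases hxp : x = (beforeBlock ξ B).max' hne
        · subst hxp
          rw [Function.update_self, Function.update_self, ha _ hmem]
        · rw [Function.update_of_ne hxp, Function.update_of_ne hxp, ha x (hsub hx)]
      · rw [(hstep M a).2 hne, (hstep M' a').2 hne, hbv,
          ih hM' (fun x hx => ha x (hsub hx)) hcard]
    · rw [nested, nested, dif_neg hex, dif_neg hex]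

/-- Non-crossing guarantees that the recursion consumes every block; otherwise it could stop at its
default value `1`, which is not linear in the remaining arguments. In the induction the variable
position is in the removed block, or is the one receiving its value, or is elsewhere. -/
theorem isLinearMap_nested {M : ∀ n : ℕ, (Fin n → A) → SymAlg k}
    (hM : ∀ n, ∃ g : MultilinearMap ℂ (fun _ : Fin n => A) (SymAlg k), M n = g)
    {ξ : Finset (Finset ι)} (hξ : IsBlocks ξ) (hnc : NonCrossing ξ) {x : ι}
    (hx : x ∈ ξ.sup id) (a : ι → A) :
    IsLinearMap ℂ fun y => nested S M ξ (Function.update a x y) := by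
  induction hn : ξ.card generalizing ξ a x with
  | zero =>
    rw [Finset.card_eq_zero.1 hn] at hx
    simp at hx
  | succ n ih =>
    have hne : ξ.Nonempty := Finset.card_pos.1 (by omega)
    obtain ⟨B, hB, hstep⟩ := nested_of_exists S
      (exists_isFirstIntervalBlock hξ (exists_isIntervalBlock hξ hnc hne))
    have hBξ := hB.1.1
    have hcard : (ξ.erase B).card = n := by rw [Finset.card_erase_of_mem hBξ, hn]; rfl
    have hξ' : IsBlocks (ξ.erase B) := hξ.mono (Finset.erase_subset _ _)
    have hnc' : NonCrossing (ξ.erase B) := hnc.mono (Finset.erase_subset _ _)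
    have hdisj : ∀ z ∈ (ξ.erase B).sup id, z ∉ B := by
      intro z hz hzB
      obtain ⟨B', hB', hzB'⟩ := mem_sup_id.1 hz
      rw [Finset.mem_erase] at hB'
      exact hB'.1 (hξ.eq_of_mem B' hB'.2 B hBξ z hzB' hzB)
    by_cases hxB : x ∈ B
    · have hlin := isLinearMap_blockValue hM hxB a
      by_cases hne' : (beforeBlock ξ B).Nonempty
      · set p := (beforeBlock ξ B).max' hne' with hp
        have hps : p ∈ (ξ.erase B).sup id := beforeBlock_subset ((beforeBlock ξ B).max'_mem hne')
        have hpx : p ≠ x := fun e => hdisj p hps (e ▸ hxB)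
        have hval : ∀ y, nested S M ξ (Function.update a x y) =
            nested S M (ξ.erase B) (Function.update a p
              (a p * S.incl (blockValue M B (Function.update a x y)))) := by
          intro y
          rw [(hstep M _).1 hne', ← hp]
          refine nested_congr S (fun _ _ => rfl) fun z hz => ?_
          by_cases hzp : z = p
          · subst hzp
            rw [Function.update_self, Function.update_self, Function.update_of_ne hpx]
          · rw [Function.update_of_ne hzp, Function.update_of_ne hzp, Function.update_of_ne]
            exact fun e => hdisj z hz (e ▸ hxB)
        have hlin' := ih hξ' hnc' hps a hcard
        constructor
        · intro y z
          rw [hval, hval, hval, hlin.map_add, map_add, mul_add, hlin'.map_add]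
        · intro c y
          rw [hval, hval, hlin.map_smul, map_smul, mul_smul_comm, hlin'.map_smul]
      · have hval : ∀ y, nested S M ξ (Function.update a x y) =
            blockValue M B (Function.update a x y) * nested S M (ξ.erase B) a := by
          intro y
          rw [(hstep M _).2 hne']
          congr 1
          refine nested_congr S (fun _ _ => rfl) fun z hz => ?_
          rw [Function.update_of_ne]
          exact fun e => hdisj z hz (e ▸ hxB)
        constructor
        · intro y z
          rw [hval, hval, hval, hlin.map_add, add_mul]
        · intro c y
          rw [hval, hval, hlin.map_smul, smul_mul_assoc]
    · have hxs : x ∈ (ξ.erase B).sup id := by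
        obtain ⟨B', hB', hxB'⟩ := mem_sup_id.1 hx
        exact mem_sup_id.2 ⟨B', Finset.mem_erase.2 ⟨by rintro rfl; exact hxB hxB', hB'⟩, hxB'⟩
      have hbv : ∀ y, blockValue M B (Function.update a x y) = blockValue M B a := fun y =>
        blockValue_congr rfl fun z hz => Function.update_of_ne (by rintro rfl; exact hxB hz) _ _
      by_cases hne' : (beforeBlock ξ B).Nonempty
      · set p := (beforeBlock ξ B).max' hne' with hp
        by_cases hpx : p = x
        · have hlin' := ih hξ' hnc' hxs a hcard
          have hval : ∀ y, nested S M ξ (Function.update a x y) =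
              nested S M (ξ.erase B) (Function.update a x (y * S.incl (blockValue M B a))) := by
            intro y
            rw [(hstep M _).1 hne', ← hp, hbv, hpx, Function.update_self, Function.update_idem]
          constructor
          · intro y z
            rw [hval, hval, hval, add_mul, hlin'.map_add]
          · intro c y
            rw [hval, hval, smul_mul_assoc, hlin'.map_smul]
        · have hlin' := ih hξ' hnc' hxs
            (Function.update a p (a p * S.incl (blockValue M B a))) hcard
          have hval : ∀ y, nested S M ξ (Function.update a x y) =
              nested S M (ξ.erase B) (Function.update
                (Function.update a p (a p * S.incl (blockValue M B a))) x y) := by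
            intro y
            rw [(hstep M _).1 hne', ← hp, hbv, Function.update_of_ne hpx,
              Function.update_comm hpx]
          simpa only [← hval] using hlin'
      · have hlin' := ih hξ' hnc' hxs a hcard
        have hval : ∀ y, nested S M ξ (Function.update a x y) =
            blockValue M B a * nested S M (ξ.erase B) (Function.update a x y) := by
          intro y
          rw [(hstep M _).2 hne', hbv]
        constructor
        · intro y z
          rw [hval, hval, hval, hlin'.map_add, mul_add]
        · intro c y
          rw [hval, hval, hlin'.map_smul, mul_smul_comm]

/-- A nested evaluation vanishes as soon as the maps vanish on one of the blocks, for arguments in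
a class stable under right multiplication. -/
theorem nested_eq_zero {M : ∀ n : ℕ, (Fin n → A) → SymAlg k}
    (hM : ∀ n, ∃ g : MultilinearMap ℂ (fun _ : Fin n => A) (SymAlg k), M n = g)
    {good : A → Prop} (hgood : ∀ a b, good a → good (a * S.incl b))
    {ξ : Finset (Finset ι)} (hξ : IsBlocks ξ) (hnc : NonCrossing ξ) {B₀ : Finset ι}
    (hB₀ : B₀ ∈ ξ) (hzero : ∀ a : Fin B₀.card → A, (∀ i, good (a i)) → M B₀.card a = 0)
    {a : ι → A} (ha : ∀ x, good (a x)) : nested S M ξ a = 0 := by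
  induction hn : ξ.card generalizing ξ a with
  | zero =>
    rw [Finset.card_eq_zero.1 hn] at hB₀
    simp at hB₀
  | succ n ih =>
    obtain ⟨B, hB, hstep⟩ := nested_of_exists S
      (exists_isFirstIntervalBlock hξ (exists_isIntervalBlock hξ hnc ⟨B₀, hB₀⟩))
    have hBξ := hB.1.1
    have hcard : (ξ.erase B).card = n := by rw [Finset.card_erase_of_mem hBξ, hn]; rfl
    have hξ' : IsBlocks (ξ.erase B) := hξ.mono (Finset.erase_subset _ _)
    have hnc' : NonCrossing (ξ.erase B) := hnc.mono (Finset.erase_subset _ _)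
    by_cases hBB : B = B₀
    · subst hBB
      have hbv : blockValue M B a = 0 := hzero _ fun i => ha _
      by_cases hne' : (beforeBlock ξ B).Nonempty
      · rw [(hstep M a).1 hne', hbv, map_zero, mul_zero]
        exact (isLinearMap_nested S hM hξ' hnc'
          (beforeBlock_subset ((beforeBlock ξ B).max'_mem hne')) a).map_zero
      · rw [(hstep M a).2 hne', hbv, zero_mul]
    -- The update multiplies one argument on the right by an element of `ℂ𝔖_k`, and the class `good`
    -- is stable under this operation.
    · have hB₀' : B₀ ∈ ξ.erase B := Finset.mem_erase.2 ⟨Ne.symm hBB, hB₀⟩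
      by_cases hne' : (beforeBlock ξ B).Nonempty
      · rw [(hstep M a).1 hne']
        refine ih hξ' hnc' hB₀' (fun x => ?_) hcard
        by_cases hx : x = (beforeBlock ξ B).max' hne'
        · subst hx
          rw [Function.update_self]
          exact hgood _ _ (ha _)
        · rw [Function.update_of_ne hx]
          exact ha x
      · rw [(hstep M a).2 hne', ih hξ' hnc' hB₀' ha hcard, mul_zero]

end Nested

/-! ### Existence of the free cumulants -/

section Cumulants

variable {k : ℕ} {A : Type*} [Ring A] [StarRing A] [Algebra ℂ A] (S : OVSpace k A)

theorem isBlocks_parts {α : Type*} [DecidableEq α] {s : Finset α} (ξ : Finpartition s) :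
    IsBlocks ξ.parts :=
  ⟨fun _ hB => ξ.nonempty_of_mem_parts hB, fun _ hB _ hB' _ hx hx' =>
    ξ.eq_of_mem_parts hB hB' hx hx'⟩

open Classical in
/-- The free cumulants, defined by induction through the moment-cumulant relation. -/
noncomputable def cumulantFun (n : ℕ) : (Fin n → A) → SymAlg k := fun a =>
  S.E (List.ofFn a).prod -
    ∑ ξ : Finpartition (Finset.univ : Finset (Fin n)) with
      IsNonCrossing ξ ∧ ξ.parts ≠ {Finset.univ},
      -- The guard is for termination only: a partition other than the one-block one has blocks of
      -- size less than `n`, so the default `0` is never used.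
      nested S (fun m b => if _h : m < n then cumulantFun m b else 0) ξ.parts a
termination_by n

/-- The cumulants of order less than `n`, extended by zero. -/
noncomputable def truncatedCumulant (n m : ℕ) : (Fin m → A) → SymAlg k := fun b =>
  if m < n then cumulantFun S m b else 0

open Classical in
theorem cumulantFun_eq (n : ℕ) (a : Fin n → A) : cumulantFun S n a = S.E (List.ofFn a).prod -
    ∑ ξ : Finpartition (Finset.univ : Finset (Fin n)) with
      IsNonCrossing ξ ∧ ξ.parts ≠ {Finset.univ}, nested S (truncatedCumulant S n) ξ.parts a := by
  rw [cumulantFun]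
  rfl

/-- By strong induction, the moment map and each nested term built from lower orders are linear in
each argument. -/
theorem exists_multilinearMap_cumulantFun (n : ℕ) :
    ∃ g : MultilinearMap ℂ (fun _ : Fin n => A) (SymAlg k), cumulantFun S n = g := by
  classical
  induction n using Nat.strong_induction_on with
  | _ n ih =>
    have hM : ∀ m, ∃ g : MultilinearMap ℂ (fun _ : Fin m => A) (SymAlg k),
        truncatedCumulant S n m = g := by
      intro m
      by_cases hm : m < n
      · obtain ⟨g, hg⟩ := ih m hm
        exact ⟨g, by rw [← hg]; funext b; exact if_pos hm⟩
      · exact ⟨0, by funext b; exact if_neg hm⟩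
    have hlin : ∀ (a : Fin n → A) (x : Fin n),
        IsLinearMap ℂ fun y => cumulantFun S n (Function.update a x y) := by
      intro a x
      have hE : ∀ y, S.E (List.ofFn (Function.update a x y)).prod =
          (S.E ∘ₗ (MultilinearMap.mkPiAlgebraFin ℂ n A).toLinearMap a x) y := by
        intro y
        simp [MultilinearMap.toLinearMap]
      have hnest : ∀ ξ : Finpartition (Finset.univ : Finset (Fin n)), IsNonCrossing ξ →
          IsLinearMap ℂ fun y => nested S (truncatedCumulant S n) ξ.parts
            (Function.update a x y) := by
        intro ξ hξ
        refine isLinearMap_nested S hM (isBlocks_parts ξ) hξ ?_ a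
        rw [ξ.sup_parts]
        exact Finset.mem_univ x
      constructor
      · intro y z
        simp only [cumulantFun_eq, hE, map_add]
        rw [← add_sub_add_comm, ← Finset.sum_add_distrib]
        congr 1
        refine Finset.sum_congr rfl fun ξ hξ => ?_
        exact (hnest ξ (Finset.mem_filter.1 hξ).2.1).map_add y z
      · intro c y
        simp only [cumulantFun_eq, hE, map_smul]
        rw [smul_sub, Finset.smul_sum]
        congr 1
        refine Finset.sum_congr rfl fun ξ hξ => ?_
        exact (hnest ξ (Finset.mem_filter.1 hξ).2.1).map_smul c y
    refine ⟨⟨cumulantFun S n, ?_, ?_⟩, rfl⟩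
    · intro inst a x y z
      obtain rfl := Subsingleton.elim inst (fun a b => instDecidableEqFin n a b)
      exact (hlin a x).map_add y z
    · intro inst a x c y
      obtain rfl := Subsingleton.elim inst (fun a b => instDecidableEqFin n a b)
      exact (hlin a x).map_smul c y

/-- The free cumulants as multilinear maps. -/
noncomputable def cumulant (n : ℕ) : MultilinearMap ℂ (fun _ : Fin n => A) (SymAlg k) :=
  (exists_multilinearMap_cumulantFun S n).choose

theorem coe_cumulant (n : ℕ) : ⇑(cumulant S n) = cumulantFun S n :=
  (exists_multilinearMap_cumulantFun S n).choose_spec.symm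

theorem card_lt_of_mem_parts {n : ℕ} {ξ : Finpartition (Finset.univ : Finset (Fin n))}
    (hξ : ξ.parts ≠ {Finset.univ}) {B : Finset (Fin n)} (hB : B ∈ ξ.parts) : B.card < n := by
  have hle : B.card ≤ n := by simpa using Finset.card_le_univ B
  refine lt_of_le_of_ne hle fun hcard => hξ ?_
  have hBu : B = Finset.univ := (Finset.card_eq_iff_eq_univ B).1 (by simpa using hcard)
  subst hBu
  refine Finset.eq_singleton_iff_unique_mem.2 ⟨hB, fun B' hB' => ?_⟩
  obtain ⟨x, hx⟩ := ξ.nonempty_of_mem_parts hB'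
  exact ξ.eq_of_mem_parts hB' hB hx (Finset.mem_univ x)

open Classical in
/-- The moment-cumulant relation with the cumulant of highest order isolated. -/
theorem E_prod_eq_cumulant_add (n : ℕ) (a : Fin n → A) :
    S.E (List.ofFn a).prod = cumulant S n a +
      ∑ ξ : Finpartition (Finset.univ : Finset (Fin n)) with
        IsNonCrossing ξ ∧ ξ.parts ≠ {Finset.univ}, nested S (fun n => cumulant S n) ξ.parts a := by
  rw [coe_cumulant, cumulantFun_eq]
  rw [Finset.sum_congr rfl (g := fun ξ => nested S (fun n => cumulant S n) ξ.parts a), sub_add_cancel]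
  intro ξ hξ
  refine nested_congr S (fun B hB => ?_) fun _ _ => rfl
  have hlt := card_lt_of_mem_parts (Finset.mem_filter.1 hξ).2.2 hB
  rw [coe_cumulant]
  funext b
  exact if_pos hlt

/-- The one-block partition contributes the cumulant of order `n` itself, and the remaining
partitions give the subtracted sum. For `n = 0` there is no one-block partition, hence the bound on
`n`. -/
theorem isFreeCumulants_cumulant : IsFreeCumulants S (cumulant S) := by
  classical
  intro n hn a
  have hne : (Finset.univ : Finset (Fin n)) ≠ ⊥ :=
    Finset.Nonempty.ne_empty ⟨⟨0, hn⟩, Finset.mem_univ _⟩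
  have htop : (Finset.univ.filter fun ξ : Finpartition (Finset.univ : Finset (Fin n)) =>
      IsNonCrossing ξ) = insert (Finpartition.indiscrete hne)
        (Finset.univ.filter fun ξ : Finpartition (Finset.univ : Finset (Fin n)) =>
          IsNonCrossing ξ ∧ ξ.parts ≠ {Finset.univ}) := by
    ext ξ
    simp only [Finset.mem_filter, Finset.mem_univ, true_and, Finset.mem_insert]
    by_cases hξ : ξ.parts = {Finset.univ}
    · have : ξ = Finpartition.indiscrete hne := Finpartition.ext hξ
      simp only [this, true_or, iff_true]
      intro B hB B' hB'
      have h1 := Finset.mem_singleton.1 hB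
      have h2 := Finset.mem_singleton.1 hB'
      intros
      rw [h1, h2]
    · have : ξ ≠ Finpartition.indiscrete hne := fun e => hξ (e ▸ rfl)
      simp [hξ, this]
  rw [E_prod_eq_cumulant_add]
  have hgoal : ∑ ξ : Finpartition (Finset.univ : Finset (Fin n)) with IsNonCrossing ξ,
        nested S (fun n => cumulant S n) ξ.parts a =
      nested S (fun n => cumulant S n) {Finset.univ} a +
      ∑ ξ : Finpartition (Finset.univ : Finset (Fin n)) with
        IsNonCrossing ξ ∧ ξ.parts ≠ {Finset.univ}, nested S (fun n => cumulant S n) ξ.parts a := by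
    rw [htop, Finset.sum_insert]
    · rfl
    · simp
  rw [nested_singleton S _ ⟨⟨0, hn⟩, Finset.mem_univ _⟩, blockValue_univ] at hgoal
  convert hgoal.symm

end Cumulants


/-! ### Complex random variables with finite moments -/

/-- A complex random variable with finite moments of all orders. -/
def HasMoments {Ω : Type*} [MeasurableSpace Ω] (P : Measure Ω) (f : Ω → ℂ) : Prop :=
  ∀ p : ℕ, MemLp f p P

section HasMoments

variable {Ω : Type*} [MeasurableSpace Ω] {P : Measure Ω} {f g : Ω → ℂ}

theorem HasMoments.integrable (hf : HasMoments P f) : Integrable f P :=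
  memLp_one_iff_integrable.1 (by simpa using hf 1)

theorem HasMoments.add (hf : HasMoments P f) (hg : HasMoments P g) :
    HasMoments P fun ω => f ω + g ω := fun p => (hf p).add (hg p)

/-- Hölder's inequality with both exponents equal to `2p`. -/
theorem HasMoments.mul (hf : HasMoments P f) (hg : HasMoments P g) :
    HasMoments P fun ω => f ω * g ω := by
  intro p
  have : ENNReal.HolderTriple ((2 * p : ℕ) : ENNReal) ((2 * p : ℕ) : ENNReal) (p : ENNReal) := by
    constructor
    rw [← two_mul]
    push_cast
    rw [ENNReal.mul_inv (by simp) (by simp), ← mul_assoc,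
      ENNReal.mul_inv_cancel (by simp) (by simp), one_mul]
  exact (hg (2 * p)).mul' (hf (2 * p))

theorem HasMoments.star (hf : HasMoments P f) : HasMoments P fun ω => star (f ω) :=
  fun p => (hf p).star

theorem hasMoments_const [IsFiniteMeasure P] (c : ℂ) : HasMoments P fun _ => c :=
  fun _ => memLp_const c

theorem HasMoments.sum {α : Type*} [IsFiniteMeasure P] (s : Finset α) {f : α → Ω → ℂ}
    (hf : ∀ i ∈ s, HasMoments P (f i)) : HasMoments P fun ω => ∑ i ∈ s, f i ω := by
  classical
  induction s using Finset.induction_on with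
  | empty => simpa using hasMoments_const 0
  | insert i s hi ih =>
    simp only [Finset.sum_insert hi]
    exact (hf i (Finset.mem_insert_self i s)).add
      (ih fun j hj => hf j (Finset.mem_insert_of_mem hj))

theorem HasMoments.prod {α : Type*} [IsFiniteMeasure P] (s : Finset α) {f : α → Ω → ℂ}
    (hf : ∀ i ∈ s, HasMoments P (f i)) : HasMoments P fun ω => ∏ i ∈ s, f i ω := by
  classical
  induction s using Finset.induction_on with
  | empty => simpa using hasMoments_const 1
  | insert i s hi ih =>
    simp only [Finset.prod_insert hi]
    exact (hf i (Finset.mem_insert_self i s)).mul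
      (ih fun j hj => hf j (Finset.mem_insert_of_mem hj))

end HasMoments

/-! ### Products of flattenings -/

/-- The permutation through which the entries of `adj ε (flattening T σ) * permMatrix N η` read the
tensor `T`. -/
def letterPerm {k : ℕ} (σ : Equiv.Perm (Fin (k + k))) (ε : Bool) (η : Equiv.Perm (Fin k)) :
    Equiv.Perm (Fin (k + k)) :=
  if ε then swapHalves k * glue η⁻¹ 1 * σ else glue 1 η⁻¹ * σ

/-- This is the same change of `ρ` as in `unitMat_mul_realPerm`. It makes the algebraic operation
`m_σ^ε u_η u_η'` and the absorption of a permutation matrix in a word agree. -/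
theorem letterPerm_mul {k : ℕ} (σ : Equiv.Perm (Fin (k + k))) (ε : Bool)
    (η η' : Equiv.Perm (Fin k)) :
    letterPerm σ ε (η * η') = glue 1 η'⁻¹ * letterPerm σ ε η := by
  cases ε
  · simp [letterPerm, ← mul_assoc, glue_mul]
  · simp only [letterPerm, if_true, mul_inv_rev, ← mul_assoc, ← swapHalves_mul_glue]
    rw [mul_assoc (swapHalves k) (glue η'⁻¹ 1), glue_mul, mul_one]

section Expansion

variable {N k : ℕ}

theorem mul_permMatrix_apply (A : Mat N k) (η : Equiv.Perm (Fin k)) (i j : Fin k → Fin N) :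
    (A * permMatrix N η) i j = A i (j ∘ η.symm) := by
  simp [Matrix.mul_apply, permMatrix]

/-- Each entry of the product reads a single entry of the tensor; the adjoint exchanges the two
halves of the multi-index, whence `τ` in `letterPerm`. -/
theorem flattening_mul_permMatrix (T : Tensor N k) (σ : Equiv.Perm (Fin (k + k))) (ε : Bool)
    (η : Equiv.Perm (Fin k)) :
    adj ε (flattening T σ) * permMatrix N η =
      ∑ v, adj ε (T v) • (unitMat (letterPerm σ ε η) v).map Complex.ofReal := by
  ext i j
  have hsum : (∑ v, adj ε (T v) • (unitMat (letterPerm σ ε η) v).map Complex.ofReal) i j =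
      adj ε (T (Fin.append i j ∘ letterPerm σ ε η)) := by
    simp [Matrix.sum_apply, unitMat, apply_ite Complex.ofReal]
  rw [hsum, mul_permMatrix_apply]
  cases ε
  · simp only [adj, letterPerm, flattening, Matrix.of_apply, Bool.false_eq_true, if_false,
      Equiv.Perm.coe_mul, ← Function.comp_assoc, append_comp_glue]
    rfl
  · simp only [adj, letterPerm, flattening, Matrix.of_apply, if_true, Matrix.star_apply,
      Equiv.Perm.coe_mul, ← Function.comp_assoc, append_comp_swapHalves, append_comp_glue]
    rfl

theorem permMatrix_eq_map (η : Equiv.Perm (Fin k)) :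
    permMatrix N η = (realPerm N η).map Complex.ofReal := by
  ext i j
  simp [permMatrix, realPerm, apply_ite Complex.ofReal]

theorem permMatrix_conjTranspose (η : Equiv.Perm (Fin k)) :
    (permMatrix N η)ᴴ = permMatrix N η⁻¹ := by
  ext i j
  have : (j = i ∘ η.symm) ↔ (i = j ∘ (η⁻¹).symm) := (eq_comp_symm_iff η⁻¹ i j).symm
  simp [permMatrix, this]

theorem permMatrix_mul (η η' : Equiv.Perm (Fin k)) :
    permMatrix N η * permMatrix N η' = permMatrix N (η * η') := by
  simp only [permMatrix_eq_map, ← realPerm_mul_realPerm]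
  exact (Matrix.map_mul (f := Complex.ofRealHom)).symm

theorem permMatrix_one : permMatrix N (1 : Equiv.Perm (Fin k)) = 1 := by
  rw [permMatrix_eq_map, realPerm_one]
  exact Matrix.map_one _ Complex.ofReal_zero Complex.ofReal_one

variable {L : ℕ}

/-- The indicator that a family of multi-indices closes up along the permutation `ζ`. -/
def chainTrace (N : ℕ) (ρ : Fin L → Equiv.Perm (Fin (k + k)))
    (θ : Fin L → Fin (k + k) → Fin N) (ζ : Equiv.Perm (Fin k)) : ℝ :=
  ((List.ofFn fun l => unitMat (ρ l) (θ l)).prod * realPerm N ζ⁻¹).trace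

/-- The expansion of the trace of a product of flattenings. -/
theorem trace_prod_flattening (T : Tensor N k) (σ : Fin L → Equiv.Perm (Fin (k + k)))
    (ε : Fin L → Bool) (η : Fin L → Equiv.Perm (Fin k)) (ζ : Equiv.Perm (Fin k)) :
    ((List.ofFn fun l => adj (ε l) (flattening T (σ l)) * permMatrix N (η l)).prod *
      (permMatrix N ζ)ᴴ).trace =
    ∑ θ : Fin L → Fin (k + k) → Fin N, (∏ l, adj (ε l) (T (θ l))) *
      (chainTrace N (fun l => letterPerm (σ l) (ε l) (η l)) θ ζ : ℂ) := by
  simp only [flattening_mul_permMatrix]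
  have h1 := (MultilinearMap.mkPiAlgebraFin ℂ L (Mat N k)).map_sum (fun l v =>
    adj (ε l) (T v) • (unitMat (letterPerm (σ l) (ε l) (η l)) v).map Complex.ofReal)
  simp only [MultilinearMap.map_smul_univ, MultilinearMap.mkPiAlgebraFin_apply] at h1
  rw [h1, Finset.sum_mul, Matrix.trace_sum]
  refine Finset.sum_congr rfl fun θ _ => ?_
  rw [smul_mul_assoc, Matrix.trace_smul, smul_eq_mul]
  congr 1
  rw [permMatrix_conjTranspose, permMatrix_eq_map, chainTrace]
  have h2 : (List.ofFn fun l => (unitMat (letterPerm (σ l) (ε l) (η l)) (θ l)).map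
      Complex.ofReal).prod = ((List.ofFn fun l =>
        unitMat (letterPerm (σ l) (ε l) (η l)) (θ l)).prod).map Complex.ofReal := by
    have := map_list_prod (Complex.ofRealHom.mapMatrix (m := Fin k → Fin N))
      (List.ofFn fun l => unitMat (letterPerm (σ l) (ε l) (η l)) (θ l))
    rw [List.map_ofFn] at this
    exact this.symm
  rw [h2]
  have h3 := (Matrix.map_mul (f := Complex.ofRealHom)
    (L := (List.ofFn fun l => unitMat (letterPerm (σ l) (ε l) (η l)) (θ l)).prod)
    (M := realPerm N ζ⁻¹))
  have h4 := (AddMonoidHom.map_trace Complex.ofRealHom.toAddMonoidHom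
    ((List.ofFn fun l => unitMat (letterPerm (σ l) (ε l) (η l)) (θ l)).prod * realPerm N ζ⁻¹))
  exact (congrArg Matrix.trace h3.symm).trans h4.symm

end Expansion

/-! ### Kernel partitions -/

section KernelPartition

variable {L : ℕ}

open Classical in
/-- The partition of the positions according to the value of `θ`. -/
noncomputable def kerPart {V : Type*} (θ : Fin L → V) : Finpartition (Finset.univ : Finset (Fin L)) :=
  Finpartition.ofSetoid (Setoid.ker θ)

/-- The block of a position. -/
def blockOf (π : Finpartition (Finset.univ : Finset (Fin L))) (l : Fin L) :
    {B // B ∈ π.parts} :=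
  ⟨π.part l, π.part_mem.2 (Finset.mem_univ l)⟩

theorem mem_part_kerPart {V : Type*} (θ : Fin L → V) (l l' : Fin L) :
    l' ∈ (kerPart θ).part l ↔ θ l = θ l' := by
  classical
  rw [kerPart]
  exact Finpartition.mem_part_ofSetoid_iff_rel

theorem blockOf_eq_iff (π : Finpartition (Finset.univ : Finset (Fin L))) (l l' : Fin L) :
    blockOf π l = blockOf π l' ↔ l' ∈ π.part l := by
  rw [blockOf, blockOf, Subtype.mk.injEq]
  constructor
  · intro h
    rw [h]
    exact π.mem_part (Finset.mem_univ _)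
  · intro h
    exact (π.part_eq_of_mem (π.part_mem.2 (Finset.mem_univ l)) h).symm

theorem blockOf_eq_of_mem (π : Finpartition (Finset.univ : Finset (Fin L)))
    (B : {B // B ∈ π.parts}) {l : Fin L} (hl : l ∈ B.1) : blockOf π l = B :=
  Subtype.ext (π.part_eq_of_mem B.2 hl)

theorem blockOf_surjective (π : Finpartition (Finset.univ : Finset (Fin L))) :
    Function.Surjective (blockOf π) := by
  intro B
  obtain ⟨l, hl⟩ := π.nonempty_of_mem_parts B.2
  exact ⟨l, blockOf_eq_of_mem π B hl⟩

theorem finpartition_ext_part {π π' : Finpartition (Finset.univ : Finset (Fin L))}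
    (h : ∀ l, π.part l = π'.part l) : π = π' := by
  have key : ∀ {π π' : Finpartition (Finset.univ : Finset (Fin L))},
      (∀ l, π.part l = π'.part l) → π.parts ⊆ π'.parts := by
    intro π π' h B hB
    obtain ⟨l, hl⟩ := π.nonempty_of_mem_parts hB
    rw [← π.part_eq_of_mem hB hl, h]
    exact π'.part_mem.2 (Finset.mem_univ l)
  exact Finpartition.ext ((key h).antisymm (key fun l => (h l).symm))

/-- Families of multi-indices with kernel exactly `π` are the injective labellings of the blocks of
`π`. All labellings together are what `loopCount` counts. -/
theorem kerPart_comp_blockOf {V : Type*} (π : Finpartition (Finset.univ : Finset (Fin L)))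
    (γ : {B // B ∈ π.parts} → V) : kerPart (γ ∘ blockOf π) = π ↔ Function.Injective γ := by
  constructor
  · intro h B B' hBB
    obtain ⟨l, rfl⟩ := blockOf_surjective π B
    obtain ⟨l', rfl⟩ := blockOf_surjective π B'
    rw [blockOf_eq_iff, ← h, mem_part_kerPart]
    exact hBB
  · intro h
    refine finpartition_ext_part fun l => ?_
    ext l'
    rw [mem_part_kerPart, ← blockOf_eq_iff]
    exact h.eq_iff

theorem exists_eq_comp_blockOf {V : Type*} (θ : Fin L → V) :
    ∃ γ : {B // B ∈ (kerPart θ).parts} → V, θ = γ ∘ blockOf (kerPart θ) := by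
  refine ⟨fun B => θ (Function.surjInv (blockOf_surjective (kerPart θ)) B), ?_⟩
  funext l
  have := Function.surjInv_eq (blockOf_surjective (kerPart θ)) (blockOf (kerPart θ) l)
  rw [blockOf_eq_iff, mem_part_kerPart] at this
  exact this.symm

/-- A coincidence of labels merges blocks of `π`. -/
theorem card_kerPart_lt {V : Type*} (π : Finpartition (Finset.univ : Finset (Fin L)))
    (γ : {B // B ∈ π.parts} → V) (h : ¬ Function.Injective γ) :
    (kerPart (γ ∘ blockOf π)).parts.card < π.parts.card := by
  rw [← Fintype.card_coe, ← Fintype.card_coe]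
  let F : {B // B ∈ π.parts} → {B // B ∈ (kerPart (γ ∘ blockOf π)).parts} := fun B =>
    blockOf _ (Function.surjInv (blockOf_surjective π) B)
  have hF : ∀ l, F (blockOf π l) = blockOf (kerPart (γ ∘ blockOf π)) l := by
    intro l
    rw [blockOf_eq_iff, mem_part_kerPart]
    simp [Function.surjInv_eq (blockOf_surjective π)]
  have hsurj : Function.Surjective F := by
    intro B
    obtain ⟨l, rfl⟩ := blockOf_surjective _ B
    exact ⟨blockOf π l, hF l⟩
  refine Fintype.card_lt_of_surjective_not_injective F hsurj fun hinj => h ?_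
  intro B B' hBB
  obtain ⟨l, rfl⟩ := blockOf_surjective π B
  obtain ⟨l', rfl⟩ := blockOf_surjective π B'
  apply hinj
  rw [hF, hF, blockOf_eq_iff, mem_part_kerPart]
  exact hBB

/-- Independence gives a product over all entries of the tensor; entries that are not read have an
empty fiber and contribute `1`. -/
theorem prod_fibers_eq_prod_parts {V : Type*} [Fintype V] [DecidableEq V] (θ : Fin L → V)
    (F : Finset (Fin L) → ℂ) (hF : F ∅ = 1) :
    ∏ v, F (Finset.univ.filter fun l => θ l = v) = ∏ B ∈ (kerPart θ).parts, F B := by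
  have h1 : ∏ v, F (Finset.univ.filter fun l => θ l = v) =
      ∏ v ∈ Finset.univ.image θ, F (Finset.univ.filter fun l => θ l = v) := by
    refine (Finset.prod_subset (Finset.subset_univ _) fun v _ hv => ?_).symm
    rw [Finset.filter_eq_empty_iff.2, hF]
    intro l _ hl
    exact hv (Finset.mem_image.2 ⟨l, Finset.mem_univ l, hl⟩)
  have hpart : ∀ l, (kerPart θ).part l = Finset.univ.filter fun l' => θ l' = θ l := by
    intro l
    ext l'
    rw [mem_part_kerPart]
    simp [eq_comm]
  have h2 : (kerPart θ).parts =
      (Finset.univ.image θ).image fun v => Finset.univ.filter fun l => θ l = v := by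
    ext B
    constructor
    · intro hB
      obtain ⟨l, hl⟩ := (kerPart θ).nonempty_of_mem_parts hB
      refine Finset.mem_image.2 ⟨θ l, Finset.mem_image_of_mem _ (Finset.mem_univ l), ?_⟩
      rw [← hpart]
      exact (kerPart θ).part_eq_of_mem hB hl
    · intro hB
      obtain ⟨v, hv, rfl⟩ := Finset.mem_image.1 hB
      obtain ⟨l, -, rfl⟩ := Finset.mem_image.1 hv
      rw [← hpart]
      exact (kerPart θ).part_mem.2 (Finset.mem_univ l)
  rw [h1, h2]
  refine (Finset.prod_image ?_).symm
  intro v hv w hw hvw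
  obtain ⟨l, -, rfl⟩ := Finset.mem_image.1 hv
  have : l ∈ Finset.univ.filter fun l' => θ l' = w := by
    rw [← show (Finset.univ.filter fun l' => θ l' = θ l) = Finset.univ.filter fun l' => θ l' = w
      from hvw]
    simp
  simpa using this

end KernelPartition


/-! ### Counting multi-indices with a given kernel partition -/

section KernelCount

variable {N k L : ℕ}

theorem sort_univ_fin (L : ℕ) : (Finset.univ : Finset (Fin L)).sort = List.finRange L := by
  refine sort_eq_of_sortedLT _ _ ?_ (by simp)
  rw [List.sortedLT_iff_pairwise]
  exact List.pairwise_lt_finRange L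

theorem chainTrace_comp {β : Type*} (ρ : Fin L → Equiv.Perm (Fin (k + k))) (lab : Fin L → β)
    (γ : β → Fin (k + k) → Fin N) (ζ : Equiv.Perm (Fin k)) :
    chainTrace N ρ (γ ∘ lab) ζ =
      (wordMat γ (wordOf lab ρ Finset.univ) * realPerm N ζ⁻¹).trace := by
  rw [chainTrace, wordMat, wordOf, sort_univ_fin, List.map_map, List.ofFn_eq_map]
  rfl

theorem chainTrace_nonneg (ρ : Fin L → Equiv.Perm (Fin (k + k)))
    (θ : Fin L → Fin (k + k) → Fin N) (ζ : Equiv.Perm (Fin k)) : 0 ≤ chainTrace N ρ θ ζ := by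
  have := chainTrace_comp ρ id θ ζ
  rw [Function.comp_id] at this
  rw [this]
  exact Finset.sum_nonneg fun i _ =>
    mul_apply_nonneg (wordMat_nonneg _ _) (realPerm_nonneg _) i i

theorem labels_wordOf_blockOf (ρ : Fin L → Equiv.Perm (Fin (k + k)))
    (π : Finpartition (Finset.univ : Finset (Fin L))) :
    (labels (wordOf (blockOf π) ρ Finset.univ)).card = π.parts.card := by
  have : labels (wordOf (blockOf π) ρ Finset.univ) = Finset.univ := by
    ext B
    rw [mem_labels_wordOf]
    simpa using blockOf_surjective π B
  rw [this, Finset.card_univ, Fintype.card_coe]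

/-- Dropping the closing condition leaves the number of composable labellings, which has the order
of the normalization. -/
theorem loopCount_le_one (hN : 0 < N) {β : Type*} [Fintype β] [DecidableEq β]
    (w : List (β × Equiv.Perm (Fin (k + k)))) (ζ : Equiv.Perm (Fin k)) :
    loopCount N w ζ ≤ 1 := by
  have hN' : (0 : ℝ) < (N : ℝ) ^ k := by positivity
  have h : average (fun γ : β → Fin (k + k) → Fin N => (wordMat γ w * realPerm N ζ⁻¹).trace) ≤
      (N : ℝ) ^ k * ((N : ℝ) ^ k)⁻¹ ^ (labels w).card := by
    refine le_trans (average_mono fun γ => ?_) (average_entrySum_wordMat_le hN w)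
    exact (trace_le_entrySum fun i j => mul_apply_nonneg (wordMat_nonneg _ _)
      (realPerm_nonneg _) i j).trans
      (entrySum_mul_le (wordMat_nonneg _ _) fun i => (sum_realPerm_row _ i).le)
  calc loopCount N w ζ ≤ ((N : ℝ) ^ k)⁻¹ * ((N : ℝ) ^ k) ^ (labels w).card *
        ((N : ℝ) ^ k * ((N : ℝ) ^ k)⁻¹ ^ (labels w).card) :=
        mul_le_mul_of_nonneg_left h (by positivity)
    _ = 1 := by
        rw [inv_pow]
        have : ((N : ℝ) ^ k) ^ (labels w).card ≠ 0 := by positivity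
        field_simp

/-- The scaling of the counts for `r` blocks. -/
noncomputable def countScale (N k r : ℕ) : ℝ := ((N : ℝ) ^ k)⁻¹ * ((N : ℝ) ^ k)⁻¹ ^ r

theorem loopCount_eq_sum (hN : 0 < N) (ρ : Fin L → Equiv.Perm (Fin (k + k)))
    (π : Finpartition (Finset.univ : Finset (Fin L))) (ζ : Equiv.Perm (Fin k)) :
    loopCount N (wordOf (blockOf π) ρ Finset.univ) ζ = countScale N k π.parts.card *
      ∑ γ : {B // B ∈ π.parts} → Fin (k + k) → Fin N, chainTrace N ρ (γ ∘ blockOf π) ζ := by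
  have hN' : (0 : ℝ) < (N : ℝ) ^ k := by positivity
  have hcard : (Fintype.card ({B // B ∈ π.parts} → Fin (k + k) → Fin N) : ℝ) =
      ((N : ℝ) ^ k) ^ π.parts.card * ((N : ℝ) ^ k) ^ π.parts.card := by
    rw [Fintype.card_fun, Nat.cast_pow, card_multiIndex, Fintype.card_coe, mul_pow]
  rw [loopCount, average, hcard, labels_wordOf_blockOf, countScale]
  simp only [chainTrace_comp]
  have : ((N : ℝ) ^ k) ^ π.parts.card ≠ 0 := by positivity
  rw [inv_pow]
  field_simp

open Classical in
/-- The normalized number of closed families with kernel partition `π`. -/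
noncomputable def kerCount (N : ℕ) (ρ : Fin L → Equiv.Perm (Fin (k + k))) (ζ : Equiv.Perm (Fin k))
    (π : Finpartition (Finset.univ : Finset (Fin L))) : ℝ :=
  countScale N k π.parts.card *
    ∑ θ : Fin L → Fin (k + k) → Fin N with kerPart θ = π, chainTrace N ρ θ ζ

theorem countScale_nonneg (N k r : ℕ) : 0 ≤ countScale N k r := by
  unfold countScale
  positivity

theorem kerCount_nonneg (ρ : Fin L → Equiv.Perm (Fin (k + k))) (ζ : Equiv.Perm (Fin k))
    (π : Finpartition (Finset.univ : Finset (Fin L))) : 0 ≤ kerCount N ρ ζ π :=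
  mul_nonneg (countScale_nonneg _ _ _) (Finset.sum_nonneg fun _ _ => chainTrace_nonneg _ _ _)

theorem sum_kerPart_eq (π : Finpartition (Finset.univ : Finset (Fin L))) {V : Type*} [Fintype V]
    [DecidablePred fun θ : Fin L → V => kerPart θ = π]
    [DecidablePred fun γ : {B // B ∈ π.parts} → V => Function.Injective γ] (G : (Fin L → V) → ℝ) :
    ∑ θ : Fin L → V with kerPart θ = π, G θ =
      ∑ γ : {B // B ∈ π.parts} → V with Function.Injective γ, G (γ ∘ blockOf π) := by
  symm
  refine Finset.sum_bij (fun γ _ => γ ∘ blockOf π) ?_ ?_ ?_ fun _ _ => rfl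
  · intro γ hγ
    exact Finset.mem_filter.2 ⟨Finset.mem_univ _,
      (kerPart_comp_blockOf π γ).2 (Finset.mem_filter.1 hγ).2⟩
  · intro γ _ γ' _ h
    exact (blockOf_surjective π).injective_comp_right h
  · intro θ hθ
    obtain rfl := (Finset.mem_filter.1 hθ).2
    obtain ⟨γ, hγ⟩ := exists_eq_comp_blockOf θ
    refine ⟨γ, Finset.mem_filter.2 ⟨Finset.mem_univ _, ?_⟩, hγ.symm⟩
    rw [← kerPart_comp_blockOf, ← hγ]

theorem kerCount_le_loopCount (hN : 0 < N) (ρ : Fin L → Equiv.Perm (Fin (k + k)))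
    (ζ : Equiv.Perm (Fin k)) (π : Finpartition (Finset.univ : Finset (Fin L))) :
    kerCount N ρ ζ π ≤ loopCount N (wordOf (blockOf π) ρ Finset.univ) ζ := by
  classical
  rw [loopCount_eq_sum hN, kerCount, sum_kerPart_eq]
  exact mul_le_mul_of_nonneg_left (Finset.sum_le_sum_of_subset_of_nonneg (Finset.filter_subset _ _)
    fun γ _ _ => chainTrace_nonneg _ _ _) (countScale_nonneg _ _ _)

theorem kerCount_le_one (hN : 0 < N) (ρ : Fin L → Equiv.Perm (Fin (k + k)))
    (ζ : Equiv.Perm (Fin k)) (π : Finpartition (Finset.univ : Finset (Fin L))) :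
    kerCount N ρ ζ π ≤ 1 :=
  (kerCount_le_loopCount hN ρ ζ π).trans (loopCount_le_one hN _ _)

/-- Each block carries a factor `N^(-k)`, so losing at least one block gains at least `1/N`. -/
theorem countScale_le (hN : 0 < N) (hk : 1 ≤ k) {r r' : ℕ} (h : r' < r) :
    countScale N k r ≤ (N : ℝ)⁻¹ * countScale N k r' := by
  have hN1 : (1 : ℝ) ≤ N := by exact_mod_cast hN
  have hNk : (N : ℝ) ≤ (N : ℝ) ^ k := le_self_pow₀ hN1 (by omega)
  have hinv : ((N : ℝ) ^ k)⁻¹ ≤ (N : ℝ)⁻¹ := inv_anti₀ (by positivity) hNk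
  have hinv1 : ((N : ℝ) ^ k)⁻¹ ≤ 1 := inv_le_one_of_one_le₀ (hN1.trans hNk)
  obtain ⟨d, rfl⟩ := Nat.exists_eq_add_of_lt h
  have hpow : ((N : ℝ) ^ k)⁻¹ ^ (r' + d + 1) ≤ (N : ℝ)⁻¹ * ((N : ℝ) ^ k)⁻¹ ^ r' := by
    calc ((N : ℝ) ^ k)⁻¹ ^ (r' + d + 1) ≤ ((N : ℝ) ^ k)⁻¹ ^ (r' + 1) :=
          pow_le_pow_of_le_one (by positivity) hinv1 (by omega)
      _ = ((N : ℝ) ^ k)⁻¹ * ((N : ℝ) ^ k)⁻¹ ^ r' := by rw [pow_succ]; ring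
      _ ≤ _ := mul_le_mul_of_nonneg_right hinv (by positivity)
  calc countScale N k (r' + d + 1) ≤ ((N : ℝ) ^ k)⁻¹ * ((N : ℝ)⁻¹ * ((N : ℝ) ^ k)⁻¹ ^ r') :=
        mul_le_mul_of_nonneg_left hpow (by positivity)
    _ = _ := by rw [countScale]; ring

/-- Labellings that are not injective are negligible. -/
theorem loopCount_sub_kerCount_le (hN : 0 < N) (hk : 1 ≤ k)
    (ρ : Fin L → Equiv.Perm (Fin (k + k))) (ζ : Equiv.Perm (Fin k))
    (π : Finpartition (Finset.univ : Finset (Fin L))) :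
    loopCount N (wordOf (blockOf π) ρ Finset.univ) ζ - kerCount N ρ ζ π ≤
      Fintype.card (Finpartition (Finset.univ : Finset (Fin L))) * (N : ℝ)⁻¹ := by
  classical
  have h1 : loopCount N (wordOf (blockOf π) ρ Finset.univ) ζ - kerCount N ρ ζ π =
      countScale N k π.parts.card * ∑ γ : {B // B ∈ π.parts} → Fin (k + k) → Fin N with
        ¬ Function.Injective γ, chainTrace N ρ (γ ∘ blockOf π) ζ := by
    rw [loopCount_eq_sum hN, kerCount, sum_kerPart_eq, ← mul_sub,
      ← Finset.sum_filter_add_sum_filter_not Finset.univ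
        (fun γ : {B // B ∈ π.parts} → Fin (k + k) → Fin N => Function.Injective γ),
      add_sub_cancel_left]
  have h2 : ∑ γ : {B // B ∈ π.parts} → Fin (k + k) → Fin N with
        ¬ Function.Injective γ, chainTrace N ρ (γ ∘ blockOf π) ζ ≤
      ∑ θ : Fin L → Fin (k + k) → Fin N with (kerPart θ).parts.card < π.parts.card,
        chainTrace N ρ θ ζ := by
    rw [← Finset.sum_image (f := fun θ => chainTrace N ρ θ ζ)
      (g := fun γ : {B // B ∈ π.parts} → Fin (k + k) → Fin N => γ ∘ blockOf π)
      (fun γ _ γ' _ h => (blockOf_surjective π).injective_comp_right h)]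
    refine Finset.sum_le_sum_of_subset_of_nonneg ?_ fun θ _ _ => chainTrace_nonneg _ _ _
    intro θ hθ
    obtain ⟨γ, hγ, rfl⟩ := Finset.mem_image.1 hθ
    exact Finset.mem_filter.2 ⟨Finset.mem_univ _, card_kerPart_lt π γ (Finset.mem_filter.1 hγ).2⟩
  -- The families with fewer blocks are regrouped by their exact kernel `π'`. Each group has count
  -- at most `1` in its own scaling, hence at most `1/N` in that of `π`.
  have h3 : ∑ θ : Fin L → Fin (k + k) → Fin N with (kerPart θ).parts.card < π.parts.card,
        chainTrace N ρ θ ζ =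
      ∑ π' : Finpartition (Finset.univ : Finset (Fin L)) with π'.parts.card < π.parts.card,
        ∑ θ : Fin L → Fin (k + k) → Fin N with kerPart θ = π', chainTrace N ρ θ ζ := by
    rw [Finset.sum_filter, ← Finset.sum_fiberwise Finset.univ kerPart, Finset.sum_filter]
    refine Finset.sum_congr rfl fun π' _ => ?_
    split_ifs with h
    · refine Finset.sum_congr rfl fun θ hθ => ?_
      rw [(Finset.mem_filter.1 hθ).2, if_pos h]
    · refine Finset.sum_eq_zero fun θ hθ => ?_
      rw [(Finset.mem_filter.1 hθ).2, if_neg h]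
  rw [h1]
  calc _ ≤ countScale N k π.parts.card * ∑ π' : Finpartition (Finset.univ : Finset (Fin L)) with
        π'.parts.card < π.parts.card,
        ∑ θ : Fin L → Fin (k + k) → Fin N with kerPart θ = π', chainTrace N ρ θ ζ :=
        mul_le_mul_of_nonneg_left (h2.trans h3.le) (countScale_nonneg _ _ _)
    _ ≤ ∑ π' : Finpartition (Finset.univ : Finset (Fin L)) with
        π'.parts.card < π.parts.card, (N : ℝ)⁻¹ := by
        rw [Finset.mul_sum]
        refine Finset.sum_le_sum fun π' hπ' => ?_
        have hlt := (Finset.mem_filter.1 hπ').2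
        calc _ ≤ (N : ℝ)⁻¹ * countScale N k π'.parts.card *
              ∑ θ : Fin L → Fin (k + k) → Fin N with kerPart θ = π', chainTrace N ρ θ ζ :=
              mul_le_mul_of_nonneg_right (countScale_le hN hk hlt)
                (Finset.sum_nonneg fun θ _ => chainTrace_nonneg _ _ _)
          _ = (N : ℝ)⁻¹ * kerCount N ρ ζ π' := by rw [kerCount, mul_assoc]
          _ ≤ (N : ℝ)⁻¹ := mul_le_of_le_one_right (by positivity) (kerCount_le_one hN ρ ζ π')
    _ ≤ _ := by
        rw [Finset.sum_const, nsmul_eq_mul]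
        refine mul_le_mul_of_nonneg_right ?_ (by positivity)
        exact_mod_cast Finset.card_le_univ _

theorem tendsto_kerCount (hk : 1 ≤ k) (ρ : Fin L → Equiv.Perm (Fin (k + k)))
    (ζ : Equiv.Perm (Fin k)) (π : Finpartition (Finset.univ : Finset (Fin L))) {Λ : ℝ}
    (h : Tendsto (fun N => loopCount N (wordOf (blockOf π) ρ Finset.univ) ζ) atTop (𝓝 Λ)) :
    Tendsto (fun N => kerCount N ρ ζ π) atTop (𝓝 Λ) := by
  have hdiff : Tendsto (fun N : ℕ => loopCount N (wordOf (blockOf π) ρ Finset.univ) ζ -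
      kerCount N ρ ζ π) atTop (𝓝 0) := by
    have hlim : Tendsto (fun N : ℕ => (Fintype.card
        (Finpartition (Finset.univ : Finset (Fin L))) : ℝ) * (N : ℝ)⁻¹) atTop (𝓝 0) := by
      simpa using tendsto_inv_atTop_nhds_zero_nat.const_mul
        (Fintype.card (Finpartition (Finset.univ : Finset (Fin L))) : ℝ)
    refine squeeze_zero' ?_ ?_ hlim
    · filter_upwards [eventually_gt_atTop 0] with N hN
      exact sub_nonneg.2 (kerCount_le_loopCount hN ρ ζ π)
    · filter_upwards [eventually_gt_atTop 0] with N hN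
      exact loopCount_sub_kerCount_le hN hk ρ ζ π
  simpa using h.sub hdiff

end KernelCount

/-! ### Mixed moments -/

section Moments

variable {N k L : ℕ}

/-- The mixed moment of the law `ν` for the exponents read on the block `B`. -/
noncomputable def blockMoment (ν : Measure ℂ) (ε : Fin L → Bool) (B : Finset (Fin L)) : ℂ :=
  ∫ z, z ^ (B.filter fun l => ε l = false).card * conj z ^ (B.filter fun l => ε l = true).card ∂ν

theorem prod_adj_eq {α : Type*} (s : Finset α) (ε : α → Bool) (z : ℂ) :
    ∏ l ∈ s, adj (ε l) z = z ^ (s.filter fun l => ε l = false).card *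
      conj z ^ (s.filter fun l => ε l = true).card := by
  rw [← Finset.prod_filter_mul_prod_filter_not s (fun l => ε l = false)]
  congr 1
  · rw [Finset.prod_congr rfl (g := fun _ => z), Finset.prod_const]
    intro l hl
    simp [adj, (Finset.mem_filter.1 hl).2]
  · rw [Finset.prod_congr (s₂ := s.filter fun l => ε l = true) (g := fun _ => conj z),
      Finset.prod_const]
    · ext l
      simp
    · intro l hl
      simp [adj, (Finset.mem_filter.1 hl).2]

variable {Ω : Type*} [MeasurableSpace Ω] {P : Measure Ω} [IsProbabilityMeasure P]
  {T : Ω → Tensor N k} {ν : Measure ℂ}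

/-- Factors reading the same entry are gathered into one mixed power; distinct entries are
independent, so each block yields one moment of the common law. -/
theorem integral_prod_adj (hlaw : ∀ i, HasLaw (fun ω => T ω i) ν P)
    (hind : iIndepFun (fun (i : Fin (k + k) → Fin N) (ω : Ω) => T ω i) P)
    (ε : Fin L → Bool) (θ : Fin L → Fin (k + k) → Fin N) :
    ∫ ω, ∏ l, adj (ε l) (T ω (θ l)) ∂P = ∏ B ∈ (kerPart θ).parts, blockMoment ν ε B := by
  classical
  let f : (Fin (k + k) → Fin N) → ℂ → ℂ := fun v z =>
    z ^ ((Finset.univ.filter fun l => θ l = v).filter fun l => ε l = false).card *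
      conj z ^ ((Finset.univ.filter fun l => θ l = v).filter fun l => ε l = true).card
  have hf : ∀ v, Continuous (f v) := fun v =>
    (continuous_pow _).mul (Complex.continuous_conj.pow _)
  have h1 : ∀ ω, ∏ l, adj (ε l) (T ω (θ l)) = ∏ v, f v (T ω v) := by
    intro ω
    rw [← Finset.prod_fiberwise Finset.univ θ]
    refine Finset.prod_congr rfl fun v _ => ?_
    refine (Finset.prod_congr rfl fun l hl => ?_).trans (prod_adj_eq _ ε _)
    rw [(Finset.mem_filter.1 hl).2]
  simp only [h1]
  -- Without multi-indices nothing makes `ν` a probability measure; in that case the word is empty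
  -- and both sides equal `1`.
  have hν : IsProbabilityMeasure ν ∨ IsEmpty (Fin (k + k) → Fin N) := by
    rcases isEmpty_or_nonempty (Fin (k + k) → Fin N) with h | ⟨⟨v⟩⟩
    · exact Or.inr h
    · exact Or.inl ((hlaw v).isProbabilityMeasure_iff.1 inferInstance)
  rw [hind.integral_fun_prod_comp (fun v => (hlaw v).aemeasurable)
    (fun v => (hf v).aestronglyMeasurable)]
  have h2 : ∀ v, ∫ ω, f v (T ω v) ∂P =
      blockMoment ν ε (Finset.univ.filter fun l => θ l = v) := by
    intro v
    rw [blockMoment, ← (hlaw v).map_eq,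
      integral_map (hlaw v).aemeasurable (hf v).aestronglyMeasurable]
  simp only [h2]
  rcases hν with hν | hν
  · exact prod_fibers_eq_prod_parts θ (blockMoment ν ε) (by simp [blockMoment])
  · have hL : IsEmpty (Fin L) := ⟨fun l => hν.elim (θ l)⟩
    have : (kerPart θ).parts = ∅ := by
      rw [Finset.eq_empty_iff_forall_notMem]
      intro B hB
      obtain ⟨l, -⟩ := (kerPart θ).nonempty_of_mem_parts hB
      exact hL.elim l
    simp [this]

omit [IsProbabilityMeasure P] in
theorem hasMoments_entry (hlaw : ∀ i, HasLaw (fun ω => T ω i) ν P)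
    (hmom : ∀ l : ℕ, Integrable (fun z : ℂ => ‖z‖ ^ l) ν) (i : Fin (k + k) → Fin N) :
    HasMoments P fun ω => T ω i := by
  intro p
  have hmeas : AEStronglyMeasurable (fun ω => T ω i) P := (hlaw i).aemeasurable.aestronglyMeasurable
  rcases Nat.eq_zero_or_pos p with rfl | hp
  · simpa using hmeas
  · rw [← integrable_norm_rpow_iff hmeas (by exact_mod_cast hp.ne') (by simp)]
    have := (hlaw i).map_eq ▸ hmom p
    simpa [Function.comp_def] using this.comp_aemeasurable (hlaw i).aemeasurable

theorem hasMoments_prod_adj (hent : ∀ i, HasMoments P fun ω => T ω i)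
    (ε : Fin L → Bool) (θ : Fin L → Fin (k + k) → Fin N) :
    HasMoments P fun ω => ∏ l, adj (ε l) (T ω (θ l)) := by
  refine HasMoments.prod _ fun l _ => ?_
  cases h : ε l
  · simpa [adj] using hent (θ l)
  · simpa [adj] using (hent (θ l)).star

/-- The expected trace of a product of flattenings, grouped by kernel partitions. -/
theorem expTrace_prod_flattening (hN : 0 < N) (hlaw : ∀ i, HasLaw (fun ω => T ω i) ν P)
    (hind : iIndepFun (fun (i : Fin (k + k) → Fin N) (ω : Ω) => T ω i) P)
    (hmom : ∀ l : ℕ, Integrable (fun z : ℂ => ‖z‖ ^ l) ν)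
    (σ : Fin L → Equiv.Perm (Fin (k + k))) (ε : Fin L → Bool) (η : Fin L → Equiv.Perm (Fin k))
    (ζ : Equiv.Perm (Fin k)) :
    expTrace P (fun ω => (List.ofFn fun l =>
        adj (ε l) (flattening (T ω) (σ l)) * permMatrix N (η l)).prod * (permMatrix N ζ)ᴴ) =
      ∑ π : Finpartition (Finset.univ : Finset (Fin L)),
        (∏ B ∈ π.parts, (N : ℂ) ^ k * blockMoment ν ε B) *
          (kerCount N (fun l => letterPerm (σ l) (ε l) (η l)) ζ π : ℂ) := by
  classical
  have hN' : (N : ℂ) ^ k ≠ 0 := pow_ne_zero _ (by exact_mod_cast hN.ne')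
  have hent := hasMoments_entry hlaw hmom
  rw [expTrace]
  simp only [trace_prod_flattening]
  rw [integral_const_mul, integral_finsetSum _ fun θ _ =>
    ((hasMoments_prod_adj hent ε θ).integrable.mul_const _)]
  simp only [integral_mul_const, integral_prod_adj hlaw hind]
  rw [← Finset.sum_fiberwise Finset.univ kerPart, Finset.mul_sum]
  refine Finset.sum_congr rfl fun π _ => ?_
  -- The factor `N^k` put on each moment cancels the `N^(-k)` per block in `countScale`.
  rw [kerCount, countScale, Finset.prod_mul_distrib, Finset.prod_const]
  push_cast
  have h : ∑ θ : Fin L → Fin (k + k) → Fin N with kerPart θ = π,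
      (∏ B ∈ (kerPart θ).parts, blockMoment ν ε B) *
        (chainTrace N (fun l => letterPerm (σ l) (ε l) (η l)) θ ζ : ℂ) =
      (∏ B ∈ π.parts, blockMoment ν ε B) *
      ∑ θ : Fin L → Fin (k + k) → Fin N with kerPart θ = π,
        (chainTrace N (fun l => letterPerm (σ l) (ε l) (η l)) θ ζ : ℂ) := by
    rw [Finset.mul_sum]
    refine Finset.sum_congr rfl fun θ hθ => ?_
    rw [(Finset.mem_filter.1 hθ).2]
  rw [h, inv_pow]
  have : ((N : ℂ) ^ k) ^ π.parts.card ≠ 0 := pow_ne_zero _ hN'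
  field_simp

end Moments


/-! ### Limits of the normalized counts -/

theorem IsPairing.isBlocks {ι β : Type*} {lab : ι → β} {ξ : Finset (Finset ι)}
    (h : IsPairing lab ξ) : IsBlocks ξ :=
  ⟨fun B hB => Finset.card_pos.1 (by rw [h.card_eq B hB]; norm_num),
    fun _ hB _ hB' _ hx hx' => h.eq_of_mem hB hB' hx hx'⟩

section LoopLimits

variable {ι : Type*} [LinearOrder ι] {β : Type*} [Fintype β] [DecidableEq β] {k : ℕ}
  {lab : ι → β} {ξ : Finset (Finset ι)}

/-- An interval block crosses nothing. -/
theorem nonCrossing_of_erase (hξ : IsBlocks ξ) {B : Finset ι} (hB : IsIntervalBlock ξ B)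
    (h : NonCrossing (ξ.erase B)) : NonCrossing ξ := by
  intro B₁ hB₁ B₂ hB₂ i hi p hp j hj q hq hij hjp hpq
  by_cases h₁ : B₁ = B
  · subst h₁
    exact hξ.eq_of_mem _ hB₁ _ hB₂ j (hB.2 i hi p hp j (mem_sup_id.2 ⟨B₂, hB₂, hj⟩) hij hjp) hj
  · by_cases h₂ : B₂ = B
    · subst h₂
      exact hξ.eq_of_mem _ hB₁ _ hB₂ p hp (hB.2 j hj q hq p (mem_sup_id.2 ⟨B₁, hB₁, hp⟩) hjp hpq)
    · exact h B₁ (Finset.mem_erase.2 ⟨h₁, hB₁⟩) B₂ (Finset.mem_erase.2 ⟨h₂, hB₂⟩) i hi p hp j hj q hq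
        hij hjp hpq

theorem tendsto_loopCount_zero (ρ : ι → Equiv.Perm (Fin (k + k))) (ζ : Equiv.Perm (Fin k))
    (h : ∀ N : ℕ, 0 < N → loopCount N (wordOf lab ρ (ξ.sup id)) ζ ≤ (N : ℝ)⁻¹) :
    Tendsto (fun N => loopCount N (wordOf lab ρ (ξ.sup id)) ζ) atTop (𝓝 0) := by
  refine squeeze_zero' (Eventually.of_forall fun N => loopCount_nonneg _ _) ?_
    tendsto_inv_atTop_nhds_zero_nat
  filter_upwards [eventually_gt_atTop 0] with N hN
  exact h N hN

/-- Interval pairs are removed until none is left or one fails to match. Existence of the limit is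
obtained without identifying it, so that `ℰ` can be defined before any cumulant is considered. -/
theorem exists_tendsto_loopCount (hk : 1 ≤ k) (h : IsPairing lab ξ)
    (ρ : ι → Equiv.Perm (Fin (k + k))) (ζ : Equiv.Perm (Fin k)) :
    ∃ Λ, Tendsto (fun N => loopCount N (wordOf lab ρ (ξ.sup id)) ζ) atTop (𝓝 Λ) := by
  induction hn : ξ.card generalizing ξ ρ ζ with
  | zero =>
    rw [Finset.card_eq_zero.1 hn]
    refine ⟨_, (tendsto_loopCount_nil (β := β) ζ).congr fun N => ?_⟩
    simp [wordOf]
  | succ n ih =>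
    have hne : ξ.Nonempty := Finset.card_pos.1 (by omega)
    by_cases hB : ∃ B, IsIntervalBlock ξ B
    · obtain ⟨B, hB⟩ := hB
      obtain ⟨x, y, hxy, rfl⟩ := h.exists_eq_pair hB.1
      have hcard : (ξ.erase {x, y}).card = n := by rw [Finset.card_erase_of_mem hB.1, hn]; rfl
      have h' := h.mono (Finset.erase_subset {x, y} ξ)
      by_cases hη : ∃ η, Matches (ρ x) (ρ y) η
      · obtain ⟨η, hη⟩ := hη
        by_cases hbef : (beforeBlock ξ {x, y}).Nonempty
        · obtain ⟨Λ, hΛ⟩ := ih h' (Function.update ρ ((beforeBlock ξ {x, y}).max' hbef)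
            (glue 1 η⁻¹ * ρ ((beforeBlock ξ {x, y}).max' hbef))) ζ hcard
          refine ⟨Λ, hΛ.congr' ?_⟩
          filter_upwards [eventually_gt_atTop 0] with N hN
          exact (loopCount_erase_of_before hN h ρ hxy hB hη hbef ζ).symm
        · obtain ⟨Λ, hΛ⟩ := ih h' ρ (η⁻¹ * ζ) hcard
          refine ⟨Λ, hΛ.congr' ?_⟩
          filter_upwards [eventually_gt_atTop 0] with N hN
          exact (loopCount_erase_of_first hN h ρ hxy hB hη
            (Finset.not_nonempty_iff_eq_empty.1 hbef) ζ).symm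
      · exact ⟨0, tendsto_loopCount_zero ρ ζ fun N hN =>
          loopCount_le_of_interval_not_matches hN hk h ρ hxy hB hη ζ⟩
    · exact ⟨0, tendsto_loopCount_zero ρ ζ fun N hN =>
        loopCount_le_of_no_interval hN hk h ρ hne (not_exists.1 hB) ζ⟩

/-- Crossing pairings are negligible. -/
theorem tendsto_loopCount_of_crossing (hk : 1 ≤ k) (h : IsPairing lab ξ) (hc : ¬ NonCrossing ξ)
    (ρ : ι → Equiv.Perm (Fin (k + k))) (ζ : Equiv.Perm (Fin k)) :
    Tendsto (fun N => loopCount N (wordOf lab ρ (ξ.sup id)) ζ) atTop (𝓝 0) := by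
  induction hn : ξ.card generalizing ξ ρ ζ with
  | zero =>
    refine absurd ?_ hc
    rw [Finset.card_eq_zero.1 hn]
    intro B hB
    simp at hB
  | succ n ih =>
    have hne : ξ.Nonempty := Finset.card_pos.1 (by omega)
    by_cases hB : ∃ B, IsIntervalBlock ξ B
    · obtain ⟨B, hB⟩ := hB
      obtain ⟨x, y, hxy, rfl⟩ := h.exists_eq_pair hB.1
      have hcard : (ξ.erase {x, y}).card = n := by rw [Finset.card_erase_of_mem hB.1, hn]; rfl
      have h' := h.mono (Finset.erase_subset {x, y} ξ)
      -- The crossing survives every removal, so the reduction never reaches the empty collection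
      -- and must end in one of the cases of order `1/N`.
      have hc' : ¬ NonCrossing (ξ.erase {x, y}) := fun hnc =>
        hc (nonCrossing_of_erase h.isBlocks hB hnc)
      by_cases hη : ∃ η, Matches (ρ x) (ρ y) η
      · obtain ⟨η, hη⟩ := hη
        by_cases hbef : (beforeBlock ξ {x, y}).Nonempty
        · refine (ih h' hc' (Function.update ρ ((beforeBlock ξ {x, y}).max' hbef)
            (glue 1 η⁻¹ * ρ ((beforeBlock ξ {x, y}).max' hbef))) ζ hcard).congr' ?_
          filter_upwards [eventually_gt_atTop 0] with N hN
          exact (loopCount_erase_of_before hN h ρ hxy hB hη hbef ζ).symm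
        · refine (ih h' hc' ρ (η⁻¹ * ζ) hcard).congr' ?_
          filter_upwards [eventually_gt_atTop 0] with N hN
          exact (loopCount_erase_of_first hN h ρ hxy hB hη
            (Finset.not_nonempty_iff_eq_empty.1 hbef) ζ).symm
      · exact tendsto_loopCount_zero ρ ζ fun N hN =>
          loopCount_le_of_interval_not_matches hN hk h ρ hxy hB hη ζ
    · exact tendsto_loopCount_zero ρ ζ fun N hN =>
        loopCount_le_of_no_interval hN hk h ρ hne (not_exists.1 hB) ζ

theorem isPairing_parts {L : ℕ} (π : Finpartition (Finset.univ : Finset (Fin L)))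
    (h : ∀ B ∈ π.parts, B.card = 2) : IsPairing (blockOf π) π.parts := by
  refine ⟨h, fun B hB B' hB' x hx x' hx' => ?_⟩
  rw [blockOf_eq_of_mem π ⟨B, hB⟩ hx, blockOf_eq_of_mem π ⟨B', hB'⟩ hx', Subtype.mk.injEq]

end LoopLimits

/-! ### Limits of the mixed moments -/

section MomentLimits

/-- The limit of the normalized mixed moments of the entries. -/
noncomputable def limitMoment (c : ℝ) (c' : ℂ) (p q : ℕ) : ℂ :=
  if p = 2 ∧ q = 0 then c' else if p = 1 ∧ q = 1 then c else if p = 0 ∧ q = 2 then conj c' else 0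

/-- The limit of the normalized mixed moments of the entries along a block. -/
noncomputable def blockWeight (c : ℝ) (c' : ℂ) {L : ℕ} (ε : Fin L → Bool) (B : Finset (Fin L)) : ℂ :=
  limitMoment c c' (B.filter fun l => ε l = false).card (B.filter fun l => ε l = true).card

theorem card_filter_bool {L : ℕ} (ε : Fin L → Bool) (B : Finset (Fin L)) :
    (B.filter fun l => ε l = false).card + (B.filter fun l => ε l = true).card = B.card := by
  rw [← Finset.card_filter_add_card_filter_not (s := B) (fun l => ε l = false)]
  simp

theorem blockWeight_eq_zero (c : ℝ) (c' : ℂ) {L : ℕ} (ε : Fin L → Bool) {B : Finset (Fin L)}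
    (hB : B.card ≠ 2) : blockWeight c c' ε B = 0 := by
  have h := card_filter_bool ε B
  unfold blockWeight limitMoment
  rw [if_neg, if_neg, if_neg] <;> omega

variable {k : ℕ} {Ω : ℕ → Type*} [∀ N, MeasurableSpace (Ω N)] {P : ∀ N, Measure (Ω N)}
  {M : ∀ N, Ω N → Tensor N k} {μ : ℕ → Measure ℂ} {c : ℝ} {c' : ℂ}

theorem IsTensorModel.tendsto_moment (hM : IsTensorModel k P M μ c c') (p q : ℕ)
    (hpq : 1 ≤ p + q) :
    Tendsto (fun N : ℕ => (N : ℂ) ^ k * ∫ z, z ^ p * conj z ^ q ∂(μ N)) atTop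
      (𝓝 (limitMoment c c' p q)) := by
  rcases lt_or_ge 2 (p + q) with h | h
  · have : limitMoment c c' p q = 0 := by
      unfold limitMoment
      rw [if_neg, if_neg, if_neg] <;> omega
    rw [this]
    exact hM.lim_higher p q h
  have hcases : (p = 1 ∧ q = 0) ∨ (p = 0 ∧ q = 1) ∨ (p = 2 ∧ q = 0) ∨ (p = 1 ∧ q = 1) ∨
      (p = 0 ∧ q = 2) := by omega
  rcases hcases with ⟨rfl, rfl⟩ | ⟨rfl, rfl⟩ | ⟨rfl, rfl⟩ | ⟨rfl, rfl⟩ | ⟨rfl, rfl⟩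
  · simp [limitMoment, hM.centered]
  · have : ∀ N, ∫ z, conj z ∂(μ N) = 0 := fun N => by
      rw [integral_conj, hM.centered, map_zero]
    simp [limitMoment, this]
  · simpa [limitMoment] using hM.lim_sq
  · have : ∀ N : ℕ, (N : ℂ) ^ k * ∫ z, z ^ 1 * conj z ^ 1 ∂(μ N) =
        (((N : ℝ) ^ k * ∫ z, ‖z‖ ^ 2 ∂(μ N) : ℝ) : ℂ) := by
      intro N
      push_cast
      rw [← integral_complex_ofReal]
      congr 2
      funext z
      rw [pow_one, pow_one, Complex.mul_conj, Complex.normSq_eq_norm_sq]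
    simp only [this]
    simpa [limitMoment, Function.comp_def] using (Complex.continuous_ofReal.tendsto c).comp hM.lim_abs_sq
  · have : ∀ N : ℕ, (N : ℂ) ^ k * ∫ z, z ^ 0 * conj z ^ 2 ∂(μ N) =
        conj ((N : ℂ) ^ k * ∫ z, z ^ 2 ∂(μ N)) := by
      intro N
      rw [map_mul, map_pow, Complex.conj_natCast, ← integral_conj]
      simp
    simp only [this]
    simpa [limitMoment, Function.comp_def] using (Complex.continuous_conj.tendsto c').comp hM.lim_sq

/-- The asymptotics of the mixed moments of the flattenings, as a sum over pairings. -/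
theorem IsTensorModel.tendsto_expTrace [∀ N, IsProbabilityMeasure (P N)]
    (hM : IsTensorModel k P M μ c c') (hk : 1 ≤ k) {L : ℕ}
    (σ : Fin L → Equiv.Perm (Fin (k + k))) (ε : Fin L → Bool) (η : Fin L → Equiv.Perm (Fin k))
    (ζ : Equiv.Perm (Fin k)) {Λ : Finpartition (Finset.univ : Finset (Fin L)) → ℝ}
    (hΛ : ∀ π : Finpartition (Finset.univ : Finset (Fin L)), (∀ B ∈ π.parts, B.card = 2) →
      Tendsto (fun N => loopCount N (wordOf (blockOf π)
        (fun l => letterPerm (σ l) (ε l) (η l)) (π.parts.sup id)) ζ) atTop (𝓝 (Λ π))) :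
    Tendsto (fun N => expTrace (P N) fun ω => (List.ofFn fun l =>
        adj (ε l) (flattening (M N ω) (σ l)) * permMatrix N (η l)).prod * (permMatrix N ζ)ᴴ) atTop
      (𝓝 (∑ π : Finpartition (Finset.univ : Finset (Fin L)),
        (∏ B ∈ π.parts, blockWeight c c' ε B) * (Λ π : ℂ))) := by
  have heq : ∀ᶠ N : ℕ in atTop, ∑ π : Finpartition (Finset.univ : Finset (Fin L)),
        (∏ B ∈ π.parts, (N : ℂ) ^ k * blockMoment (μ N) ε B) *
          (kerCount N (fun l => letterPerm (σ l) (ε l) (η l)) ζ π : ℂ) =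
      expTrace (P N) fun ω => (List.ofFn fun l =>
        adj (ε l) (flattening (M N ω) (σ l)) * permMatrix N (η l)).prod * (permMatrix N ζ)ᴴ := by
    filter_upwards [eventually_gt_atTop 0] with N hN
    exact (expTrace_prod_flattening hN (hM.hasLaw N) (hM.indep N) (hM.moments N) σ ε η ζ).symm
  refine Tendsto.congr' heq (tendsto_finsetSum _ fun π _ => ?_)
  have hprod : Tendsto (fun N : ℕ => ∏ B ∈ π.parts, (N : ℂ) ^ k * blockMoment (μ N) ε B) atTop
      (𝓝 (∏ B ∈ π.parts, blockWeight c c' ε B)) := by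
    refine tendsto_finsetProd _ fun B hB => hM.tendsto_moment _ _ ?_
    rw [card_filter_bool]
    exact Finset.card_pos.2 (π.nonempty_of_mem_parts hB)
  by_cases hπ : ∀ B ∈ π.parts, B.card = 2
  · have h := hΛ π hπ
    rw [π.sup_parts] at h
    exact hprod.mul ((Complex.continuous_ofReal.tendsto _).comp (tendsto_kerCount hk _ ζ π h))
  · push Not at hπ
    obtain ⟨B, hB, hB2⟩ := hπ
    have hzero : ∏ B ∈ π.parts, blockWeight c c' ε B = 0 :=
      Finset.prod_eq_zero hB (blockWeight_eq_zero c c' ε hB2)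
    rw [hzero] at hprod ⊢
    rw [zero_mul]
    -- A block of size other than two makes the moment factor tend to `0`, while the count stays
    -- bounded by `1`.
    refine hprod.zero_mul_isBoundedUnder_le ?_
    refine isBoundedUnder_of_eventually_le (a := 1) ?_
    filter_upwards [eventually_gt_atTop 0] with N hN
    simp only [Function.comp_apply, Complex.norm_real, Real.norm_eq_abs]
    rw [abs_of_nonneg (kerCount_nonneg _ _ _)]
    exact kerCount_le_one hN _ _ _

theorem IsTensorModel.exists_tendsto_expTrace [∀ N, IsProbabilityMeasure (P N)]
    (hM : IsTensorModel k P M μ c c') (hk : 1 ≤ k) {L : ℕ}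
    (σ : Fin L → Equiv.Perm (Fin (k + k))) (ε : Fin L → Bool) (η : Fin L → Equiv.Perm (Fin k))
    (ζ : Equiv.Perm (Fin k)) :
    ∃ t, Tendsto (fun N => expTrace (P N) fun ω => (List.ofFn fun l =>
        adj (ε l) (flattening (M N ω) (σ l)) * permMatrix N (η l)).prod * (permMatrix N ζ)ᴴ) atTop
      (𝓝 t) := by
  classical
  have hex : ∀ π : Finpartition (Finset.univ : Finset (Fin L)), ∃ Λ : ℝ,
      (∀ B ∈ π.parts, B.card = 2) → Tendsto (fun N => loopCount N (wordOf (blockOf π)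
        (fun l => letterPerm (σ l) (ε l) (η l)) (π.parts.sup id)) ζ) atTop (𝓝 Λ) := by
    intro π
    by_cases hπ : ∀ B ∈ π.parts, B.card = 2
    · obtain ⟨Λ, hΛ⟩ := exists_tendsto_loopCount hk (isPairing_parts π hπ)
        (fun l => letterPerm (σ l) (ε l) (η l)) ζ
      exact ⟨Λ, fun _ => hΛ⟩
    · exact ⟨0, fun h => absurd h hπ⟩
  choose Λ hΛ using hex
  exact ⟨_, hM.tendsto_expTrace hk σ ε η ζ hΛ⟩

end MomentLimits


/-! ### The universal `*`-algebra generated by the flattenings and the permutations -/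

/-- Words in the symbols `m_σ`, `m_σ^*` and in permutations. -/
abbrev FlatWord (k : ℕ) : Type :=
  Monoid.Coprod (FreeMonoid (Equiv.Perm (Fin (k + k)) × Bool)) (Equiv.Perm (Fin k))

section FlatWord

variable {k : ℕ}

/-- The letter `m_σ^ε`. -/
def symbol (σ : Equiv.Perm (Fin (k + k))) (ε : Bool) : FlatWord k :=
  Monoid.Coprod.inl (FreeMonoid.of (σ, ε))

/-- The letter `u_η`. -/
def permWord (η : Equiv.Perm (Fin k)) : FlatWord k := Monoid.Coprod.inr η

theorem permWord_mul (η η' : Equiv.Perm (Fin k)) :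
    permWord (η * η') = permWord η * permWord η' := map_mul Monoid.Coprod.inr _ _

theorem permWord_one : permWord (1 : Equiv.Perm (Fin k)) = 1 := map_one Monoid.Coprod.inr

theorem flatWord_induction {motive : FlatWord k → Prop} (w : FlatWord k) (one : motive 1)
    (symbol_mul : ∀ σ ε w, motive w → motive (symbol σ ε * w))
    (perm_mul : ∀ η w, motive w → motive (permWord η * w)) : motive w := by
  induction w using Monoid.Coprod.induction_on' with
  | one => exact one
  | inl_mul m x hx =>
    induction m using FreeMonoid.inductionOn' with
    | one => simpa using hx
    | of_mul a m ih =>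
      rw [map_mul, mul_assoc]
      exact symbol_mul a.1 a.2 _ ih
  | inr_mul η x hx => exact perm_mul η x hx

/-- The involution of words, as a morphism to the opposite monoid. -/
def wordStar : FlatWord k →* (FlatWord k)ᵐᵒᵖ :=
  Monoid.Coprod.lift (FreeMonoid.lift fun x => MulOpposite.op (symbol x.1 !x.2))
    { toFun := fun η => MulOpposite.op (permWord η⁻¹)
      map_one' := by rw [inv_one, permWord_one, MulOpposite.op_one]
      map_mul' := fun η η' => by rw [mul_inv_rev, permWord_mul, MulOpposite.op_mul] }

instance instStarFlatWord : Star (FlatWord k) := ⟨fun w => (wordStar w).unop⟩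

theorem flatWord_star_mul (w w' : FlatWord k) : star (w * w') = star w' * star w := by
  change (wordStar (w * w')).unop = _
  rw [map_mul, MulOpposite.unop_mul]
  rfl

theorem star_symbol (σ : Equiv.Perm (Fin (k + k))) (ε : Bool) :
    star (symbol σ ε) = symbol σ !ε := by
  change (wordStar (symbol σ ε)).unop = _
  simp [wordStar, symbol]

theorem star_permWord (η : Equiv.Perm (Fin k)) : star (permWord η) = permWord η⁻¹ := by
  change (wordStar (permWord η)).unop = _
  simp [wordStar, permWord]

theorem flatWord_star_one : star (1 : FlatWord k) = 1 := by
  rw [← permWord_one, star_permWord, inv_one]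

instance instStarMulFlatWord : StarMul (FlatWord k) where
  star_mul := flatWord_star_mul
  star_involutive w := by
    induction w using flatWord_induction with
    | one => rw [flatWord_star_one, flatWord_star_one]
    | symbol_mul σ ε w ih =>
      rw [flatWord_star_mul, flatWord_star_mul, ih, star_symbol, star_symbol, Bool.not_not]
    | perm_mul η w ih =>
      rw [flatWord_star_mul, flatWord_star_mul, ih, star_permWord, star_permWord, inv_inv]

/-- Every word is equivalent to a word in which symbols and permutations alternate. -/
theorem exists_normalForm (w : FlatWord k) :
    ∃ (η₀ : Equiv.Perm (Fin k)) (L : ℕ) (σ : Fin L → Equiv.Perm (Fin (k + k))) (ε : Fin L → Bool)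
      (η : Fin L → Equiv.Perm (Fin k)),
      w = permWord η₀ * (List.ofFn fun l => symbol (σ l) (ε l) * permWord (η l)).prod := by
  have key : ∃ (η₀ : Equiv.Perm (Fin k))
      (t : List (Equiv.Perm (Fin (k + k)) × Bool × Equiv.Perm (Fin k))),
      w = permWord η₀ * (t.map fun x => symbol x.1 x.2.1 * permWord x.2.2).prod := by
    induction w using flatWord_induction with
    | one => exact ⟨1, [], by simp [permWord_one]⟩
    | symbol_mul σ ε w ih =>
      obtain ⟨η₀, t, rfl⟩ := ih
      exact ⟨1, (σ, ε, η₀) :: t, by simp [permWord_one, mul_assoc]⟩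
    | perm_mul η w ih =>
      obtain ⟨η₀, t, rfl⟩ := ih
      exact ⟨η * η₀, t, by rw [permWord_mul, mul_assoc]⟩
  obtain ⟨η₀, t, rfl⟩ := key
  refine ⟨η₀, t.length, fun l => (t.get l).1, fun l => (t.get l).2.1, fun l => (t.get l).2.2, ?_⟩
  congr 2
  conv_lhs => rw [← List.ofFn_get t, List.map_ofFn]
  rfl

end FlatWord

/-- The universal algebra generated by the symbols `m_σ`, `m_σ^*` and by `ℂ𝔖_k`. -/
abbrev FlatAlg (k : ℕ) : Type := MonoidAlgebra ℂ (FlatWord k)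

/-! ### The involution on the universal algebra and the inclusion of the group algebra -/

section FlatAlg

variable {k : ℕ}

noncomputable instance instStarFlatAlg : Star (FlatAlg k) where
  star b := MonoidAlgebra.ofCoeff ((b.coeff.mapRange (fun z : ℂ => conj z)
    (map_zero _)).equivMapDomain (star_involutive (R := FlatWord k)).toPerm)

theorem flatAlg_star_coeff (b : FlatAlg k) (w : FlatWord k) :
    (star b).coeff w = conj (b.coeff (star w)) := by
  simp only [star, Finsupp.equivMapDomain_apply, Finsupp.mapRange_apply]
  rfl

theorem flatAlg_star_single (w : FlatWord k) (z : ℂ) :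
    star (MonoidAlgebra.single w z : FlatAlg k) = MonoidAlgebra.single (star w) (conj z) := by
  classical
  ext g
  rw [flatAlg_star_coeff, MonoidAlgebra.coeff_single, MonoidAlgebra.coeff_single,
    Finsupp.single_apply, Finsupp.single_apply]
  by_cases h : w = star g
  · subst h; simp
  · have h' : star w ≠ g := fun e => h (by rw [← e, star_star])
    simp [h, h']

theorem flatAlg_star_add (a b : FlatAlg k) : star (a + b) = star a + star b := by
  ext w
  simp [flatAlg_star_coeff]

noncomputable instance instStarRingFlatAlg : StarRing (FlatAlg k) where
  star_involutive b := by
    ext w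
    simp [flatAlg_star_coeff]
  star_add := flatAlg_star_add
  star_mul a b := by
    have hzero : star (0 : FlatAlg k) = 0 := by
      ext w
      simp [flatAlg_star_coeff]
    induction a using MonoidAlgebra.induction_linear with
    | zero => simp [hzero]
    | add x y hx hy => rw [add_mul, flatAlg_star_add, hx, hy, flatAlg_star_add, mul_add]
    | single g r =>
      induction b using MonoidAlgebra.induction_linear with
      | zero => simp [hzero]
      | add x y hx hy => rw [mul_add, flatAlg_star_add, hx, hy, flatAlg_star_add, add_mul]
      | single h t =>
        simp only [MonoidAlgebra.single_mul_single, flatAlg_star_single, star_mul, map_mul,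
          mul_comm]

instance instStarModuleFlatAlg : StarModule ℂ (FlatAlg k) where
  star_smul z b := by
    ext w
    simp [flatAlg_star_coeff]

/-- The generator `m_σ`. -/
noncomputable def flatGen (σ : Equiv.Perm (Fin (k + k))) : FlatAlg k :=
  MonoidAlgebra.single (symbol σ false) 1

theorem adj_flatGen (ε : Bool) (σ : Equiv.Perm (Fin (k + k))) :
    adj ε (flatGen σ) = MonoidAlgebra.single (symbol σ ε) 1 := by
  cases ε
  · rfl
  · simp [adj, flatGen, flatAlg_star_single, star_symbol]

/-- The inclusion of `ℂ𝔖_k`. -/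
noncomputable def flatIncl (k : ℕ) : SymAlg k →⋆ₐ[ℂ] FlatAlg k where
  __ := MonoidAlgebra.lift ℂ (FlatAlg k) (Equiv.Perm (Fin k))
    ((MonoidAlgebra.of ℂ (FlatWord k)).comp Monoid.Coprod.inr)
  map_star' b := by
    change MonoidAlgebra.lift ℂ _ _ _ _ = star (MonoidAlgebra.lift ℂ _ _ _ _)
    induction b using MonoidAlgebra.induction_linear with
    | zero => simp
    | add x y hx hy => rw [star_add, map_add, map_add, star_add, hx, hy]
    | single η r =>
      rw [star_single, MonoidAlgebra.lift_single, MonoidAlgebra.lift_single, star_smul]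
      simp only [MonoidHom.coe_comp, Function.comp_apply, MonoidAlgebra.of_apply,
        flatAlg_star_single, map_one]
      rw [show star (Monoid.Coprod.inr η : FlatWord k) = Monoid.Coprod.inr η⁻¹
        from star_permWord η]
      rfl

theorem flatIncl_single (η : Equiv.Perm (Fin k)) (r : ℂ) :
    flatIncl k (MonoidAlgebra.single η r) = MonoidAlgebra.single (permWord η) r := by
  change MonoidAlgebra.lift ℂ _ _ _ _ = _
  rw [MonoidAlgebra.lift_single]
  simp [permWord]

end FlatAlg

/-! ### Evaluation on a tensor -/

section Eval

variable {N k : ℕ}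

/-- The evaluation of words on the flattenings of a tensor. -/
def evalWord (T : Tensor N k) : FlatWord k →* Mat N k :=
  Monoid.Coprod.lift (FreeMonoid.lift fun x => adj x.2 (flattening T x.1))
    { toFun := fun η => permMatrix N η
      map_one' := permMatrix_one
      map_mul' := fun η η' => (permMatrix_mul η η').symm }

theorem evalWord_symbol (T : Tensor N k) (σ : Equiv.Perm (Fin (k + k))) (ε : Bool) :
    evalWord T (symbol σ ε) = adj ε (flattening T σ) := by
  simp [evalWord, symbol]

theorem evalWord_permWord (T : Tensor N k) (η : Equiv.Perm (Fin k)) :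
    evalWord T (permWord η) = permMatrix N η := by
  simp [evalWord, permWord]

theorem evalWord_star (T : Tensor N k) (w : FlatWord k) :
    evalWord T (star w) = (evalWord T w)ᴴ := by
  induction w using flatWord_induction with
  | one => rw [star_one, map_one, Matrix.conjTranspose_one]
  | symbol_mul σ ε w ih =>
    rw [star_mul, map_mul, map_mul, Matrix.conjTranspose_mul, ih, star_symbol, evalWord_symbol,
      evalWord_symbol]
    cases ε <;> simp [adj, Matrix.star_eq_conjTranspose]
  | perm_mul η w ih =>
    rw [star_mul, map_mul, map_mul, Matrix.conjTranspose_mul, ih, star_permWord, evalWord_permWord,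
      evalWord_permWord, permMatrix_conjTranspose]

/-- The evaluation of the universal algebra on the flattenings of a tensor. -/
noncomputable def flatEval (T : Tensor N k) : FlatAlg k →ₐ[ℂ] Mat N k :=
  MonoidAlgebra.lift ℂ (Mat N k) (FlatWord k) (evalWord T)

theorem flatEval_single (T : Tensor N k) (w : FlatWord k) (r : ℂ) :
    flatEval T (MonoidAlgebra.single w r) = r • evalWord T w :=
  MonoidAlgebra.lift_single _ _ _

theorem flatEval_star (T : Tensor N k) (a : FlatAlg k) :
    flatEval T (star a) = (flatEval T a)ᴴ := by
  induction a using MonoidAlgebra.induction_linear with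
  | zero => simp
  | add x y hx hy => rw [star_add, map_add, map_add, Matrix.conjTranspose_add, hx, hy]
  | single w r =>
    rw [flatAlg_star_single, flatEval_single, flatEval_single, evalWord_star,
      Matrix.conjTranspose_smul]
    rfl

theorem flatEval_incl (T : Tensor N k) (η : Equiv.Perm (Fin k)) :
    flatEval T (flatIncl k (u η)) = permMatrix N η := by
  rw [flatIncl_single, flatEval_single, evalWord_permWord, one_smul]

theorem flatEval_prod (T : Tensor N k) {L : ℕ} (σ : Fin L → Equiv.Perm (Fin (k + k)))
    (ε : Fin L → Bool) (η : Fin L → Equiv.Perm (Fin k)) :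
    flatEval T (List.ofFn fun l => adj (ε l) (flatGen (σ l)) * flatIncl k (u (η l))).prod =
      (List.ofFn fun l => adj (ε l) (flattening T (σ l)) * permMatrix N (η l)).prod := by
  rw [map_list_prod, List.map_ofFn]
  congr 2
  funext l
  simp only [Function.comp_apply, map_mul, flatEval_incl, adj_flatGen, flatEval_single,
    evalWord_symbol, one_smul]

variable {Ω : Type*} [MeasurableSpace Ω] {P : Measure Ω} [IsProbabilityMeasure P]
  {T : Ω → Tensor N k}

theorem hasMoments_evalWord (hT : ∀ i, HasMoments P fun ω => T ω i) (w : FlatWord k)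
    (i j : Fin k → Fin N) : HasMoments P fun ω => evalWord (T ω) w i j := by
  induction w using flatWord_induction generalizing i j with
  | one => simpa using hasMoments_const _
  | symbol_mul σ ε w ih =>
    simp only [map_mul, Matrix.mul_apply, evalWord_symbol]
    refine HasMoments.sum _ fun a _ => HasMoments.mul ?_ (ih a j)
    cases ε
    · exact hT _
    · exact (hT _).star
  | perm_mul η w ih =>
    simp only [map_mul, Matrix.mul_apply, evalWord_permWord]
    exact HasMoments.sum _ fun a _ => HasMoments.mul (hasMoments_const _) (ih a j)

theorem hasMoments_flatEval (hT : ∀ i, HasMoments P fun ω => T ω i) (a : FlatAlg k)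
    (i j : Fin k → Fin N) : HasMoments P fun ω => flatEval (T ω) a i j := by
  induction a using MonoidAlgebra.induction_linear with
  | zero => simpa using hasMoments_const _
  | add x y hx hy => simpa using hx.add hy
  | single w r =>
    simp only [flatEval_single, Matrix.smul_apply, smul_eq_mul]
    exact (hasMoments_const r).mul (hasMoments_evalWord hT w i j)

/-- The moments `Φ_N[A U_ζ^*]` of an element of the universal algebra. -/
noncomputable def flatMoment (P : Measure Ω) (T : Ω → Tensor N k) (a : FlatAlg k)
    (ζ : Equiv.Perm (Fin k)) : ℂ :=
  expTrace P fun ω => flatEval (T ω) a * (permMatrix N ζ)ᴴ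

theorem integrable_flatMoment (hT : ∀ i, HasMoments P fun ω => T ω i) (a : FlatAlg k)
    (ζ : Equiv.Perm (Fin k)) :
    Integrable (fun ω => ((N : ℂ) ^ k)⁻¹ * (flatEval (T ω) a * (permMatrix N ζ)ᴴ).trace) P := by
  refine HasMoments.integrable ((hasMoments_const _).mul ?_)
  simp only [Matrix.trace, Matrix.diag, Matrix.mul_apply]
  exact HasMoments.sum _ fun i _ => HasMoments.sum _ fun j _ =>
    (hasMoments_flatEval hT a i j).mul (hasMoments_const _)

theorem flatMoment_add (hT : ∀ i, HasMoments P fun ω => T ω i) (a b : FlatAlg k)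
    (ζ : Equiv.Perm (Fin k)) :
    flatMoment P T (a + b) ζ = flatMoment P T a ζ + flatMoment P T b ζ := by
  rw [flatMoment, flatMoment, flatMoment, expTrace, expTrace, expTrace,
    ← integral_add (integrable_flatMoment hT a ζ) (integrable_flatMoment hT b ζ)]
  simp only [map_add, add_mul, Matrix.trace_add, mul_add]

omit [IsProbabilityMeasure P] in
theorem flatMoment_smul (r : ℂ) (a : FlatAlg k) (ζ : Equiv.Perm (Fin k)) :
    flatMoment P T (r • a) ζ = r * flatMoment P T a ζ := by
  rw [flatMoment, flatMoment, expTrace, expTrace, ← integral_const_mul]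
  simp only [map_smul, smul_mul_assoc, Matrix.trace_smul, smul_eq_mul]
  congr 1
  funext ω
  ring

omit [IsProbabilityMeasure P] in
theorem flatMoment_eq (a : FlatAlg k) (ζ : Equiv.Perm (Fin k)) :
    flatMoment P T a ζ =
      ∫ ω, ((N : ℂ) ^ k)⁻¹ * (flatEval (T ω) a * permMatrix N ζ⁻¹).trace ∂P := by
  rw [flatMoment, expTrace, permMatrix_conjTranspose]

theorem trace_perm_mul (X : Mat N k) (η ζ : Equiv.Perm (Fin k)) :
    (permMatrix N η * X * permMatrix N ζ⁻¹).trace =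
      (X * permMatrix N (η⁻¹ * ζ)⁻¹).trace := by
  rw [Matrix.trace_mul_cycle, Matrix.trace_mul_comm, permMatrix_mul, mul_inv_rev, inv_inv]

-- Cyclicity of the trace turns multiplication by a permutation matrix into a translation of `ζ`, so
-- bimodularity over `ℂ𝔖_k` is already exact at finite `N`.
omit [IsProbabilityMeasure P] in
theorem flatMoment_incl_mul (η : Equiv.Perm (Fin k)) (a : FlatAlg k) (ζ : Equiv.Perm (Fin k)) :
    flatMoment P T (flatIncl k (u η) * a) ζ = flatMoment P T a (η⁻¹ * ζ) := by
  rw [flatMoment_eq, flatMoment_eq]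
  refine integral_congr_ae (Eventually.of_forall fun ω => ?_)
  beta_reduce
  rw [map_mul, flatEval_incl, trace_perm_mul]

omit [IsProbabilityMeasure P] in
theorem flatMoment_mul_incl (η : Equiv.Perm (Fin k)) (a : FlatAlg k) (ζ : Equiv.Perm (Fin k)) :
    flatMoment P T (a * flatIncl k (u η)) ζ = flatMoment P T a (ζ * η⁻¹) := by
  rw [flatMoment_eq, flatMoment_eq]
  refine integral_congr_ae (Eventually.of_forall fun ω => ?_)
  beta_reduce
  rw [map_mul, flatEval_incl, mul_assoc, permMatrix_mul, mul_inv_rev, inv_inv]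

theorem trace_conjTranspose_mul_perm (X : Mat N k) (ζ : Equiv.Perm (Fin k)) :
    (Xᴴ * permMatrix N ζ).trace = conj (X * permMatrix N ζ⁻¹).trace := by
  rw [starRingEnd_apply, ← Matrix.trace_conjTranspose, Matrix.conjTranspose_mul,
    permMatrix_conjTranspose, inv_inv, Matrix.trace_mul_comm]

omit [IsProbabilityMeasure P] in
theorem flatMoment_star (a : FlatAlg k) (ζ : Equiv.Perm (Fin k)) :
    flatMoment P T (star a) ζ = conj (flatMoment P T a ζ⁻¹) := by
  rw [flatMoment_eq, flatMoment_eq, ← integral_conj]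
  refine integral_congr_ae (Eventually.of_forall fun ω => ?_)
  beta_reduce
  rw [flatEval_star, trace_conjTranspose_mul_perm, map_mul, map_inv₀, map_pow, Complex.conj_natCast]

omit [IsProbabilityMeasure P] in
open scoped ComplexOrder in
theorem flatMoment_star_mul_self_nonneg (a : FlatAlg k) :
    0 ≤ flatMoment P T (star a * a) 1 := by
  rw [flatMoment, expTrace]
  refine integral_nonneg fun ω => ?_
  simp only [Pi.zero_apply]
  rw [map_mul, flatEval_star, permMatrix_one, Matrix.conjTranspose_one, mul_one]
  refine mul_nonneg ?_ (Matrix.posSemidef_conjTranspose_mul_self _).trace_nonneg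
  rw [inv_nonneg]
  positivity

end Eval


/-! ### Complete positivity from positivity of the scalar state -/

section CompletePositivity

variable {k : ℕ} {A : Type*} [Ring A] [StarRing A] [Algebra ℂ A] [StarModule ℂ A]

theorem isPos_zero {R : Type*} [Ring R] [StarRing R] : IsPos (0 : R) := zero_mem _

theorem IsPos.add {R : Type*} [Ring R] [StarRing R] {a b : R} (ha : IsPos a) (hb : IsPos b) :
    IsPos (a + b) := add_mem ha hb

theorem IsPos.sum {R : Type*} [Ring R] [StarRing R] {ι : Type*} (s : Finset ι) (f : ι → R)
    (h : ∀ i ∈ s, IsPos (f i)) : IsPos (∑ i ∈ s, f i) := sum_mem h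

theorem isPos_star_mul_self {R : Type*} [Ring R] [StarRing R] (a : R) : IsPos (star a * a) :=
  AddSubmonoid.subset_closure ⟨a, rfl⟩

theorem coeff_sum_single (f : Equiv.Perm (Fin k) → ℂ) (x : Equiv.Perm (Fin k)) :
    (∑ h, MonoidAlgebra.single h (f h) : SymAlg k).coeff x = f x := by
  classical
  rw [MonoidAlgebra.coeff_sum, Finsupp.finsetSum_apply]
  simp [MonoidAlgebra.coeff_single, Finsupp.single_apply]

-- Write the scalar kernel as a sum of rank one terms `v_r v_r^*`. Each vector gives an element of
-- the matrix algebra over `ℂ𝔖_k`, and since the kernel depends on `g, h` only through `g⁻¹h`,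
-- averaging over the group recovers `Z` as a sum of terms `Q^* Q`.
open scoped ComplexOrder in
theorem isPos_of_posSemidef {p : ℕ} (Z : Matrix (Fin p) (Fin p) (SymAlg k))
    (hZ : (Matrix.of fun (x y : Equiv.Perm (Fin k) × Fin p) =>
      (Z x.2 y.2).coeff (x.1⁻¹ * y.1)).PosSemidef) : IsPos Z := by
  obtain ⟨m, v, hv⟩ := Matrix.posSemidef_iff_eq_sum_vecMulVec.1 hZ
  have hval : ∀ (i j : Fin p) (g h : Equiv.Perm (Fin k)),
      (Z i j).coeff (g⁻¹ * h) = ∑ r, v r (g, i) * conj (v r (h, j)) := by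
    intro i j g h
    have := congrFun (congrFun hv (g, i)) (h, j)
    simpa [Matrix.sum_apply, Matrix.vecMulVec_apply] using this
  set s : ℝ := (√((p : ℝ) * Fintype.card (Equiv.Perm (Fin k))))⁻¹ with hs
  -- All `p` rows of `Q r` are equal, so `(Q r)^* (Q r)` counts each term `p` times, and the sum
  -- over the group repeats it `|𝔖_k|` times; `s` is the inverse square root of this multiplicity.
  let Q : Fin m → Matrix (Fin p) (Fin p) (SymAlg k) := fun r =>
    Matrix.of fun _ j => ∑ h, MonoidAlgebra.single h ((s : ℂ) * conj (v r (h, j)))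
  have hQ : Z = ∑ r, star (Q r) * Q r := by
    ext i j x
    have hp : (0 : ℝ) < p := Nat.cast_pos.2 i.pos
    have hG : (0 : ℝ) < Fintype.card (Equiv.Perm (Fin k)) := Nat.cast_pos.2 Fintype.card_pos
    have hss : (p : ℂ) * Fintype.card (Equiv.Perm (Fin k)) * ((s : ℂ) * s) = 1 := by
      have : (p : ℝ) * Fintype.card (Equiv.Perm (Fin k)) * (s * s) = 1 := by
        rw [hs, ← mul_inv, Real.mul_self_sqrt (by positivity)]
        exact mul_inv_cancel₀ (by positivity)
      exact_mod_cast this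
    have hentry : ∀ r, ((star (Q r) * Q r) i j).coeff x =
        p * ∑ g, (s : ℂ) * s * (v r (g, i) * conj (v r (g * x, j))) := by
      intro r
      simp only [Matrix.mul_apply, Matrix.star_apply, Q, Matrix.of_apply, Finset.sum_const,
        Finset.card_univ, Fintype.card_fin, star_sum, star_single]
      rw [MonoidAlgebra.coeff_smul, Finsupp.smul_apply, nsmul_eq_mul, Finset.sum_mul,
        MonoidAlgebra.coeff_sum, Finsupp.finsetSum_apply]
      congr 1
      refine Finset.sum_congr rfl fun g _ => ?_
      rw [MonoidAlgebra.coeff_single_mul_apply, coeff_sum_single, inv_inv, map_mul,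
        Complex.conj_conj, Complex.conj_ofReal]
      ring
    rw [Matrix.sum_apply, MonoidAlgebra.coeff_sum, Finsupp.finsetSum_apply]
    simp only [hentry]
    have havg : ∀ g : Equiv.Perm (Fin k),
        ∑ r, v r (g, i) * conj (v r (g * x, j)) = (Z i j).coeff x := fun g => by
      rw [← hval, inv_mul_cancel_left]
    rw [← Finset.mul_sum, Finset.sum_comm]
    simp only [← Finset.mul_sum, havg, Finset.sum_const, Finset.card_univ, nsmul_eq_mul]
    calc (Z i j).coeff x = (p : ℂ) * Fintype.card (Equiv.Perm (Fin k)) * ((s : ℂ) * s) *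
          (Z i j).coeff x := by rw [hss, one_mul]
      _ = _ := by ring
  rw [hQ]
  exact IsPos.sum _ _ fun r _ => isPos_star_mul_self _

-- The scalar functional taking the coefficient of `ℰ` at `1` suffices: by bimodularity every
-- coefficient of `ℰ(a)` is the coefficient at `1` of some `ℰ(u_g a u_h)`.
open scoped ComplexOrder in
theorem isPos_map_of_nonneg (incl : SymAlg k →⋆ₐ[ℂ] A) (E : A →ₗ[ℂ] SymAlg k)
    (hbim : ∀ (η : Equiv.Perm (Fin k)) (a : A) (ζ : Equiv.Perm (Fin k)),
      E (incl (u η) * a * incl (u ζ)) = u η * E a * u ζ)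
    (hstar : ∀ a, E (star a) = star (E a)) (hpos : ∀ a, 0 ≤ (E (star a * a)).coeff 1)
    (p : ℕ) (X : Matrix (Fin p) (Fin p) A) (hX : IsPos X) : IsPos (X.map E) := by
  induction hX using AddSubmonoid.closure_induction with
  | zero => rw [Matrix.map_zero _ (map_zero E)]; exact isPos_zero
  | add X Y _ _ hX hY => rw [Matrix.map_add _ (map_add E)]; exact hX.add hY
  | mem X hX =>
    obtain ⟨Y, rfl⟩ := hX
    beta_reduce
    apply isPos_of_posSemidef
    have hentry : ∀ i j, (star Y * Y) i j = ∑ q, star (Y q i) * Y q j := fun i j => by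
      simp [Matrix.mul_apply, Matrix.star_apply]
    apply Matrix.PosSemidef.of_dotProduct_mulVec_nonneg
    · ext x y
      rw [Matrix.conjTranspose_apply, Matrix.of_apply, Matrix.of_apply, Matrix.map_apply,
        Matrix.map_apply]
      have h1 : (star Y * Y) x.2 y.2 = star ((star Y * Y) y.2 x.2) := by
        simp only [hentry, star_sum, star_mul, star_star]
      rw [h1, hstar, star_coeff, mul_inv_rev, inv_inv]
      rfl
    · intro z
      -- `W` is chosen so that the quadratic form of the kernel at `z` is the sum over `q` of the
      -- coefficients at `1` of `ℰ((W q)^* (W q))`.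
      let W : Fin p → A := fun q => ∑ y : Equiv.Perm (Fin k) × Fin p,
        z y • (Y q y.2 * incl (u y.1⁻¹))
      have hW : star z ⬝ᵥ ((Matrix.of fun (x y : Equiv.Perm (Fin k) × Fin p) =>
          (((star Y * Y).map E) x.2 y.2).coeff (x.1⁻¹ * y.1)) *ᵥ z) =
          ∑ q, (E (star (W q) * W q)).coeff 1 := by
        have hterm : ∀ q, (E (star (W q) * W q)).coeff 1 = ∑ x, ∑ y,
            conj (z x) * ((E (star (Y q x.2) * Y q y.2)).coeff (x.1⁻¹ * y.1) * z y) := by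
          intro q
          have hinner : ∀ x y : Equiv.Perm (Fin k) × Fin p,
              (E (star (z x • (Y q x.2 * incl (u x.1⁻¹))) * (z y • (Y q y.2 * incl (u y.1⁻¹))))).coeff
                1 = conj (z x) * ((E (star (Y q x.2) * Y q y.2)).coeff (x.1⁻¹ * y.1) * z y) := by
            intro x y
            rw [star_smul, smul_mul_smul_comm, star_mul, ← map_star, star_single, map_one (starRingEnd ℂ), inv_inv,
              ← mul_assoc, mul_assoc (incl (u x.1)), map_smul, hbim, MonoidAlgebra.coeff_smul,
              Finsupp.smul_apply, MonoidAlgebra.coeff_mul_single_apply,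
              MonoidAlgebra.coeff_single_mul_apply, one_mul, mul_one, one_mul, inv_inv, smul_eq_mul,
              Complex.star_def]
            ring
          simp only [W, star_sum, Finset.sum_mul, Finset.mul_sum, map_sum, MonoidAlgebra.coeff_sum,
            Finsupp.finsetSum_apply, hinner]
          exact Finset.sum_comm
        simp only [hterm, dotProduct, Matrix.mulVec, Matrix.of_apply, Matrix.map_apply, hentry,
          map_sum, MonoidAlgebra.coeff_sum, Finsupp.finsetSum_apply, Finset.sum_mul,
          Finset.mul_sum, Pi.star_apply, Complex.star_def]
        symm
        rw [Finset.sum_comm]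
        exact Finset.sum_congr rfl fun x _ => Finset.sum_comm
      rw [hW]
      exact Finset.sum_nonneg fun q _ => hpos _

end CompletePositivity


/-! ### The limit space -/

section LimitSpace

variable {k : ℕ} {Ω : ℕ → Type*} [∀ N, MeasurableSpace (Ω N)] {P : ∀ N, Measure (Ω N)}
  {M : ∀ N, Ω N → Tensor N k} {μ : ℕ → Measure ℂ} {c : ℝ} {c' : ℂ}

theorem flatMoment_zero {N : ℕ} {Ω : Type*} [MeasurableSpace Ω] (P : Measure Ω)
    (T : Ω → Tensor N k) (ζ : Equiv.Perm (Fin k)) : flatMoment P T 0 ζ = 0 := by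
  have := flatMoment_smul (P := P) (T := T) 0 0 ζ
  rwa [zero_smul, zero_mul] at this

theorem flatMoment_prod {N : ℕ} {Ω : Type*} [MeasurableSpace Ω] (P : Measure Ω)
    (T : Ω → Tensor N k) {L : ℕ} (σ : Fin L → Equiv.Perm (Fin (k + k))) (ε : Fin L → Bool)
    (η : Fin L → Equiv.Perm (Fin k)) (ζ : Equiv.Perm (Fin k)) :
    flatMoment P T (List.ofFn fun l => adj (ε l) (flatGen (σ l)) * flatIncl k (u (η l))).prod ζ =
      expTrace P fun ω => (List.ofFn fun l =>
        adj (ε l) (flattening (T ω) (σ l)) * permMatrix N (η l)).prod * (permMatrix N ζ)ᴴ := by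
  simp only [flatMoment, flatEval_prod]

theorem flatGen_prod_eq_single {L : ℕ} (η₀ : Equiv.Perm (Fin k))
    (σ : Fin L → Equiv.Perm (Fin (k + k))) (ε : Fin L → Bool) (η : Fin L → Equiv.Perm (Fin k)) :
    (MonoidAlgebra.single (permWord η₀ *
      (List.ofFn fun l => symbol (σ l) (ε l) * permWord (η l)).prod) 1 : FlatAlg k) =
      flatIncl k (u η₀) *
        (List.ofFn fun l => adj (ε l) (flatGen (σ l)) * flatIncl k (u (η l))).prod := by
  have h := map_list_prod (MonoidAlgebra.of ℂ (FlatWord k))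
    (List.ofFn fun l => symbol (σ l) (ε l) * permWord (η l))
  rw [List.map_ofFn] at h
  simp only [Function.comp_def, map_mul] at h
  simp only [MonoidAlgebra.of_apply] at h
  simp only [adj_flatGen, flatIncl_single]
  rw [← h, MonoidAlgebra.single_mul_single, one_mul]

variable [∀ N, IsProbabilityMeasure (P N)]

/-- By linearity a single word suffices; in normal form its leading permutation is moved into `ζ`,
which leaves a mixed moment of flattenings. -/
theorem IsTensorModel.exists_tendsto_flatMoment (hM : IsTensorModel k P M μ c c') (hk : 1 ≤ k)
    (a : FlatAlg k) (ζ : Equiv.Perm (Fin k)) :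
    ∃ t, Tendsto (fun N => flatMoment (P N) (M N) a ζ) atTop (𝓝 t) := by
  induction a using MonoidAlgebra.induction_linear with
  | zero => simp only [flatMoment_zero]; exact ⟨0, tendsto_const_nhds⟩
  | add x y hx hy =>
    obtain ⟨s, hs⟩ := hx
    obtain ⟨t, ht⟩ := hy
    refine ⟨s + t, (hs.add ht).congr fun N => ?_⟩
    exact (flatMoment_add (hasMoments_entry (hM.hasLaw N) (hM.moments N)) x y ζ).symm
  | single w r =>
    obtain ⟨η₀, L, σ, ε, η, rfl⟩ := exists_normalForm w
    obtain ⟨t, ht⟩ := hM.exists_tendsto_expTrace hk σ ε η (η₀⁻¹ * ζ)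
    refine ⟨r * t, (ht.const_mul r).congr fun N => ?_⟩
    rw [← flatMoment_prod, ← flatMoment_incl_mul, ← flatMoment_smul, ← flatGen_prod_eq_single,
      MonoidAlgebra.smul_single, smul_eq_mul, mul_one]

/-- The limit of the conditional expectations `ℰ_N` on the universal algebra. -/
noncomputable def limitE (P : ∀ N, Measure (Ω N)) (M : ∀ N, Ω N → Tensor N k) (a : FlatAlg k) :
    SymAlg k :=
  ∑ ζ, MonoidAlgebra.single ζ (limUnder atTop fun N => flatMoment (P N) (M N) a ζ)

theorem IsTensorModel.tendsto_flatMoment (hM : IsTensorModel k P M μ c c') (hk : 1 ≤ k)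
    (a : FlatAlg k) (ζ : Equiv.Perm (Fin k)) :
    Tendsto (fun N => flatMoment (P N) (M N) a ζ) atTop (𝓝 ((limitE P M a).coeff ζ)) := by
  rw [limitE, coeff_sum_single]
  exact tendsto_nhds_limUnder (hM.exists_tendsto_flatMoment hk a ζ)

theorem IsTensorModel.limitE_add (hM : IsTensorModel k P M μ c c') (hk : 1 ≤ k)
    (a b : FlatAlg k) : limitE P M (a + b) = limitE P M a + limitE P M b := by
  ext ζ
  rw [MonoidAlgebra.coeff_add, Finsupp.add_apply]
  refine tendsto_nhds_unique (hM.tendsto_flatMoment hk _ ζ) ?_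
  refine ((hM.tendsto_flatMoment hk a ζ).add (hM.tendsto_flatMoment hk b ζ)).congr fun N => ?_
  exact (flatMoment_add (hasMoments_entry (hM.hasLaw N) (hM.moments N)) a b ζ).symm

theorem IsTensorModel.limitE_smul (hM : IsTensorModel k P M μ c c') (hk : 1 ≤ k)
    (r : ℂ) (a : FlatAlg k) : limitE P M (r • a) = r • limitE P M a := by
  ext ζ
  rw [MonoidAlgebra.coeff_smul, Finsupp.smul_apply]
  refine tendsto_nhds_unique (hM.tendsto_flatMoment hk _ ζ) ?_
  refine ((hM.tendsto_flatMoment hk a ζ).const_mul r).congr fun N => ?_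
  exact (flatMoment_smul r a ζ).symm

theorem IsTensorModel.limitE_incl_mul (hM : IsTensorModel k P M μ c c') (hk : 1 ≤ k)
    (b : SymAlg k) (a : FlatAlg k) : limitE P M (flatIncl k b * a) = b * limitE P M a := by
  have hzero : limitE P M (0 : FlatAlg k) = 0 := by
    have := hM.limitE_smul hk 0 0
    rwa [zero_smul, zero_smul] at this
  induction b using MonoidAlgebra.induction_linear with
  | zero => rw [map_zero, zero_mul, zero_mul, hzero]
  | add x y hx hy => rw [map_add, add_mul, hM.limitE_add hk, hx, hy, add_mul]
  | single η r =>
    have hu : limitE P M (flatIncl k (u η) * a) = u η * limitE P M a := by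
      ext ζ
      rw [MonoidAlgebra.coeff_single_mul_apply, one_mul]
      refine tendsto_nhds_unique (hM.tendsto_flatMoment hk _ ζ) ?_
      have := hM.tendsto_flatMoment hk a (η⁻¹ * ζ)
      simpa only [flatMoment_incl_mul] using this
    have hr : (MonoidAlgebra.single η r : SymAlg k) = r • u η := by
      rw [MonoidAlgebra.smul_single, smul_eq_mul, mul_one]
    rw [hr, map_smul, smul_mul_assoc, smul_mul_assoc, hM.limitE_smul hk, hu]

theorem IsTensorModel.limitE_mul_incl (hM : IsTensorModel k P M μ c c') (hk : 1 ≤ k)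
    (a : FlatAlg k) (b : SymAlg k) : limitE P M (a * flatIncl k b) = limitE P M a * b := by
  have hzero : limitE P M (0 : FlatAlg k) = 0 := by
    have := hM.limitE_smul hk 0 0
    rwa [zero_smul, zero_smul] at this
  induction b using MonoidAlgebra.induction_linear with
  | zero => rw [map_zero, mul_zero, mul_zero, hzero]
  | add x y hx hy => rw [map_add, mul_add, hM.limitE_add hk, hx, hy, mul_add]
  | single η r =>
    have hu : limitE P M (a * flatIncl k (u η)) = limitE P M a * u η := by
      ext ζ
      rw [MonoidAlgebra.coeff_mul_single_apply, mul_one]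
      refine tendsto_nhds_unique (hM.tendsto_flatMoment hk _ ζ) ?_
      have := hM.tendsto_flatMoment hk a (ζ * η⁻¹)
      simpa only [flatMoment_mul_incl] using this
    have hr : (MonoidAlgebra.single η r : SymAlg k) = r • u η := by
      rw [MonoidAlgebra.smul_single, smul_eq_mul, mul_one]
    rw [hr, map_smul, mul_smul_comm, mul_smul_comm, hM.limitE_smul hk, hu]

theorem IsTensorModel.limitE_star (hM : IsTensorModel k P M μ c c') (hk : 1 ≤ k)
    (a : FlatAlg k) : limitE P M (star a) = star (limitE P M a) := by
  ext ζ
  rw [star_coeff]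
  refine tendsto_nhds_unique (hM.tendsto_flatMoment hk _ ζ) ?_
  simp only [flatMoment_star]
  exact (Complex.continuous_conj.tendsto _).comp (hM.tendsto_flatMoment hk a ζ⁻¹)

open scoped ComplexOrder in
theorem IsTensorModel.limitE_star_mul_self_nonneg (hM : IsTensorModel k P M μ c c') (hk : 1 ≤ k)
    (a : FlatAlg k) : 0 ≤ (limitE P M (star a * a)).coeff 1 :=
  ge_of_tendsto' (hM.tendsto_flatMoment hk _ 1) fun _ => flatMoment_star_mul_self_nonneg a

/-- The moment formula for the empty word: the only partition is empty and `tendsto_loopCount_nil`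
gives the coefficient. -/
theorem IsTensorModel.limitE_one (hM : IsTensorModel k P M μ c c') (hk : 1 ≤ k) :
    limitE P M (1 : FlatAlg k) = 1 := by
  classical
  ext ζ
  refine tendsto_nhds_unique (hM.tendsto_flatMoment hk _ ζ) ?_
  have h := hM.tendsto_expTrace hk (L := 0) Fin.elim0 Fin.elim0 Fin.elim0 ζ
    (Λ := fun _ => if ζ = 1 then 1 else 0) (fun π _ => by
      have hnil : wordOf (blockOf π) (fun l : Fin 0 => letterPerm (k := k) (Fin.elim0 l)
          (Fin.elim0 l) (Fin.elim0 l)) (π.parts.sup id) = [] := by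
        rw [π.sup_parts]; simp [wordOf]
      rw [hnil]
      exact tendsto_loopCount_nil ζ)
  simp only [← flatMoment_prod] at h
  simp only [List.ofFn_zero, List.prod_nil] at h
  convert h using 2
  have : Unique (Finpartition (Finset.univ : Finset (Fin 0))) :=
    inferInstanceAs (Unique (Finpartition (⊥ : Finset (Fin 0))))
  rw [MonoidAlgebra.one_def, MonoidAlgebra.coeff_single, Finsupp.single_apply, Fintype.sum_unique]
  have hp : (default : Finpartition (Finset.univ : Finset (Fin 0))).parts = ∅ :=
    Finpartition.parts_eq_empty_iff.2 rfl
  rw [hp, Finset.prod_empty, one_mul]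
  by_cases h1 : ζ = 1
  · simp [h1]
  · simp [h1, Ne.symm h1]

/-- The limit space of the flattenings. -/
noncomputable def IsTensorModel.limitSpace (hM : IsTensorModel k P M μ c c') (hk : 1 ≤ k) :
    OVSpace k (FlatAlg k) where
  incl := flatIncl k
  E :=
    { toFun := limitE P M
      map_add' := hM.limitE_add hk
      map_smul' := hM.limitE_smul hk }
  E_one := hM.limitE_one hk
  E_bimodule b a b' := by
    change limitE P M _ = b * limitE P M a * b'
    rw [hM.limitE_mul_incl hk, hM.limitE_incl_mul hk]
  completely_positive := by
    refine isPos_map_of_nonneg (flatIncl k) _ (fun η a ζ => ?_) (hM.limitE_star hk)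
      (hM.limitE_star_mul_self_nonneg hk)
    change limitE P M _ = u η * limitE P M a * u ζ
    rw [hM.limitE_mul_incl hk, hM.limitE_incl_mul hk]

theorem IsTensorModel.tendsto_expTrace_limitSpace (hM : IsTensorModel k P M μ c c') (hk : 1 ≤ k)
    {L : ℕ} (σ : Fin L → Equiv.Perm (Fin (k + k))) (ε : Fin L → Bool)
    (η : Fin L → Equiv.Perm (Fin k)) (ζ : Equiv.Perm (Fin k)) :
    Tendsto (fun N => expTrace (P N) fun ω => (List.ofFn fun l =>
        adj (ε l) (flattening (M N ω) (σ l)) * permMatrix N (η l)).prod * (permMatrix N ζ)ᴴ) atTop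
      (𝓝 (((hM.limitSpace hk).E (List.ofFn fun l => adj (ε l) (flatGen (σ l)) *
        (hM.limitSpace hk).incl (u (η l))).prod).coeff ζ)) := by
  simp only [← flatMoment_prod]
  exact hM.tendsto_flatMoment hk _ ζ

theorem IsTensorModel.convergesInSymDistribution (hM : IsTensorModel k P M μ c c') (hk : 1 ≤ k) :
    ConvergesInSymDistribution P (fun N σ ω => flattening (M N ω) σ) (hM.limitSpace hk) flatGen :=
  -- The coefficients are those in the definition of `ℰ_N`, so the expansion holds for every `N` and
  -- linear independence of the `U_η` plays no role.
  fun _ _ σ ε η => ⟨_, Eventually.of_forall fun _ => rfl, fun ζ =>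
    hM.tendsto_expTrace_limitSpace hk σ ε η ζ⟩

end LimitSpace


/-! ### Limits along non-crossing pairings -/

section NestedPairings

variable {k : ℕ} {A : Type*} [Ring A] [StarRing A] [Algebra ℂ A] (S : OVSpace k A)
  (m : Equiv.Perm (Fin (k + k)) → A)

/-- The element `m_σ^ε u_η`. -/
noncomputable def letterElt (σ : Equiv.Perm (Fin (k + k))) (ε : Bool) (η : Equiv.Perm (Fin k)) :
    A :=
  adj ε (m σ) * S.incl (u η)

theorem letterElt_mul_incl (σ : Equiv.Perm (Fin (k + k))) (ε : Bool) (η η' : Equiv.Perm (Fin k)) :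
    letterElt S m σ ε η * S.incl (u η') = letterElt S m σ ε (η * η') := by
  rw [letterElt, letterElt, mul_assoc, ← map_mul, MonoidAlgebra.single_mul_single, one_mul]

/-- The weight of a pair of letters. -/
noncomputable def pairWeight (c : ℝ) (c' : ℂ) : Bool → Bool → ℂ
  | false, false => c'
  | true, true => conj c'
  | _, _ => c

theorem blockWeight_pair (c : ℝ) (c' : ℂ) {L : ℕ} (ε : Fin L → Bool) {x y : Fin L} (h : x ≠ y) :
    blockWeight c c' ε {x, y} = pairWeight c c' (ε x) (ε y) := by
  unfold blockWeight
  rw [Finset.filter_insert, Finset.filter_singleton, Finset.filter_insert, Finset.filter_singleton]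
  cases hx : ε x <;> cases hy : ε y <;> simp [limitMoment, pairWeight, h]

open Classical in
/-- The contraction of two letters. -/
noncomputable def contraction (w : ℂ) (ρ ρ' : Equiv.Perm (Fin (k + k))) : SymAlg k :=
  if h : ∃ η, Matches ρ ρ' η then w • u h.choose else 0

theorem contraction_of_matches (w : ℂ) {ρ ρ' : Equiv.Perm (Fin (k + k))} {η : Equiv.Perm (Fin k)}
    (h : Matches ρ ρ' η) : contraction w ρ ρ' = w • u η := by
  rw [contraction, dif_pos ⟨η, h⟩, (Exists.choose_spec (⟨η, h⟩ : ∃ η, Matches ρ ρ' η)).unique h]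

theorem contraction_of_not_matches (w : ℂ) {ρ ρ' : Equiv.Perm (Fin (k + k))}
    (h : ¬ ∃ η, Matches ρ ρ' η) : contraction w ρ ρ' = 0 := by
  rw [contraction, dif_neg h]

/-- The contribution of a non-crossing pairing converges to the nested evaluation of the
contractions. -/
theorem tendsto_loopCount_nested {ι : Type*} [LinearOrder ι] {β : Type*} [Fintype β]
    [DecidableEq β] (hk : 1 ≤ k) {lab : ι → β} {ξ : Finset (Finset ι)} (h : IsPairing lab ξ)
    (hnc : NonCrossing ξ) {K : ∀ n : ℕ, (Fin n → A) → SymAlg k}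
    (hK : ∀ n, ∃ g : MultilinearMap ℂ (fun _ : Fin n => A) (SymAlg k), K n = g)
    (w : Finset ι → ℂ) (σ : ι → Equiv.Perm (Fin (k + k))) (ε : ι → Bool)
    (hpair : ∀ x y : ι, x < y → {x, y} ∈ ξ → ∀ η η' : Equiv.Perm (Fin k),
      K 2 ![letterElt S m (σ x) (ε x) η, letterElt S m (σ y) (ε y) η'] =
        contraction (w {x, y}) (letterPerm (σ x) (ε x) η) (letterPerm (σ y) (ε y) η'))
    (η : ι → Equiv.Perm (Fin k)) (ζ : Equiv.Perm (Fin k)) :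
    Tendsto (fun N => (∏ B ∈ ξ, w B) * (loopCount N (wordOf lab
      (fun l => letterPerm (σ l) (ε l) (η l)) (ξ.sup id)) ζ : ℂ)) atTop
      (𝓝 ((nested S K ξ fun l => letterElt S m (σ l) (ε l) (η l)).coeff ζ)) := by
  have htop : ∀ (ξ : Finset (Finset ι)) (ρ : ι → Equiv.Perm (Fin (k + k))) (t : ℝ)
      (ζ : Equiv.Perm (Fin k)),
      Tendsto (fun N => loopCount N (wordOf lab ρ (ξ.sup id)) ζ) atTop (𝓝 t) →
      Tendsto (fun N => (loopCount N (wordOf lab ρ (ξ.sup id)) ζ : ℂ)) atTop (𝓝 (t : ℂ)) :=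
    fun ξ ρ t ζ ht => (Complex.continuous_ofReal.tendsto _).comp ht
  induction hn : ξ.card generalizing ξ η ζ with
  | zero =>
    classical
    have hξ := Finset.card_eq_zero.1 hn
    subst hξ
    rw [nested_empty, Finset.prod_empty]
    have := htop ∅ (fun l => letterPerm (σ l) (ε l) (η l)) _ ζ
      ((tendsto_loopCount_nil (β := β) ζ).congr fun N => by simp [wordOf])
    convert this using 2
    · rw [one_mul]
    · rw [MonoidAlgebra.one_def, MonoidAlgebra.coeff_single, Finsupp.single_apply]
      by_cases h1 : ζ = 1
      · simp [h1]
      · simp [h1, Ne.symm h1]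
  | succ n ih =>
    have hne : ξ.Nonempty := Finset.card_pos.1 (by omega)
    -- The pair removed from the word is the one selected by `nested`, so that both sides follow the
    -- same recursion.
    obtain ⟨B, hB, hstep⟩ := nested_of_exists S (exists_isFirstIntervalBlock h.isBlocks
      (exists_isIntervalBlock h.isBlocks hnc hne))
    have hint := hB.1
    obtain ⟨x, y, hxy, rfl⟩ := h.exists_eq_pair hint.1
    have hcard : (ξ.erase {x, y}).card = n := by rw [Finset.card_erase_of_mem hint.1, hn]; rfl
    have h' := h.mono (Finset.erase_subset {x, y} ξ)
    have hnc' := hnc.mono (Finset.erase_subset {x, y} ξ)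
    have hpair' := fun (x' y' : ι) (hlt : x' < y') (hmem : {x', y'} ∈ ξ.erase {x, y}) =>
      hpair x' y' hlt (Finset.mem_of_mem_erase hmem)
    have hval : blockValue K {x, y} (fun l => letterElt S m (σ l) (ε l) (η l)) =
        contraction (w {x, y}) (letterPerm (σ x) (ε x) (η x)) (letterPerm (σ y) (ε y) (η y)) := by
      rw [blockValue_pair _ _ hxy]
      exact hpair x y hxy hint.1 _ _
    obtain ⟨hbefore, hfirst⟩ := hstep K fun l => letterElt S m (σ l) (ε l) (η l)
    rw [hval] at hbefore hfirst
    by_cases hη : ∃ η', Matches (letterPerm (σ x) (ε x) (η x)) (letterPerm (σ y) (ε y) (η y)) η'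
    · obtain ⟨η', hη'⟩ := hη
      rw [contraction_of_matches _ hη'] at hbefore hfirst
      by_cases hbef : (beforeBlock ξ {x, y}).Nonempty
      · set p := (beforeBlock ξ {x, y}).max' hbef with hp
        have hpm : p ∈ (ξ.erase {x, y}).sup id := beforeBlock_subset (Finset.max'_mem _ hbef)
        have hlin := isLinearMap_nested S hK h'.isBlocks hnc' hpm
          fun l => letterElt S m (σ l) (ε l) (η l)
        have hup : Function.update (fun l => letterElt S m (σ l) (ε l) (η l)) p
            (letterElt S m (σ p) (ε p) (η p * η')) =
            fun l => letterElt S m (σ l) (ε l) (Function.update η p (η p * η') l) := by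
          funext l
          by_cases hl : l = p
          · subst hl; simp
          · simp [hl]
        have hup' : Function.update (fun l => letterPerm (σ l) (ε l) (η l)) p
            (glue 1 η'⁻¹ * letterPerm (σ p) (ε p) (η p)) =
            fun l => letterPerm (σ l) (ε l) (Function.update η p (η p * η') l) := by
          funext l
          by_cases hl : l = p
          · subst hl; simp [letterPerm_mul]
          · simp [hl]
        -- Both reductions replace `η p` by `η p * η'`. This is why the hypothesis on `K 2` is
        -- required for all permutations attached to the letters.
        rw [hbefore hbef, map_smul, mul_smul_comm, letterElt_mul_incl, hlin.map_smul, hup,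
          MonoidAlgebra.coeff_smul, Finsupp.smul_apply, smul_eq_mul]
        refine ((ih h' hnc' hpair' (Function.update η p (η p * η')) ζ hcard).const_mul
          (w {x, y})).congr' ?_
        filter_upwards [eventually_gt_atTop 0] with N hN
        rw [loopCount_erase_of_before hN h _ hxy hint hη' hbef ζ, ← hp, hup', ← mul_assoc,
          Finset.mul_prod_erase _ _ hint.1]
      · rw [hfirst hbef, smul_mul_assoc, MonoidAlgebra.coeff_smul, Finsupp.smul_apply, smul_eq_mul,
          MonoidAlgebra.coeff_single_mul_apply, one_mul]
        refine ((ih h' hnc' hpair' η (η'⁻¹ * ζ) hcard).const_mul (w {x, y})).congr' ?_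
        filter_upwards [eventually_gt_atTop 0] with N hN
        rw [loopCount_erase_of_first hN h _ hxy hint hη' (Finset.not_nonempty_iff_eq_empty.1 hbef) ζ,
          ← mul_assoc, Finset.mul_prod_erase _ _ hint.1]
    · rw [contraction_of_not_matches _ hη] at hbefore hfirst
      have hzero : nested S K ξ (fun l => letterElt S m (σ l) (ε l) (η l)) = 0 := by
        by_cases hbef : (beforeBlock ξ {x, y}).Nonempty
        · have hpm : (beforeBlock ξ {x, y}).max' hbef ∈ (ξ.erase {x, y}).sup id :=
            beforeBlock_subset (Finset.max'_mem _ hbef)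
          rw [hbefore hbef, map_zero, mul_zero]
          exact (isLinearMap_nested S hK h'.isBlocks hnc' hpm _).map_zero
        · rw [hfirst hbef, zero_mul]
      rw [hzero, MonoidAlgebra.coeff_zero, Finsupp.zero_apply]
      have := (htop ξ _ _ ζ (tendsto_loopCount_zero (fun l => letterPerm (σ l) (ε l) (η l)) ζ
        fun N hN => loopCount_le_of_interval_not_matches hN hk h _ hxy hint hη ζ)).const_mul
          (∏ B ∈ ξ, w B)
      simpa using this

end NestedPairings


/-! ### Covariances and cumulants of the limit family -/

/-- Each coefficient `b l` is expanded in the basis of the `u η`. -/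
theorem multilinear_eq_zero_of_letterElt {k : ℕ} {A : Type*} [Ring A] [StarRing A] [Algebra ℂ A]
    (S : OVSpace k A) (m : Equiv.Perm (Fin (k + k)) → A) {n : ℕ}
    (g : MultilinearMap ℂ (fun _ : Fin n => A) (SymAlg k)) (σ : Fin n → Equiv.Perm (Fin (k + k)))
    (ε : Fin n → Bool) (hg : ∀ η : Fin n → Equiv.Perm (Fin k),
      g (fun l => letterElt S m (σ l) (ε l) (η l)) = 0) (b : Fin n → SymAlg k) :
    g (fun l => adj (ε l) (m (σ l)) * S.incl (b l)) = 0 := by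
  have hb : ∀ l, adj (ε l) (m (σ l)) * S.incl (b l) =
      ∑ η, (b l).coeff η • letterElt S m (σ l) (ε l) η := by
    intro l
    have h1 : b l = ∑ η, (b l).coeff η • u η := by
      ext ζ
      have := coeff_sum_single (fun η => (b l).coeff η) ζ
      simpa only [MonoidAlgebra.smul_single, smul_eq_mul, mul_one] using this.symm
    conv_lhs => rw [h1, map_sum, Finset.mul_sum]
    simp only [map_smul, mul_smul_comm, letterElt]
  simp only [hb]
  rw [g.map_sum]
  refine Finset.sum_eq_zero fun η _ => ?_
  rw [g.map_smul_univ, hg, smul_zero]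

section LimitFamily

variable {k : ℕ} {Ω : ℕ → Type*} [∀ N, MeasurableSpace (Ω N)] {P : ∀ N, Measure (Ω N)}
  {M : ∀ N, Ω N → Tensor N k} {μ : ℕ → Measure ℂ} {c : ℝ} {c' : ℂ}
  [∀ N, IsProbabilityMeasure (P N)]

/-- The moments of the limit family, as sums over pairings. -/
theorem IsTensorModel.coeff_E_prod (hM : IsTensorModel k P M μ c c') (hk : 1 ≤ k) {L : ℕ}
    (σ : Fin L → Equiv.Perm (Fin (k + k))) (ε : Fin L → Bool) (η : Fin L → Equiv.Perm (Fin k))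
    (ζ : Equiv.Perm (Fin k)) {Λ : Finpartition (Finset.univ : Finset (Fin L)) → ℝ}
    (hΛ : ∀ π : Finpartition (Finset.univ : Finset (Fin L)), (∀ B ∈ π.parts, B.card = 2) →
      Tendsto (fun N => loopCount N (wordOf (blockOf π)
        (fun l => letterPerm (σ l) (ε l) (η l)) (π.parts.sup id)) ζ) atTop (𝓝 (Λ π))) :
    ((hM.limitSpace hk).E (List.ofFn fun l =>
      letterElt (hM.limitSpace hk) flatGen (σ l) (ε l) (η l)).prod).coeff ζ =
      ∑ π : Finpartition (Finset.univ : Finset (Fin L)),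
        (∏ B ∈ π.parts, blockWeight c c' ε B) * (Λ π : ℂ) :=
  tendsto_nhds_unique (hM.tendsto_expTrace_limitSpace hk σ ε η ζ)
    (hM.tendsto_expTrace hk σ ε η ζ hΛ)

theorem parts_eq_of_fin_two {π : Finpartition (Finset.univ : Finset (Fin 2))}
    (hπ : ∀ B ∈ π.parts, B.card = 2) : π.parts = {{0, 1}} := by
  have huniv : ∀ B ∈ π.parts, B = {0, 1} := fun B hB =>
    ((Finset.card_eq_iff_eq_univ B).1 (by simp [hπ B hB])).trans rfl
  refine Finset.eq_singleton_iff_unique_mem.2 ⟨?_, huniv⟩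
  obtain ⟨B, hB, -⟩ := π.exists_mem (Finset.mem_univ (0 : Fin 2))
  rwa [← huniv B hB]

/-- For two letters the single block `{0, 1}` is the only pairing, and removing it leaves the empty
word with closing permutation `θ⁻¹ * ζ`. -/
theorem IsTensorModel.E_letterElt_mul (hM : IsTensorModel k P M μ c c') (hk : 1 ≤ k)
    (σ σ' : Equiv.Perm (Fin (k + k))) (ε ε' : Bool) (η η' : Equiv.Perm (Fin k)) :
    (hM.limitSpace hk).E (letterElt (hM.limitSpace hk) flatGen σ ε η *
      letterElt (hM.limitSpace hk) flatGen σ' ε' η') =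
      contraction (pairWeight c c' ε ε') (letterPerm σ ε η) (letterPerm σ' ε' η') := by
  classical
  ext ζ
  have h := hM.coeff_E_prod hk ![σ, σ'] ![ε, ε'] ![η, η'] ζ
    (Λ := fun _ => if Matches (letterPerm σ ε η) (letterPerm σ' ε' η') ζ then 1 else 0) (by
      intro π hπ
      have hp := isPairing_parts π hπ
      have hparts := parts_eq_of_fin_two hπ
      have hint : IsIntervalBlock π.parts {0, 1} := by
        rw [hparts]
        refine ⟨Finset.mem_singleton_self _, fun x _ z _ y hy _ _ => by simpa using hy⟩
      have hemp : beforeBlock π.parts {0, 1} = ∅ := by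
        rw [hparts]; simp [beforeBlock]
      have hsup : (π.parts.erase {0, 1}).sup id = ∅ := by rw [hparts]; simp
      by_cases hη : ∃ θ, Matches (letterPerm σ ε η) (letterPerm σ' ε' η') θ
      · obtain ⟨θ, hθ⟩ := hη
        have hiff : Matches (letterPerm σ ε η) (letterPerm σ' ε' η') ζ ↔ θ⁻¹ * ζ = 1 := by
          rw [inv_mul_eq_one]
          exact ⟨fun h => hθ.unique h, fun h => h ▸ hθ⟩
        simp only [hiff]
        refine (tendsto_loopCount_nil (β := {B // B ∈ π.parts}) (θ⁻¹ * ζ)).congr' ?_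
        filter_upwards [eventually_gt_atTop 0] with N hN
        rw [loopCount_erase_of_first hN hp (fun l => letterPerm (![σ, σ'] l) (![ε, ε'] l)
          (![η, η'] l)) (by decide : (0 : Fin 2) < 1) hint hθ hemp ζ, hsup]
        simp [wordOf]
      · rw [if_neg fun h => hη ⟨ζ, h⟩]
        exact tendsto_loopCount_zero _ ζ fun N hN => loopCount_le_of_interval_not_matches hN hk hp
          (fun l => letterPerm (![σ, σ'] l) (![ε, ε'] l) (![η, η'] l))
          (by decide : (0 : Fin 2) < 1) hint hη ζ)
  have hprod : (List.ofFn fun l : Fin 2 => letterElt (hM.limitSpace hk) flatGen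
      (![σ, σ'] l) (![ε, ε'] l) (![η, η'] l)).prod =
      letterElt (hM.limitSpace hk) flatGen σ ε η *
        letterElt (hM.limitSpace hk) flatGen σ' ε' η' := by
    simp [List.ofFn_succ]
  rw [hprod] at h
  rw [h]
  have hne : (Finset.univ : Finset (Fin 2)) ≠ ⊥ := by decide
  rw [Finset.sum_eq_single (Finpartition.indiscrete hne)]
  · rw [Finpartition.indiscrete_parts, Finset.prod_singleton,
      show (Finset.univ : Finset (Fin 2)) = {0, 1} from rfl, blockWeight_pair _ _ _ (by decide)]
    by_cases hη : ∃ θ, Matches (letterPerm σ ε η) (letterPerm σ' ε' η') θ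
    · obtain ⟨θ, hθ⟩ := hη
      have hiff : Matches (letterPerm σ ε η) (letterPerm σ' ε' η') ζ ↔ θ = ζ :=
        ⟨fun h => hθ.unique h, fun h => h ▸ hθ⟩
      rw [contraction_of_matches _ hθ, MonoidAlgebra.coeff_smul, Finsupp.smul_apply,
        MonoidAlgebra.coeff_single, Finsupp.single_apply]
      simp only [hiff]
      by_cases hθζ : θ = ζ <;> simp [hθζ]
    · rw [contraction_of_not_matches _ hη, if_neg fun h => hη ⟨ζ, h⟩]
      simp
  · intro π _ hπ
    have hB : ∃ B ∈ π.parts, B.card ≠ 2 := by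
      by_contra hcon
      push Not at hcon
      exact hπ (Finpartition.ext (parts_eq_of_fin_two hcon))
    obtain ⟨B, hB, hB2⟩ := hB
    rw [Finset.prod_eq_zero hB (blockWeight_eq_zero c c' _ hB2), zero_mul]
  · intro h
    exact absurd (Finset.mem_univ _) h

/-- Nested evaluations vanish if the cumulant of the size of one of the blocks does. -/
theorem nested_cumulant_eq_zero {A : Type*} [Ring A] [StarRing A] [Algebra ℂ A]
    (S : OVSpace k A) (m : Equiv.Perm (Fin (k + k)) → A) {n : ℕ}
    {ξ : Finpartition (Finset.univ : Finset (Fin n))} (hξ : IsNonCrossing ξ) {B : Finset (Fin n)}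
    (hB : B ∈ ξ.parts) (hzero : ∀ (σ : Fin B.card → Equiv.Perm (Fin (k + k)))
      (ε : Fin B.card → Bool) (b : Fin B.card → SymAlg k),
      cumulant S B.card (fun l => adj (ε l) (m (σ l)) * S.incl (b l)) = 0)
    (σ : Fin n → Equiv.Perm (Fin (k + k))) (ε : Fin n → Bool) (η : Fin n → Equiv.Perm (Fin k)) :
    nested S (fun n => cumulant S n) ξ.parts (fun l => letterElt S m (σ l) (ε l) (η l)) = 0 := by
  refine nested_eq_zero S (fun n => ⟨cumulant S n, rfl⟩)
    (good := fun a => ∃ σ ε b, a = adj ε (m σ) * S.incl b) ?_ (isBlocks_parts ξ) hξ hB ?_ ?_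
  · rintro _ b ⟨σ, ε, b', rfl⟩
    exact ⟨σ, ε, b' * b, by rw [map_mul, mul_assoc]⟩
  · intro a ha
    choose σ ε b hab using ha
    obtain rfl : a = _ := funext hab
    exact hzero σ ε b
  · exact fun l => ⟨σ l, ε l, u (η l), rfl⟩

/-- With vanishing first cumulants, the second cumulant is the covariance. Vanishing at order one is
a hypothesis so that the lemma can be used inside the induction proving it for all orders other than
two. -/
theorem IsTensorModel.cumulant_two (hM : IsTensorModel k P M μ c c') (hk : 1 ≤ k)
    (hone : ∀ (σ : Fin 1 → Equiv.Perm (Fin (k + k))) (ε : Fin 1 → Bool) (b : Fin 1 → SymAlg k),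
      cumulant (hM.limitSpace hk) 1
        (fun l => adj (ε l) (flatGen (σ l)) * (hM.limitSpace hk).incl (b l)) = 0)
    (σ σ' : Equiv.Perm (Fin (k + k))) (ε ε' : Bool) (η η' : Equiv.Perm (Fin k)) :
    cumulant (hM.limitSpace hk) 2 ![letterElt (hM.limitSpace hk) flatGen σ ε η,
      letterElt (hM.limitSpace hk) flatGen σ' ε' η'] =
      contraction (pairWeight c c' ε ε') (letterPerm σ ε η) (letterPerm σ' ε' η') := by
  classical
  rw [← hM.E_letterElt_mul hk]
  have h := E_prod_eq_cumulant_add (hM.limitSpace hk) 2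
    ![letterElt (hM.limitSpace hk) flatGen σ ε η, letterElt (hM.limitSpace hk) flatGen σ' ε' η']
  have hsum : ∀ ξ : Finpartition (Finset.univ : Finset (Fin 2)),
      IsNonCrossing ξ → ξ.parts ≠ {Finset.univ} → nested (hM.limitSpace hk)
        (fun n => cumulant (hM.limitSpace hk) n) ξ.parts
        ![letterElt (hM.limitSpace hk) flatGen σ ε η,
          letterElt (hM.limitSpace hk) flatGen σ' ε' η'] = 0 := by
    intro ξ hξ hne
    obtain ⟨B, hB, -⟩ := ξ.exists_mem (Finset.mem_univ (0 : Fin 2))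
    have hlt := card_lt_of_mem_parts hne hB
    have hpos := Finset.card_pos.2 (ξ.nonempty_of_mem_parts hB)
    have hB1 : B.card = 1 := by omega
    have hfun : ![letterElt (hM.limitSpace hk) flatGen σ ε η,
        letterElt (hM.limitSpace hk) flatGen σ' ε' η'] =
        fun l => letterElt (hM.limitSpace hk) flatGen (![σ, σ'] l) (![ε, ε'] l) (![η, η'] l) := by
      funext l
      fin_cases l <;> rfl
    rw [hfun]
    refine nested_cumulant_eq_zero _ _ hξ hB ?_ _ _ _
    rw [hB1]
    exact hone
  rw [Finset.sum_eq_zero fun ξ hξ => hsum ξ (Finset.mem_filter.1 hξ).2.1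
    (Finset.mem_filter.1 hξ).2.2, add_zero] at h
  rw [← h]
  simp [List.ofFn_succ]

/-- The nested terms of the proper non-crossing partitions already account for the whole moment.
Non-crossing pairings agree with their limit counts, crossing pairings have limit zero, and any
other partition has a block whose size is not two, where the induction hypothesis and the block
weight both vanish. Nothing remains for the cumulant of order `n`. -/
theorem IsTensorModel.cumulant_eq_zero (hM : IsTensorModel k P M μ c c') (hk : 1 ≤ k) {n : ℕ}
    (hn : 1 ≤ n) (hn2 : n ≠ 2) (σ : Fin n → Equiv.Perm (Fin (k + k))) (ε : Fin n → Bool)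
    (b : Fin n → SymAlg k) :
    cumulant (hM.limitSpace hk) n
      (fun l => adj (ε l) (flatGen (σ l)) * (hM.limitSpace hk).incl (b l)) = 0 := by
  classical
  induction n using Nat.strong_induction_on with
  | _ n ih =>
    refine multilinear_eq_zero_of_letterElt _ flatGen _ σ ε (fun η => ?_) b
    ext ζ
    have hex : ∀ π : Finpartition (Finset.univ : Finset (Fin n)), ∃ Λ : ℝ,
        (∀ B ∈ π.parts, B.card = 2) → Tendsto (fun N => loopCount N (wordOf (blockOf π)
          (fun l => letterPerm (σ l) (ε l) (η l)) (π.parts.sup id)) ζ) atTop (𝓝 Λ) := by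
      intro π
      by_cases hπ : ∀ B ∈ π.parts, B.card = 2
      · obtain ⟨Λ, hΛ⟩ := exists_tendsto_loopCount hk (isPairing_parts π hπ)
          (fun l => letterPerm (σ l) (ε l) (η l)) ζ
        exact ⟨Λ, fun _ => hΛ⟩
      · exact ⟨0, fun h => absurd h hπ⟩
    choose Λ hΛ using hex
    have hE := hM.coeff_E_prod hk σ ε η ζ hΛ
    rw [E_prod_eq_cumulant_add, MonoidAlgebra.coeff_add, Finsupp.add_apply,
      MonoidAlgebra.coeff_sum, Finsupp.finsetSum_apply] at hE
    have hsum : ∑ ξ : Finpartition (Finset.univ : Finset (Fin n)) with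
        IsNonCrossing ξ ∧ ξ.parts ≠ {Finset.univ},
        (nested (hM.limitSpace hk) (fun n => cumulant (hM.limitSpace hk) n) ξ.parts
          (fun l => letterElt (hM.limitSpace hk) flatGen (σ l) (ε l) (η l))).coeff ζ =
        ∑ π : Finpartition (Finset.univ : Finset (Fin n)),
          (∏ B ∈ π.parts, blockWeight c c' ε B) * (Λ π : ℂ) := by
      rw [Finset.sum_filter]
      refine Finset.sum_congr rfl fun π _ => ?_
      by_cases hπ : ∀ B ∈ π.parts, B.card = 2
      · have hne : π.parts ≠ {Finset.univ} := by
          intro h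
          refine hn2 ?_
          have := hπ Finset.univ (by rw [h]; exact Finset.mem_singleton_self _)
          simpa using this
        by_cases hnc : IsNonCrossing π
        · rw [if_pos ⟨hnc, hne⟩]
          have hpair : ∀ x y : Fin n, x < y → {x, y} ∈ π.parts → ∀ η η' : Equiv.Perm (Fin k),
              cumulant (hM.limitSpace hk) 2 ![letterElt (hM.limitSpace hk) flatGen (σ x) (ε x) η,
                letterElt (hM.limitSpace hk) flatGen (σ y) (ε y) η'] =
              contraction (blockWeight c c' ε {x, y}) (letterPerm (σ x) (ε x) η)
                (letterPerm (σ y) (ε y) η') := by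
            intro x y hxy hmem η η'
            rw [blockWeight_pair _ _ _ hxy.ne]
            have hlt := card_lt_of_mem_parts hne hmem
            rw [hπ _ hmem] at hlt
            exact hM.cumulant_two hk (ih 1 (by omega) le_rfl (by norm_num)) _ _ _ _ _ _
          refine tendsto_nhds_unique (tendsto_loopCount_nested _ flatGen hk (isPairing_parts π hπ)
            hnc (fun n => ⟨cumulant (hM.limitSpace hk) n, rfl⟩) (blockWeight c c' ε) σ ε hpair η ζ) ?_
          exact ((Complex.continuous_ofReal.tendsto _).comp (hΛ π hπ)).const_mul _
        · rw [if_neg fun h => hnc h.1, tendsto_nhds_unique (hΛ π hπ)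
            (tendsto_loopCount_of_crossing hk (isPairing_parts π hπ) hnc _ ζ)]
          simp
      · push Not at hπ
        obtain ⟨B, hB, hB2⟩ := hπ
        rw [Finset.prod_eq_zero hB (blockWeight_eq_zero c c' _ hB2), zero_mul]
        by_cases h : IsNonCrossing π ∧ π.parts ≠ {Finset.univ}
        · rw [if_pos h, nested_cumulant_eq_zero _ _ h.1 hB ?_]
          · simp
          · exact ih B.card (card_lt_of_mem_parts h.2 hB)
              (Finset.card_pos.2 (π.nonempty_of_mem_parts hB)) hB2
        · rw [if_neg h]
    rw [hsum] at hE
    simpa using hE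

theorem IsTensorModel.isSymCircular (hM : IsTensorModel k P M μ c c') (hk : 1 ≤ k) :
    IsSymCircular (hM.limitSpace hk) flatGen :=
  ⟨cumulant (hM.limitSpace hk), isFreeCumulants_cumulant _, fun _ hL σ ε b =>
    hM.cumulant_eq_zero hk (by omega) (by omega) σ ε b⟩

theorem IsTensorModel.isCentered (hM : IsTensorModel k P M μ c c') (hk : 1 ≤ k) :
    IsCentered (hM.limitSpace hk) flatGen := by
  classical
  intro σ
  have h := hM.cumulant_eq_zero hk le_rfl (by norm_num) (fun _ : Fin 1 => σ) (fun _ => false)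
    fun _ => 1
  have h' := E_prod_eq_cumulant_add (hM.limitSpace hk) 1
    (fun _ => adj false (flatGen σ) * (hM.limitSpace hk).incl 1)
  rw [h, zero_add, Finset.sum_eq_zero] at h'
  · simpa [adj, List.ofFn_succ] using h'
  · intro ξ hξ
    obtain ⟨B, hB, -⟩ := ξ.exists_mem (Finset.mem_univ (0 : Fin 1))
    have hlt := card_lt_of_mem_parts (Finset.mem_filter.1 hξ).2.2 hB
    have hpos := Finset.card_pos.2 (ξ.nonempty_of_mem_parts hB)
    omega

end LimitFamily

/-! ### Matching of letters -/

section Matching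

variable {k : ℕ}

/-- The adjoint brings a second `τ`; commuting it past `1 ⊔ η'` cancels both and moves `η'` to the
first half. In the two other covariances `η'` stays in the second half. -/
theorem matches_star_right_iff (σ σ' : Equiv.Perm (Fin (k + k))) (η η' : Equiv.Perm (Fin k)) :
    Matches (letterPerm σ false η) (letterPerm σ' true 1) η' ↔ σ = glue η' η * σ' := by
  have h : glue (1 : Equiv.Perm (Fin k)) η⁻¹ = (glue 1 η)⁻¹ := by rw [glue_inv, inv_one]
  have h2 : swapHalves k * glue 1 η' * (swapHalves k * glue 1 1 * σ') = glue η' 1 * σ' := by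
    rw [swapHalves_mul_glue, glue_one, mul_one, mul_assoc, ← mul_assoc (swapHalves k),
      swapHalves_mul_self, one_mul]
  simp only [Matches, letterPerm, Bool.false_eq_true, if_false, if_true, inv_one]
  rw [h2, h, inv_mul_eq_iff_eq_mul, ← mul_assoc, glue_mul, one_mul, mul_one]

theorem matches_star_left_iff (σ σ' : Equiv.Perm (Fin (k + k))) (η η' : Equiv.Perm (Fin k)) :
    Matches (letterPerm σ true η) (letterPerm σ' false 1) η' ↔ σ = glue η η' * σ' := by
  have h : glue η⁻¹ (1 : Equiv.Perm (Fin k)) = (glue η 1)⁻¹ := by rw [glue_inv, inv_one]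
  simp only [Matches, letterPerm, Bool.false_eq_true, if_false, if_true, inv_one]
  rw [glue_one, one_mul, h, mul_assoc, mul_assoc, mul_right_inj, inv_mul_eq_iff_eq_mul, ← mul_assoc,
    glue_mul, one_mul, mul_one]

theorem matches_iff (σ σ' : Equiv.Perm (Fin (k + k))) (η η' : Equiv.Perm (Fin k)) :
    Matches (letterPerm σ false η) (letterPerm σ' false 1) η' ↔
      σ = swapHalves k * glue η η' * σ' := by
  have h : glue (1 : Equiv.Perm (Fin k)) η⁻¹ = (glue 1 η)⁻¹ := by rw [glue_inv, inv_one]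
  simp only [Matches, letterPerm, Bool.false_eq_true, if_false, inv_one]
  rw [glue_one, one_mul, h, inv_mul_eq_iff_eq_mul, ← mul_assoc, ← mul_assoc, ← swapHalves_mul_glue,
    mul_assoc (swapHalves k), glue_mul, one_mul, mul_one]

end Matching

end TensorFlattening

/-! ### Conclusion: the limit family and its covariances -/

open TensorFlattening in
theorem theorem2p1 (k : ℕ) (hk : 1 ≤ k)
    {Ω : ℕ → Type*} [∀ N, MeasurableSpace (Ω N)]
    (P : ∀ N, MeasureTheory.Measure (Ω N)) [∀ N, MeasureTheory.IsProbabilityMeasure (P N)]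
    (M : ∀ N, Ω N → Tensor N k) (μ : ℕ → MeasureTheory.Measure ℂ) (c : ℝ) (c' : ℂ)
    (hM : IsTensorModel k P M μ c c') :
    ∃ (A : Type) (_ : Ring A) (_ : StarRing A) (_ : Algebra ℂ A) (_ : StarModule ℂ A)
      (S : OVSpace k A) (m : Equiv.Perm (Fin (k + k)) → A),
      ConvergesInSymDistribution P (fun N σ ω => flattening (M N ω) σ) S m ∧
      IsCentered S m ∧
      IsSymCircular S m ∧
      (∀ (σ σ' : Equiv.Perm (Fin (k + k))) (η : Equiv.Perm (Fin k)),
        (∀ η' : Equiv.Perm (Fin k), σ = glue η' η * σ' →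
          S.E (m σ * S.incl (u η) * star (m σ')) = (c : ℂ) • u η') ∧
        ((¬ ∃ η' : Equiv.Perm (Fin k), σ = glue η' η * σ') →
          S.E (m σ * S.incl (u η) * star (m σ')) = 0)) ∧
      (∀ (σ σ' : Equiv.Perm (Fin (k + k))) (η : Equiv.Perm (Fin k)),
        (∀ η' : Equiv.Perm (Fin k), σ = glue η η' * σ' →
          S.E (star (m σ) * S.incl (u η) * m σ') = (c : ℂ) • u η') ∧
        ((¬ ∃ η' : Equiv.Perm (Fin k), σ = glue η η' * σ') →
          S.E (star (m σ) * S.incl (u η) * m σ') = 0)) ∧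
      (∀ (σ σ' : Equiv.Perm (Fin (k + k))) (η : Equiv.Perm (Fin k)),
        (∀ η' : Equiv.Perm (Fin k), σ = swapHalves k * glue η η' * σ' →
          S.E (m σ * S.incl (u η) * m σ') = c' • u η') ∧
        ((¬ ∃ η' : Equiv.Perm (Fin k), σ = swapHalves k * glue η η' * σ') →
          S.E (m σ * S.incl (u η) * m σ') = 0)) := by
  -- The three covariances at once: the second letter carries the identity permutation, and `R` is
  -- the matching condition in the form appropriate to `ε, ε'`.
  have hcov : ∀ (σ σ' : Equiv.Perm (Fin (k + k))) (ε ε' : Bool) (η : Equiv.Perm (Fin k))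
      (w : ℂ) (R : Equiv.Perm (Fin k) → Prop), pairWeight c c' ε ε' = w →
      (∀ η', Matches (letterPerm σ ε η) (letterPerm σ' ε' 1) η' ↔ R η') →
      (∀ η', R η' → (hM.limitSpace hk).E (adj ε (flatGen σ) * (hM.limitSpace hk).incl (u η) *
        adj ε' (flatGen σ')) = w • u η') ∧
      ((¬ ∃ η', R η') → (hM.limitSpace hk).E (adj ε (flatGen σ) * (hM.limitSpace hk).incl (u η) *
        adj ε' (flatGen σ')) = 0) := by
    intro σ σ' ε ε' η w R hw hR
    have h := hM.E_letterElt_mul hk σ σ' ε ε' η 1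
    have hone : (hM.limitSpace hk).incl (u 1) = 1 := map_one (hM.limitSpace hk).incl
    rw [letterElt, letterElt, hone, mul_one, hw] at h
    rw [h]
    refine ⟨fun η' hη' => contraction_of_matches w ((hR η').2 hη'), fun hne => ?_⟩
    exact contraction_of_not_matches w fun ⟨η', hη'⟩ => hne ⟨η', (hR η').1 hη'⟩
  exact ⟨FlatAlg k, inferInstance, inferInstance, inferInstance, inferInstance, hM.limitSpace hk,
    flatGen, hM.convergesInSymDistribution hk, hM.isCentered hk, hM.isSymCircular hk,
    fun σ σ' η => hcov σ σ' false true η c _ rfl (matches_star_right_iff σ σ' η),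
    fun σ σ' η => hcov σ σ' true false η c _ rfl (matches_star_left_iff σ σ' η),
    fun σ σ' η => hcov σ σ' false false η c' _ rfl (matches_iff σ σ' η)⟩
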